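/- Let $k$ be a field of characteristic $0$, $R$ a finite-dimensional semisimple $k$-algebra, and $B$ a smooth associative $R$-algebra, i.e. $R\to B$ is a map of $k$-algebras, $B$ is finitely generated over $R$, and the bimodule $\Omega^1_R B$ of noncommutative relative 1-forms is a projective $B$-bimodule. Let $E_1,E_2$ be finitely generated projective $B$-bimodules and let $A=T_B(E_1[-1]\oplus E_2[-2])$ be the tensor algebra, graded by weight with $B,E_1,E_2$ in weights $0,1,2$; $A^n$ is its weight-$n$ part. Unadorned tensor products are over $k$. On $B\otimes B$ the outer actions are $b(x\otimes y)c=bx\otimes yc$ and the inner ones $b*(x\otimes y)*c=xc\otimes by$; similarly on $E\otimes B\oplus B\otimes E$. Let $\Omega^\bullet_R A=T_A(\Omega^1_R A)$, bigraded by weight $|\cdot|$ and form degree $\|\cdot\|$, with Koszul signs $(-1)^{|u||v|+\|u\|\|v\|}$, and let $\mathrm{DR}^\bullet_R A$ be its quotient by the span of graded commutators, with induced differential $\mathrm d$. For a graded $R$-linear double derivation $\Theta:A\to A\otimes A$ (outer structure) let $\iota_\Theta:\mathrm{DR}^\bullet_R A\to\Omega^{\bullet-1}_RA$ be the reduced contraction.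 Let $\omega\in\mathrm{DR}^2_R(A)$ be a bi-symplectic form of weight $2$: it is homogeneous of weight $2$, $\mathrm d\omega=0$ in $\mathrm{DR}^3_R A$, and $\Theta\mapsto\iota_\Theta\omega$ is an isomorphism from graded double derivations to $\Omega^1_RA$ (from weight $d$ onto weight $d+2$, for all $d\in\mathbb Z$). For homogeneous $a$ let $H_a$ be the double derivation with $\iota_{H_a}\omega=\mathrm da$, and put $⦃a,b⦄_\omega=H_a(b)\in A\otimes A$ (extended linearly in $a$) and $\{a,b\}_\omega=m(⦃a,b⦄_\omega)\in A$, where $m$ is multiplication. Put $E=E_1$ and $\langle e_1,e_2\rangle=⦃e_1,e_2⦄_\omega$ for $e_1,e_2\in E$. Then for every $S\in A^3$ the formulas $$\rho(e_1)(b)=⦃\{S,e_1\}_\omega,b⦄_\omega,\qquad [[e_1,e_2]]=⦃\{S,e_1\}_\omega,e_2⦄_\omega\qquad(e_1,e_2\in E,\ b\in B)$$ define a double pre-Courant algebroid structure on $(E,\langle-,-\rangle)$. (These elements of $A\otimes A$, and $\langle e_1,e_2\rangle$, lie in the images of $B\otimes B$, $E\otimes B\oplus B\otimes E$ and $B\otimes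 B$, respectively, and the structure is uniquely determined by these formulas.) Explicitly: * $\langle-,-\rangle:E\otimes E\to B\otimes B$ is an inner product: linear for the outer actions in the second argument and for the inner actions in the first; symmetric, $\langle e_1,e_2\rangle=\langle e_2,e_1\rangle^{\sigma}$ with $\sigma(x\otimes y)=y\otimes x$; and non-degenerate: every $k$-linear $\varphi:E\to B\otimes B$ that is linear for the inner actions equals $\langle-,q\rangle$ for a unique $q\in E$. * $\rho$ is a $B$-bimodule map from $E$ to the bimodule of $R$-linear double derivations $B\to B\otimes B$ (bimodule structure induced by the inner actions). * $[[-,-]]:E\otimes E\to E\otimes B\oplus B\otimes E$ is $k$-bilinear and $R$-bilinear (outer actions in the second argument, inner actions in the first). * For all $b\in B$ and $e,e_1,e_2\in E$: (a) $[[e_1,be_2]]=\rho(e_1)(b)\,e_2+b\,[[e_1,e_2]]$; (b) $[[e_1,e_2b]]=e_2\,\rho(e_1)(b)+[[e_1,e_2]]\,b$; (c) $\rho^\vee\mathrm d(\langle e,e\rangle)=[[e,e]]+[[e,e]]^\sigma$; (d) $\rho(e_1)(\langle e_2,e_2\rangle)=\langle[[e_1,e_2]],e_2\rangle_L+\langle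 e_2,[[e_1,e_2]]\rangle_R$ in $B^{\otimes3}$. Here $(x\otimes y)e=x\otimes ye$ and $e(x\otimes y)=ex\otimes y$. The element $\rho^\vee\mathrm db\in E$ is the one with $\langle e',\rho^\vee\mathrm db\rangle=\rho(e')(b)$ for all $e'\in E$, and $\rho^\vee\mathrm d(x\otimes y)=\rho^\vee\mathrm dx\otimes y+x\otimes\rho^\vee\mathrm dy\in E\otimes B\oplus B\otimes E$; $\sigma$ is the flip of tensor factors. In (d), $\rho(e_1)$ acts on the first tensor factor, and, writing $\langle e,e'\rangle=\sum\langle e,e'\rangle'\otimes\langle e,e'\rangle''$, $$\langle e\otimes b,e'\rangle_L=\sum\langle e,e'\rangle'\otimes b\otimes\langle e,e'\rangle'',\quad \langle b\otimes e,e'\rangle_L=0,\quad \langle e',b\otimes e\rangle_R=b\otimes\langle e',e\rangle,\quad \langle e',e\otimes b\rangle_R=0.$$ -/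

import Mathlib

open scoped TensorProduct
open MulOpposite

noncomputable section

namespace NCCourant

set_option linter.unusedSectionVars false
set_option linter.unusedSimpArgs false

/-! ## Bimodules and relative tensor algebras

Everything is over a field `k`.  A `B`-bimodule is a left module over the enveloping algebra
`Env k B = B ⊗ Bᵐᵒᵖ`; unadorned tensor products are over `k`. -/

section Bimodules

variable (k : Type*) [Field k]

/-- The enveloping algebra `Bᵉ = B ⊗ Bᵒᵖ`. -/
def Env (B : Type*) [Ring B] [Algebra k B] : Type _ := B ⊗[k] Bᵐᵒᵖ

instance (B : Type*) [Ring B] [Algebra k B] : Ring (Env k B) :=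
  inferInstanceAs (Ring (B ⊗[k] Bᵐᵒᵖ))
instance (B : Type*) [Ring B] [Algebra k B] : Algebra k (Env k B) :=
  inferInstanceAs (Algebra k (B ⊗[k] Bᵐᵒᵖ))

/-- The element `b ⊗ c` of `Bᵉ`; it acts on a bimodule by `m ↦ b m c`. -/
def Env.mk {B : Type*} [Ring B] [Algebra k B] (b c : B) : Env k B := b ⊗ₜ[k] op c

theorem Env.mk_mul {B : Type*} [Ring B] [Algebra k B] (b c : B) :
    Env.mk k b 1 * Env.mk k 1 c = Env.mk k b c :=
  (by simp : (b ⊗ₜ[k] (1 : Bᵐᵒᵖ)) * ((1 : B) ⊗ₜ[k] op c) = b ⊗ₜ[k] op c)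

theorem Env.induction {B : Type*} [Ring B] [Algebra k B] {p : Env k B → Prop} (h0 : p 0)
    (hmk : ∀ b c, p (Env.mk k b c)) (hadd : ∀ x y, p x → p y → p (x + y)) (x : Env k B) : p x :=
  TensorProduct.induction_on (motive := p) x h0 (fun b c => hmk b (unop c)) hadd

variable {B : Type*} [Ring B] [Algebra k B]
variable {M : Type*} [AddCommGroup M] [Module k M] [Module (Env k B) M]
  [IsScalarTower k (Env k B) M]

/-- The left action `m ↦ b m` on a `B`-bimodule. -/
def lact (b : B) : M →ₗ[k] M := Algebra.lsmul k k M (Env.mk k b 1)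

/-- The right action `m ↦ m b` on a `B`-bimodule. -/
def ract (b : B) : M →ₗ[k] M := Algebra.lsmul k k M (Env.mk k 1 b)

variable (B M)

/-- The relations defining the tensor algebra `T_B M`: the algebra structure of `B` and the
bimodule structure of `M`. -/
inductive TensorAlgRel : TensorAlgebra k (B × M) → TensorAlgebra k (B × M) → Prop
  | one : TensorAlgRel (TensorAlgebra.ι k ((1, 0) : B × M)) 1
  | mul (b c : B) : TensorAlgRel
      (TensorAlgebra.ι k ((b, 0) : B × M) * TensorAlgebra.ι k ((c, 0) : B × M))
      (TensorAlgebra.ι k ((b * c, 0) : B × M))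
  | left (b : B) (m : M) : TensorAlgRel
      (TensorAlgebra.ι k ((b, 0) : B × M) * TensorAlgebra.ι k ((0, m) : B × M))
      (TensorAlgebra.ι k ((0, lact k b m) : B × M))
  | right (b : B) (m : M) : TensorAlgRel
      (TensorAlgebra.ι k ((0, m) : B × M) * TensorAlgebra.ι k ((b, 0) : B × M))
      (TensorAlgebra.ι k ((0, ract k b m) : B × M))

/-- The tensor algebra `T_B M = B ⊕ M ⊕ (M ⊗_B M) ⊕ ⋯` of a bimodule `M` over the (not
necessarily commutative) algebra `B`, presented by generators and relations. -/
def TensorAlg : Type _ := RingQuot (TensorAlgRel k B M)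

instance : Ring (TensorAlg k B M) := inferInstanceAs (Ring (RingQuot (TensorAlgRel k B M)))
instance : Algebra k (TensorAlg k B M) :=
  inferInstanceAs (Algebra k (RingQuot (TensorAlgRel k B M)))

namespace TensorAlg

/-- The quotient map from the free tensor algebra. -/
def mk : TensorAlgebra k (B × M) →ₐ[k] TensorAlg k B M :=
  RingQuot.mkAlgHom k (TensorAlgRel k B M)

/-- The canonical map `B → T_B M`. -/
def base : B →ₐ[k] TensorAlg k B M :=
  AlgHom.ofLinearMap
    ((mk k B M).toLinearMap ∘ₗ TensorAlgebra.ι k ∘ₗ LinearMap.inl k B M)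
    ((RingQuot.mkAlgHom_rel k (TensorAlgRel.one (k := k) (B := B) (M := M))).trans
      (map_one (mk k B M)))
    (fun b c => ((RingQuot.mkAlgHom_rel k
      (TensorAlgRel.mul (k := k) (B := B) (M := M) b c)).symm.trans
      (map_mul (mk k B M) _ _)))

/-- The canonical map `M → T_B M`. -/
def gen : M →ₗ[k] TensorAlg k B M :=
  (mk k B M).toLinearMap ∘ₗ TensorAlgebra.ι k ∘ₗ LinearMap.inr k B M

variable {k B M}

theorem base_mul_gen (b : B) (m : M) :
    base k B M b * gen k B M m = gen k B M (lact k b m) :=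
  (map_mul (mk k B M) _ _).symm.trans (RingQuot.mkAlgHom_rel k (TensorAlgRel.left b m))

theorem gen_mul_base (b : B) (m : M) :
    gen k B M m * base k B M b = gen k B M (ract k b m) :=
  (map_mul (mk k B M) _ _).symm.trans (RingQuot.mkAlgHom_rel k (TensorAlgRel.right b m))

variable {C : Type*} [Semiring C] [Algebra k C]

/-- The universal property of `T_B M`. -/
def lift (φ : B →ₐ[k] C) (ψ : M →ₗ[k] C)
    (hl : ∀ b m, ψ (lact k b m) = φ b * ψ m) (hr : ∀ b m, ψ (ract k b m) = ψ m * φ b) :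
    TensorAlg k B M →ₐ[k] C :=
  RingQuot.liftAlgHom k ⟨TensorAlgebra.lift k (LinearMap.coprod φ.toLinearMap ψ), by
    intro x y h
    induction h <;> simp [hl, hr]⟩

theorem lift_base (φ : B →ₐ[k] C) (ψ : M →ₗ[k] C) (hl hr) (b : B) :
    lift φ ψ hl hr (base k B M b) = φ b := by
  have : lift φ ψ hl hr (mk k B M (TensorAlgebra.ι k ((b, 0) : B × M))) = φ b := by
    refine (RingQuot.liftAlgHom_mkAlgHom_apply k _ _ _).trans ?_
    simp
  exact this

theorem lift_gen (φ : B →ₐ[k] C) (ψ : M →ₗ[k] C) (hl hr) (m : M) :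
    lift φ ψ hl hr (gen k B M m) = ψ m := by
  have : lift φ ψ hl hr (mk k B M (TensorAlgebra.ι k ((0, m) : B × M))) = ψ m := by
    refine (RingQuot.liftAlgHom_mkAlgHom_apply k _ _ _).trans ?_
    simp
  exact this

theorem algHom_ext {g h : TensorAlg k B M →ₐ[k] C}
    (hb : ∀ b, g (base k B M b) = h (base k B M b))
    (hm : ∀ m, g (gen k B M m) = h (gen k B M m)) : g = h := by
  apply RingQuot.ringQuot_ext'
  apply TensorAlgebra.hom_ext
  apply LinearMap.prod_ext
  · ext b; exact hb b
  · ext m; exact hm m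

theorem induction {p : TensorAlg k B M → Prop} (hb : ∀ b, p (base k B M b))
    (hm : ∀ m, p (gen k B M m)) (hadd : ∀ x y, p x → p y → p (x + y))
    (hmul : ∀ x y, p x → p y → p (x * y)) (x : TensorAlg k B M) : p x := by
  obtain ⟨y, rfl⟩ := RingQuot.mkAlgHom_surjective k (TensorAlgRel k B M) x
  change p (mk k B M y)
  induction y using TensorAlgebra.induction with
  | algebraMap r =>
    have h := hb (algebraMap k B r)
    rw [AlgHom.commutes] at h
    rwa [AlgHom.commutes]
  | ι v =>
    have h : mk k B M (TensorAlgebra.ι k v) = base k B M v.1 + gen k B M v.2 := by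
      change _ = mk k B M (TensorAlgebra.ι k ((v.1, 0) : B × M)) +
        mk k B M (TensorAlgebra.ι k ((0, v.2) : B × M))
      rw [← map_add, ← map_add, Prod.mk_add_mk, add_zero, zero_add]
    rw [h]
    exact hadd _ _ (hb _) (hm _)
  | mul x y hx hy => rw [map_mul]; exact hmul _ _ hx hy
  | add x y hx hy => rw [map_add]; exact hadd _ _ hx hy

end TensorAlg

end Bimodules

/-! ## Noncommutative differential forms -/

section Forms

variable {k : Type*} [Field k]
variable {R : Type*} [Ring R] [Algebra k R]
variable {A : Type*} [Ring A] [Algebra k A]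
variable (f : R →ₐ[k] A)

/-- The relations between the symbols `d a` in `Ω¹_R A`: `k`-linearity, the Leibniz rule and
`d r = 0` for `r` in `R`. -/
inductive KaehlerRel : (A →₀ Env k A) → Prop
  | add (a b : A) : KaehlerRel
      (Finsupp.single (a + b) 1 - (Finsupp.single a 1 + Finsupp.single b 1))
  | smul (c : k) (a : A) : KaehlerRel (Finsupp.single (c • a) 1 - c • Finsupp.single a 1)
  | leibniz (a b : A) : KaehlerRel
      (Finsupp.single (a * b) 1 -
        (Finsupp.single a (Env.mk k 1 b) + Finsupp.single b (Env.mk k a 1)))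
  | base (r : R) : KaehlerRel (Finsupp.single (f r) 1)

/-- The `A`-bimodule `Ω¹_R A` of noncommutative 1-forms of `A` relative to `f : R → A`. -/
abbrev Kaehler : Type _ :=
  (A →₀ Env k A) ⧸ Submodule.span (Env k A) {x | KaehlerRel f x}

/-- The universal derivation `d : A → Ω¹_R A`. -/
def Kaehler.d : A →ₗ[k] Kaehler f where
  toFun a := Submodule.Quotient.mk (Finsupp.single a 1)
  map_add' a b := by
    rw [← Submodule.Quotient.mk_add, Submodule.Quotient.eq]
    exact Submodule.subset_span (KaehlerRel.add a b)
  map_smul' c a := by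
    rw [RingHom.id_apply, ← Submodule.Quotient.mk_smul, Submodule.Quotient.eq]
    exact Submodule.subset_span (KaehlerRel.smul c a)

theorem Kaehler.d_mul (a b : A) :
    Kaehler.d f (a * b) = ract k b (Kaehler.d f a) + lact k a (Kaehler.d f b) := by
  have h : ∀ (e : Env k A) (c : A), e • (Submodule.Quotient.mk (Finsupp.single c 1) : Kaehler f) =
      Submodule.Quotient.mk (Finsupp.single c e) := by
    intro e c
    rw [← Submodule.Quotient.mk_smul, Finsupp.smul_single, smul_eq_mul, mul_one]
  change (Submodule.Quotient.mk _ : Kaehler f) =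
    Env.mk k 1 b • (Submodule.Quotient.mk (Finsupp.single a 1) : Kaehler f) +
    Env.mk k a 1 • (Submodule.Quotient.mk (Finsupp.single b 1) : Kaehler f)
  rw [h, h, ← Submodule.Quotient.mk_add, Submodule.Quotient.eq]
  exact Submodule.subset_span (KaehlerRel.leibniz a b)

theorem Kaehler.d_base (r : R) : Kaehler.d f (f r) = 0 := by
  change (Submodule.Quotient.mk _ : Kaehler f) = 0
  rw [Submodule.Quotient.mk_eq_zero]
  exact Submodule.subset_span (KaehlerRel.base r)

section Lift

variable {C : Type*} [Ring C] [Algebra k C]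

/-- `C` as a module over `Aᵉ` along an algebra map `φ : A → C`. -/
def envHom (φ : A →ₐ[k] C) : Env k A →ₐ[k] Module.End k C :=
  Algebra.TensorProduct.lift ((Algebra.lmul k C).comp φ)
    (AlgHom.ofLinearMap
      ((LinearMap.mul k C).flip ∘ₗ φ.toLinearMap ∘ₗ
        (MulOpposite.opLinearEquiv k (M := A)).symm.toLinearMap)
      (by ext; simp) (by intro x y; ext; simp [mul_assoc]))
    (by intro a b; ext; simp [mul_assoc])

theorem envHom_mk (φ : A →ₐ[k] C) (a b : A) (c : C) :
    envHom φ (Env.mk k a b) c = φ a * (c * φ b) :=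
  congrArg (fun g : Module.End k C => g c) (Algebra.TensorProduct.lift_tmul _ _ _ a (op b))

/-- The universal property of `Ω¹_R A`, for derivations with values in an algebra over `A`. -/
theorem Kaehler.exists_lift (φ : A →ₐ[k] C) (δ : A →ₗ[k] C)
    (hδ : ∀ a b, δ (a * b) = δ a * φ b + φ a * δ b) (hR : ∀ r, δ (f r) = 0) :
    ∃ ψ : Kaehler f →ₗ[k] C, (∀ a, ψ (Kaehler.d f a) = δ a) ∧
      (∀ b m, ψ (lact k b m) = φ b * ψ m) ∧ (∀ b m, ψ (ract k b m) = ψ m * φ b) := by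
  let _ : Module (Env k A) C := Module.compHom C (envHom φ).toRingHom
  have hs : ∀ (e : Env k A) (c : C), e • c = envHom φ e c := fun _ _ => rfl
  have : IsScalarTower k (Env k A) C := ⟨fun r e c => by simp [hs]⟩
  let g : (A →₀ Env k A) →ₗ[Env k A] C := Finsupp.linearCombination (Env k A) (fun a => δ a)
  have hg : Submodule.span (Env k A) {x | KaehlerRel f x} ≤ LinearMap.ker g := by
    rw [Submodule.span_le]
    rintro x (hx : KaehlerRel f x)
    rw [SetLike.mem_coe, LinearMap.mem_ker]
    induction hx with
    | add a b => simp [g]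
    | smul c a =>
      rw [map_sub, Finsupp.smul_single]
      simp [g, Finsupp.linearCombination_single, hs]
    | leibniz a b => simp [g, Finsupp.linearCombination_single, hs, envHom_mk, hδ]
    | base r => simp [g, Finsupp.linearCombination_single, hR]
  let ψ := Submodule.liftQ _ g hg
  refine ⟨ψ.restrictScalars k, fun a => ?_, fun b m => ?_, fun b m => ?_⟩
  · change g (Finsupp.single a 1) = _
    simp [g]
  · change ψ ((_ : Env k A) • m) = _
    rw [map_smul, hs, envHom_mk]; simp
  · change ψ ((_ : Env k A) • m) = _
    rw [map_smul, hs, envHom_mk]; simp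

/-- The bimodule map out of `Ω¹_R A` determined by a derivation. -/
def Kaehler.lift (φ : A →ₐ[k] C) (δ : A →ₗ[k] C)
    (hδ : ∀ a b, δ (a * b) = δ a * φ b + φ a * δ b) (hR : ∀ r, δ (f r) = 0) :
    Kaehler f →ₗ[k] C :=
  (Kaehler.exists_lift f φ δ hδ hR).choose

end Lift

/-- The algebra `Ω_R A = T_A (Ω¹_R A)` of noncommutative differential forms. -/
abbrev Forms : Type _ := TensorAlg k A (Kaehler f)

namespace Forms

/-- The inclusion of functions, `A → Ω_R A`. -/
abbrev of : A →ₐ[k] Forms f := TensorAlg.base k A (Kaehler f)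

/-- The 1-form `d a`, as an element of `Ω_R A`. -/
def δ : A →ₗ[k] Forms f := TensorAlg.gen k A (Kaehler f) ∘ₗ Kaehler.d f

theorem δ_mul (a b : A) : δ f (a * b) = δ f a * of f b + of f a * δ f b := by
  simp only [δ, LinearMap.comp_apply, Kaehler.d_mul, map_add, TensorAlg.gen_mul_base,
    TensorAlg.base_mul_gen]

theorem δ_base (r : R) : δ f (f r) = 0 := by
  simp [δ, Kaehler.d_base]

theorem induction {p : Forms f → Prop} (ho : ∀ a, p (of f a)) (hδ : ∀ a, p (δ f a))
    (hadd : ∀ x y, p x → p y → p (x + y)) (hmul : ∀ x y, p x → p y → p (x * y))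
    (x : Forms f) : p x := by
  refine TensorAlg.induction ho (fun m => ?_) hadd hmul x
  have h0 : p 0 := by simpa using ho 0
  have key : ∀ (e : Env k A) (a : A), p (TensorAlg.gen k A (Kaehler f) (e • Kaehler.d f a)) := by
    intro e a
    induction e using Env.induction with
    | h0 => rw [zero_smul, map_zero]; exact h0
    | hmk b c =>
      rw [← Env.mk_mul, mul_smul]
      change p (TensorAlg.gen k A (Kaehler f) (lact k b (ract k c (Kaehler.d f a))))
      rw [← TensorAlg.base_mul_gen, ← TensorAlg.gen_mul_base]
      exact hmul _ _ (ho _) (hmul _ _ (hδ a) (ho _))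
    | hadd x y hx hy => rw [add_smul, map_add]; exact hadd _ _ hx hy
  obtain ⟨y, rfl⟩ := Submodule.Quotient.mk_surjective _ m
  induction y using Finsupp.induction_linear with
  | zero => rw [Submodule.Quotient.mk_zero, map_zero]; exact h0
  | add x y hx hy => rw [Submodule.Quotient.mk_add, map_add]; exact hadd _ _ hx hy
  | single a e =>
    have h := key e a
    change p (TensorAlg.gen k A (Kaehler f) (e • Submodule.Quotient.mk _)) at h
    rwa [← Submodule.Quotient.mk_smul, Finsupp.smul_single, smul_eq_mul, mul_one] at h

variable {C : Type*} [Ring C] [Algebra k C]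

/-- The universal property of `Ω_R A`: an algebra map on `A` and a derivation along it determine
an algebra map on `Ω_R A`. -/
def lift (φ : A →ₐ[k] C) (D : A →ₗ[k] C)
    (hD : ∀ a b, D (a * b) = D a * φ b + φ a * D b) (hR : ∀ r, D (f r) = 0) :
    Forms f →ₐ[k] C :=
  TensorAlg.lift φ (Kaehler.lift f φ D hD hR)
    (Kaehler.exists_lift f φ D hD hR).choose_spec.2.1
    (Kaehler.exists_lift f φ D hD hR).choose_spec.2.2

theorem lift_of (φ : A →ₐ[k] C) (D : A →ₗ[k] C) (hD hR) (a : A) :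
    lift f φ D hD hR (of f a) = φ a := TensorAlg.lift_base _ _ _ _ _

theorem lift_δ (φ : A →ₐ[k] C) (D : A →ₗ[k] C) (hD hR) (a : A) :
    lift f φ D hD hR (δ f a) = D a :=
  (TensorAlg.lift_gen _ _ _ _ _).trans
    ((Kaehler.exists_lift f φ D hD hR).choose_spec.1 a)

/-- The form-degree sign `α ↦ (-1)^{‖α‖} α`. -/
def formSign : Forms f →ₐ[k] Forms f :=
  lift f (of f) (-δ f) (by intro a b; simp [δ_mul]; abel) (by intro r; simp [δ_base])

section TwistedDerivation

variable {T : Type*} [Ring T] [Algebra k T]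
variable (γ j : Forms f →ₐ[k] T) (D₀ D₁ : A →ₗ[k] T)

/-- On 1-forms, the representation `α ↦ ((x, t) ↦ (α x, D(α) j(x) + γ(α) t))` attached to a
twisted derivation `D`. -/
def twistedRepAux (D : A →ₗ[k] T) (φ : A →ₗ[k] Forms f) :
    A →ₗ[k] Module.End k (Forms f × T) where
  toFun a := LinearMap.prod
    (LinearMap.mulLeft k (φ a) ∘ₗ LinearMap.fst k _ _)
    (LinearMap.mulLeft k (D a) ∘ₗ j.toLinearMap ∘ₗ LinearMap.fst k _ _ +
      LinearMap.mulLeft k (γ (φ a)) ∘ₗ LinearMap.snd k _ _)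
  map_add' a b := by ext <;> simp [add_mul]
  map_smul' c a := by ext <;> simp

theorem twistedRepAux_apply (D : A →ₗ[k] T) (φ : A →ₗ[k] Forms f) (a : A) (p : Forms f × T) :
    twistedRepAux f γ j D φ a p = (φ a * p.1, D a * j p.1 + γ (φ a) * p.2) := rfl

/-- A twisted derivation `D : Ω_R A → T`, `D(αβ) = D(α) j(β) + γ(α) D(β)`, is determined by
arbitrary compatible values `D₀ a` of `D(a)` and `D₁ a` of `D(d a)`. -/
theorem exists_twistedDer
    (h₀ : ∀ a b, D₀ (a * b) = D₀ a * j (of f b) + γ (of f a) * D₀ b)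
    (h₁ : ∀ a b, D₁ (a * b) = (D₁ a * j (of f b) + γ (δ f a) * D₀ b) +
      (D₀ a * j (δ f b) + γ (of f a) * D₁ b))
    (hR : ∀ r, D₁ (f r) = 0) :
    ∃ D : Forms f →ₗ[k] T, (∀ a, D (of f a) = D₀ a) ∧ (∀ a, D (δ f a) = D₁ a) ∧
      ∀ α β, D (α * β) = D α * j β + γ α * D β := by
  have h1 : D₀ 1 = 0 := by simpa using h₀ 1 1
  let φ : A →ₐ[k] Module.End k (Forms f × T) :=
    AlgHom.ofLinearMap (twistedRepAux f γ j D₀ (of f).toLinearMap)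
      (LinearMap.ext fun p => by simp [twistedRepAux_apply, h1])
      (fun a b => LinearMap.ext fun p => by
        simp [twistedRepAux_apply, h₀, mul_assoc, add_mul, mul_add, add_assoc])
  let Φ : Forms f →ₐ[k] Module.End k (Forms f × T) :=
    lift f φ (twistedRepAux f γ j D₁ (δ f))
      (fun a b => LinearMap.ext fun p => by
        simp [φ, twistedRepAux_apply, h₁, δ_mul, mul_assoc, add_mul, mul_add]
        abel)
      (fun r => LinearMap.ext fun p => by simp [twistedRepAux_apply, hR, δ_base])
  have hof : ∀ a p, Φ (of f a) p = (of f a * p.1, D₀ a * j p.1 + γ (of f a) * p.2) := by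
    intro a p
    simp only [Φ, lift_of]
    rfl
  have hδ : ∀ a p, Φ (δ f a) p = (δ f a * p.1, D₁ a * j p.1 + γ (δ f a) * p.2) := by
    intro a p
    simp only [Φ, lift_δ]
    rfl
  let D : Forms f →ₗ[k] T := LinearMap.snd k _ _ ∘ₗ LinearMap.applyₗ ((1, 0) : Forms f × T) ∘ₗ
    Φ.toLinearMap
  have hD : ∀ α, D α = (Φ α (1, 0)).2 := fun _ => rfl
  have key : ∀ α, ∀ p, Φ α p = (α * p.1, D α * j p.1 + γ α * p.2) := by
    intro α
    induction α using Forms.induction with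
    | ho a => intro p; rw [hD, hof, hof]; simp
    | hδ a => intro p; rw [hD, hδ, hδ]; simp
    | hadd x y hx hy =>
      intro p
      rw [map_add, LinearMap.add_apply, hx, hy, map_add, map_add]
      ext <;> simp [add_mul]
      abel
    | hmul x y hx hy =>
      intro p
      have hxy : D (x * y) = D x * j y + γ x * D y := by
        rw [hD (x * y), map_mul, Module.End.mul_apply, hx, hy]; simp
      rw [map_mul, Module.End.mul_apply, hx, hy, hxy]
      ext <;> simp [add_mul, mul_add, mul_assoc, add_assoc]
  refine ⟨D, fun a => ?_, fun a => ?_, fun α β => ?_⟩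
  · rw [hD, hof]; simp
  · rw [hD, hδ]; simp
  · rw [hD (α * β), map_mul, Module.End.mul_apply, key, key]; simp

end TwistedDerivation

theorem formSign_of (a : A) : formSign f (of f a) = of f a := lift_of _ _ _ _ _ _

theorem formSign_δ (a : A) : formSign f (δ f a) = -δ f a := lift_δ _ _ _ _ _ _

theorem exists_d : ∃ D : Forms f →ₗ[k] Forms f, (∀ a, D (of f a) = δ f a) ∧
    (∀ a, D (δ f a) = 0) ∧ ∀ α β, D (α * β) = D α * β + formSign f α * D β := by
  have := exists_twistedDer f (formSign f) (AlgHom.id k _) (δ f) 0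
    (fun a b => by rw [formSign_of, δ_mul]; rfl)
    (fun a b => by rw [formSign_of, formSign_δ]; simp) (fun r => by simp)
  simpa using this

/-- The de Rham differential, the derivation of form degree 1 with `d(a) = d a`, `d(d a) = 0`
and `d(αβ) = (dα)β + (-1)^{‖α‖} α dβ`. -/
def d : Forms f →ₗ[k] Forms f := (exists_d f).choose

theorem d_of (a : A) : d f (of f a) = δ f a := (exists_d f).choose_spec.1 a
theorem d_δ (a : A) : d f (δ f a) = 0 := (exists_d f).choose_spec.2.1 a
theorem d_mul (α β : Forms f) : d f (α * β) = d f α * β + formSign f α * d f β :=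
  (exists_d f).choose_spec.2.2 α β

end Forms

/-! ## Weights, double derivations and contractions

`A` is an `ℕ`-graded algebra with `R` mapping to weight `0`.  The sign rule on `Ω_R A` is the
bigraded Koszul rule for (weight, form degree). -/

/-- The sign `(-1)^n` in `k`. -/
def sgn (k : Type*) [Field k] (n : ℤ) : k := ((n.negOnePow : ℤ) : k)

theorem sgn_add (m n : ℤ) : sgn k (m + n) = sgn k m * sgn k n := by
  simp [sgn, Int.negOnePow_add]

theorem sgn_zero : sgn k 0 = 1 := by simp [sgn]

theorem sgn_one : sgn k 1 = -1 := by simp [sgn]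

theorem sgn_congr {m n : ℤ} (h : Even (m - n)) : sgn k m = sgn k n := by
  rw [sgn, sgn, (Int.negOnePow_eq_iff m n).2 h]

theorem sgn_mul_self (n : ℤ) : sgn k n * sgn k n = 1 := by
  rw [← sgn_add, sgn_congr (n := 0) (by simp), sgn_zero]

variable (𝒜 : ℕ → Submodule k A) [GradedAlgebra 𝒜]

/-- The algebra automorphism `a ↦ (-1)^{d|a|} a`. -/
def weightSign (d : ℤ) : A →ₐ[k] A :=
  (DirectSum.toAlgebra k (fun i => 𝒜 i)
    (fun i => sgn k (d * i) • (𝒜 i).subtype)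
    (by simp [GradedMonoid.GOne.one, sgn_zero])
    (fun {i j} x y => by
      simp [GradedMonoid.GMul.mul, mul_add, sgn_add, smul_smul, mul_comm])).comp
    (DirectSum.decomposeAlgEquiv 𝒜 : A →ₐ[k] DirectSum ℕ fun i => 𝒜 i)

theorem weightSign_of_mem (d : ℤ) {n : ℕ} {a : A} (ha : a ∈ 𝒜 n) :
    weightSign 𝒜 d a = sgn k (d * n) • a := by
  have h : DirectSum.decompose 𝒜 a = DirectSum.of (fun i => 𝒜 i) n ⟨a, ha⟩ :=
    DirectSum.decompose_of_mem 𝒜 ha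
  change DirectSum.toModule k ℕ A (fun i => sgn k (d * i) • (𝒜 i).subtype)
    (DirectSum.decompose 𝒜 a) = _
  rw [h]
  exact (DirectSum.toModule_lof (M := fun i => 𝒜 i) k n ⟨a, ha⟩).trans rfl

/-- The weight `m` part of `A ⊗ A`. -/
def tensorPart (m : ℤ) : Submodule k (A ⊗[k] A) :=
  Submodule.span k {t | ∃ (i j : ℕ) (a b : A),
    a ∈ 𝒜 i ∧ b ∈ 𝒜 j ∧ (i + j : ℤ) = m ∧ t = a ⊗ₜ b}

/-- An `R`-linear graded double derivation of `A` of weight `d`, that is, a derivation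
`A → (A ⊗ A)_out` of weight `d` vanishing on `R`. -/
structure DoubleDer (d : ℤ) where
  /-- The underlying linear map. -/
  toLin : A →ₗ[k] A ⊗[k] A
  map_weight : ∀ (n : ℕ), ∀ a ∈ 𝒜 n, toLin a ∈ tensorPart 𝒜 (n + d)
  leibniz : ∀ (n : ℕ), ∀ a ∈ 𝒜 n, ∀ b : A,
    toLin (a * b) = toLin a * (1 ⊗ₜ b) + sgn k (d * n) • ((a ⊗ₜ 1) * toLin b)
  map_base : ∀ r, toLin (f r) = 0

theorem DoubleDer.leibniz' {d : ℤ} (Θ : DoubleDer f 𝒜 d) (a b : A) :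
    Θ.toLin (a * b) = Θ.toLin a * (1 ⊗ₜ b) + (weightSign 𝒜 d a ⊗ₜ 1) * Θ.toLin b := by
  induction a using DirectSum.Decomposition.inductionOn 𝒜 with
  | zero => simp
  | @homogeneous n a =>
    rw [Θ.leibniz n a a.2, weightSign_of_mem 𝒜 d a.2, ← TensorProduct.smul_tmul',
      smul_mul_assoc]
  | add x y hx hy => simp only [add_mul, map_add, hx, hy, TensorProduct.add_tmul]; abel

namespace Forms

/-- Products of elements `a` and `d a`, with `a` homogeneous; `p` is the form degree and `w` the
weight. -/
inductive IsMonomial : ℕ → ℤ → Forms f → Prop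
  | of {n : ℕ} {a : A} (ha : a ∈ 𝒜 n) : IsMonomial 0 n (of f a)
  | δ {n : ℕ} {a : A} (ha : a ∈ 𝒜 n) : IsMonomial 1 n (δ f a)
  | mul {p q : ℕ} {v w : ℤ} {α β : Forms f} (hα : IsMonomial p v α) (hβ : IsMonomial q w β) :
      IsMonomial (p + q) (v + w) (α * β)

/-- The forms of degree `p` and weight `w`. -/
def homog (p : ℕ) (w : ℤ) : Submodule k (Forms f) := Submodule.span k {α | IsMonomial f 𝒜 p w α}

/-- The span of the bigraded commutators in `Ω_R A`. -/
def commutators : Submodule k (Forms f) :=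
  Submodule.span k {x | ∃ (p q : ℕ) (v w : ℤ), ∃ α ∈ homog f 𝒜 p v, ∃ β ∈ homog f 𝒜 q w,
    x = α * β - sgn k (v * w + p * q) • (β * α)}

theorem mul_mem_homog {p q : ℕ} {v w : ℤ} {α β : Forms f} (hα : α ∈ homog f 𝒜 p v)
    (hβ : β ∈ homog f 𝒜 q w) : α * β ∈ homog f 𝒜 (p + q) (v + w) := by
  have := Submodule.mul_mem_mul hα hβ
  rw [homog, homog, Submodule.span_mul_span] at this
  refine Submodule.span_mono ?_ this
  rintro _ ⟨x, hx, y, hy, rfl⟩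
  exact IsMonomial.mul hx hy

theorem formSign_of_mem {p : ℕ} {w : ℤ} {α : Forms f} (h : α ∈ homog f 𝒜 p w) :
    formSign f α = sgn k p • α := by
  have hle : homog f 𝒜 p w ≤ LinearMap.eqLocus (formSign f).toLinearMap
      (sgn k p • LinearMap.id) := by
    refine Submodule.span_le.2 fun α hα => ?_
    change formSign f α = sgn k p • α
    clear h
    induction hα with
    | of ha => simp [formSign_of, sgn_zero]
    | δ ha => simp [formSign_δ, sgn_one]
    | mul _ _ h1 h2 => rw [map_mul, h1, h2, smul_mul_smul_comm, ← sgn_add]; norm_cast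
  exact hle h

theorem d_mem_homog {p : ℕ} {w : ℤ} {α : Forms f} (h : α ∈ homog f 𝒜 p w) :
    d f α ∈ homog f 𝒜 (p + 1) w := by
  have hle : homog f 𝒜 p w ≤ (homog f 𝒜 (p + 1) w).comap (d f) := by
    refine Submodule.span_le.2 fun α hα => ?_
    change d f α ∈ homog f 𝒜 (p + 1) w
    clear h
    induction hα with
    | of ha => rw [d_of]; exact Submodule.subset_span (.δ ha)
    | δ ha => rw [d_δ]; exact zero_mem _
    | @mul p q v w α β hα hβ h1 h2 =>
      have hα' : α ∈ homog f 𝒜 p v := Submodule.subset_span hα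
      have hβ' : β ∈ homog f 𝒜 q w := Submodule.subset_span hβ
      rw [d_mul, formSign_of_mem f 𝒜 hα']
      refine add_mem ?_ ?_
      · have := mul_mem_homog f 𝒜 h1 hβ'
        rwa [show p + 1 + q = p + q + 1 by ring] at this
      · rw [smul_mul_assoc]
        exact Submodule.smul_mem _ _ (by
          simpa only [add_assoc] using mul_mem_homog f 𝒜 hα' h2)
  exact hle h

theorem d_mem_commutators {x : Forms f} (hx : x ∈ commutators f 𝒜) :
    d f x ∈ commutators f 𝒜 := by
  have hle : commutators f 𝒜 ≤ (commutators f 𝒜).comap (d f) := by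
    refine Submodule.span_le.2 ?_
    rintro _ ⟨p, q, v, w, α, hα, β, hβ, rfl⟩
    have h1 : d f α * β - sgn k (v * w + (p + 1 : ℕ) * q) • (β * d f α) ∈ commutators f 𝒜 :=
      Submodule.subset_span ⟨_, _, _, _, _, d_mem_homog f 𝒜 hα, _, hβ, rfl⟩
    have h2 : α * d f β - sgn k (v * w + p * (q + 1 : ℕ)) • (d f β * α) ∈ commutators f 𝒜 :=
      Submodule.subset_span ⟨_, _, _, _, _, hα, _, d_mem_homog f 𝒜 hβ, rfl⟩
    have h3 := add_mem h1 (Submodule.smul_mem _ (sgn k p) h2)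
    rw [SetLike.mem_coe, Submodule.mem_comap]
    convert h3 using 1
    rw [map_sub, map_smul, d_mul, d_mul, formSign_of_mem f 𝒜 hα, formSign_of_mem f 𝒜 hβ]
    have e1 : sgn k (v * w + (p + 1 : ℕ) * q) = sgn k (v * w + p * q) * sgn k q := by
      rw [← sgn_add]; congr 1; push_cast; ring
    have e2 : sgn k (v * w + p * (q + 1 : ℕ)) = sgn k (v * w + p * q) * sgn k p := by
      rw [← sgn_add]; congr 1; push_cast; ring
    have e3 : sgn k p * (sgn k (v * w + p * q) * sgn k p) = sgn k (v * w + p * q) := by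
      rw [mul_left_comm, sgn_mul_self, mul_one]
    rw [e1, e2, smul_sub, smul_smul, e3, smul_add, smul_mul_assoc, smul_mul_assoc, smul_smul]
    abel
  exact hle hx

end Forms

/-- The Karoubi–de Rham space `DR_R A = Ω_R A / [Ω_R A, Ω_R A]`. -/
abbrev DR : Type _ := Forms f ⧸ Forms.commutators f 𝒜

namespace DR

/-- The component of form degree `p` and weight `w` of `DR_R A`. -/
def homog (p : ℕ) (w : ℤ) : Submodule k (DR f 𝒜) :=
  (Forms.homog f 𝒜 p w).map (Forms.commutators f 𝒜).mkQ

/-- The differential induced on `DR_R A`. -/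
def d : DR f 𝒜 →ₗ[k] DR f 𝒜 :=
  Submodule.mapQ _ _ (Forms.d f) fun _ hx => Forms.d_mem_commutators f 𝒜 hx

end DR

section Contraction

variable {f} {𝒜} (hf : ∀ r, f r ∈ 𝒜 0)

theorem weightSign_base (hf : ∀ r, f r ∈ 𝒜 0) (d : ℤ) (r : R) :
    weightSign 𝒜 d (f r) = f r := by
  rw [weightSign_of_mem 𝒜 d (hf r)]; simp [sgn_zero]

namespace Forms

/-- The weight sign `α ↦ (-1)^{d|α|} α` on forms. -/
def weightSign (d : ℤ) : Forms f →ₐ[k] Forms f :=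
  lift f ((of f).comp (NCCourant.weightSign 𝒜 d)) (δ f ∘ₗ (NCCourant.weightSign 𝒜 d).toLinearMap)
    (fun a b => by simp [δ_mul])
    (fun r => by simp [weightSign_base hf, δ_base])

theorem weightSign_of (d : ℤ) (a : A) :
    weightSign hf d (of f a) = of f (NCCourant.weightSign 𝒜 d a) := lift_of _ _ _ _ _ _

theorem weightSign_δ (d : ℤ) (a : A) :
    weightSign hf d (δ f a) = δ f (NCCourant.weightSign 𝒜 d a) := lift_δ _ _ _ _ _ _

theorem weightSign_of_mem (d : ℤ) {p : ℕ} {w : ℤ} {α : Forms f} (h : α ∈ homog f 𝒜 p w) :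
    weightSign hf d α = sgn k (d * w) • α := by
  have hle : homog f 𝒜 p w ≤ LinearMap.eqLocus (weightSign hf d).toLinearMap
      (sgn k (d * w) • LinearMap.id) := by
    refine Submodule.span_le.2 fun α hα => ?_
    change weightSign hf d α = sgn k (d * w) • α
    clear h
    induction hα with
    | of ha => rw [weightSign_of, NCCourant.weightSign_of_mem 𝒜 d ha, map_smul]
    | δ ha => rw [weightSign_δ, NCCourant.weightSign_of_mem 𝒜 d ha, map_smul]
    | mul _ _ h1 h2 => rw [map_mul, h1, h2, smul_mul_smul_comm, ← sgn_add, mul_add]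
  exact hle h

/-- The sign `α ↦ (-1)^{d|α| - ‖α‖} α` by which an operator of bidegree `(d, -1)` passes `α`. -/
def passSign (d : ℤ) : Forms f →ₐ[k] Forms f := (formSign f).comp (weightSign hf d)

theorem exists_contraction {d : ℤ} (Θ : DoubleDer f 𝒜 d) :
    ∃ i : Forms f →ₗ[k] Forms f ⊗[k] Forms f,
      (∀ a, i (of f a) = 0) ∧
      (∀ a, i (δ f a) = TensorProduct.map (of f).toLinearMap (of f).toLinearMap (Θ.toLin a)) ∧
      ∀ α β, i (α * β) = i α * (1 ⊗ₜ β) + (passSign hf d α ⊗ₜ 1) * i β := by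
  have hmul : ∀ s t : A ⊗[k] A, TensorProduct.map (of f).toLinearMap (of f).toLinearMap (s * t) =
      TensorProduct.map (of f).toLinearMap (of f).toLinearMap s *
        TensorProduct.map (of f).toLinearMap (of f).toLinearMap t :=
    fun s t => map_mul (Algebra.TensorProduct.map (of f) (of f)) s t
  obtain ⟨i, h1, h2, h3⟩ := exists_twistedDer f
    (T := Forms f ⊗[k] Forms f)
    (Algebra.TensorProduct.includeLeft.comp (passSign hf d))
    Algebra.TensorProduct.includeRight 0
    (TensorProduct.map (of f).toLinearMap (of f).toLinearMap ∘ₗ Θ.toLin)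
    (fun a b => by simp)
    (fun a b => by
      simp only [LinearMap.comp_apply, Θ.leibniz', map_add, hmul]
      simp [passSign, weightSign_of, formSign_of])
    (fun r => by simp [Θ.map_base])
  exact ⟨i, h1, h2, h3⟩

/-- The contraction `i_Θ : Ω → Ω ⊗ Ω`, the double derivation of bidegree `(d, -1)` with
`i_Θ(a) = 0` and `i_Θ(d a) = Θ(a)`. -/
def contraction {d : ℤ} (Θ : DoubleDer f 𝒜 d) : Forms f →ₗ[k] Forms f ⊗[k] Forms f :=
  (exists_contraction hf Θ).choose

theorem contraction_of {d : ℤ} (Θ : DoubleDer f 𝒜 d) (a : A) : contraction hf Θ (of f a) = 0 :=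
  (exists_contraction hf Θ).choose_spec.1 a

theorem contraction_δ {d : ℤ} (Θ : DoubleDer f 𝒜 d) (a : A) : contraction hf Θ (δ f a) =
    TensorProduct.map (of f).toLinearMap (of f).toLinearMap (Θ.toLin a) :=
  (exists_contraction hf Θ).choose_spec.2.1 a

theorem contraction_mul {d : ℤ} (Θ : DoubleDer f 𝒜 d) (α β : Forms f) :
    contraction hf Θ (α * β) =
      contraction hf Θ α * (1 ⊗ₜ β) + (passSign hf d α ⊗ₜ 1) * contraction hf Θ β :=
  (exists_contraction hf Θ).choose_spec.2.2 α β

end Forms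

/-- For an involution `ε` with eigenvalues `(-1)^{|x|}`, the map
`x ⊗ y ↦ (-1)^{|x||y|} x ⊗ y = ½ (x ⊗ y + εx ⊗ y + x ⊗ εy - εx ⊗ εy)`. -/
def koszulTwist {V : Type*} [AddCommGroup V] [Module k V] (ε : V →ₗ[k] V) :
    V ⊗[k] V →ₗ[k] V ⊗[k] V :=
  (2⁻¹ : k) • (LinearMap.id + TensorProduct.map ε LinearMap.id +
    TensorProduct.map LinearMap.id ε - TensorProduct.map ε ε)

theorem koszulTwist_tmul [CharZero k] {V : Type*} [AddCommGroup V] [Module k V] {ε : V →ₗ[k] V}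
    {x y : V} {m n : ℤ} (hx : ε x = sgn k m • x) (hy : ε y = sgn k n • y) :
    koszulTwist ε (x ⊗ₜ[k] y) = sgn k (m * n) • (x ⊗ₜ[k] y) := by
  have hs : (2⁻¹ : k) * (1 + sgn k m + sgn k n - sgn k m * sgn k n) = sgn k (m * n) := by
    rcases Int.even_or_odd m with hm | hm <;> rcases Int.even_or_odd n with hn | hn <;>
      simp [sgn, Int.negOnePow_even, Int.negOnePow_odd, hm, hn, Int.even_mul, Int.odd_mul] <;>
      norm_num
  simp only [koszulTwist, LinearMap.smul_apply, LinearMap.sub_apply, LinearMap.add_apply,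
    LinearMap.id_apply, TensorProduct.map_tmul, hx, hy, TensorProduct.tmul_smul,
    ← TensorProduct.smul_tmul', smul_smul]
  rw [← hs]
  module

namespace Forms

/-- The map `°(x ⊗ y) = (-1)^{|x||y| + ‖x‖‖y‖} y x`. -/
def circ : Forms f ⊗[k] Forms f →ₗ[k] Forms f :=
  LinearMap.mul' k (Forms f) ∘ₗ (TensorProduct.comm k (Forms f) (Forms f)).toLinearMap ∘ₗ
    koszulTwist (weightSign hf 1).toLinearMap ∘ₗ koszulTwist (formSign f).toLinearMap

theorem circ_tmul [CharZero k] {p q : ℕ} {v w : ℤ} {x y : Forms f} (hx : x ∈ homog f 𝒜 p v)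
    (hy : y ∈ homog f 𝒜 q w) : circ hf (x ⊗ₜ y) = sgn k (v * w + p * q) • (y * x) := by
  simp only [circ, LinearMap.comp_apply]
  rw [koszulTwist_tmul (formSign_of_mem f 𝒜 hx) (formSign_of_mem f 𝒜 hy), map_smul,
    koszulTwist_tmul (m := v) (n := w) (by simpa using weightSign_of_mem hf 1 hx)
      (by simpa using weightSign_of_mem hf 1 hy), smul_smul, map_smul, map_smul, ← sgn_add,
    add_comm]
  rfl

/-- The span of the `x ⊗ y` of total form degree `p - 1` and weight `w`. -/
def tensorHomog (p : ℕ) (w : ℤ) : Submodule k (Forms f ⊗[k] Forms f) :=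
  Submodule.span k {t | ∃ (p₁ p₂ : ℕ) (w₁ w₂ : ℤ), ∃ x ∈ homog f 𝒜 p₁ w₁,
    ∃ y ∈ homog f 𝒜 p₂ w₂, p₁ + p₂ + 1 = p ∧ w₁ + w₂ = w ∧ t = x ⊗ₜ y}

theorem contraction_mem {d : ℤ} (Θ : DoubleDer f 𝒜 d) {p : ℕ} {w : ℤ} {α : Forms f}
    (h : α ∈ homog f 𝒜 p w) :
    contraction hf Θ α ∈ tensorHomog (f := f) (𝒜 := 𝒜) p (w + d) := by
  have hle : homog f 𝒜 p w ≤
      (tensorHomog (f := f) (𝒜 := 𝒜) p (w + d)).comap (contraction hf Θ) := by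
    refine Submodule.span_le.2 fun α hα => ?_
    change contraction hf Θ α ∈ tensorHomog (f := f) (𝒜 := 𝒜) p (w + d)
    clear h
    induction hα with
    | of ha => rw [contraction_of]; exact zero_mem _
    | @δ n a ha =>
      rw [contraction_δ]
      have h1 := Θ.map_weight n a ha
      generalize Θ.toLin a = t at h1
      induction h1 using Submodule.span_induction with
      | mem t ht =>
        obtain ⟨i, j, x, y, hx, hy, hij, rfl⟩ := ht
        exact Submodule.subset_span ⟨0, 0, i, j, of f x, Submodule.subset_span (.of hx), of f y,
          Submodule.subset_span (.of hy), rfl, hij, rfl⟩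
      | zero => simp
      | add x y _ _ h1 h2 => rw [map_add]; exact add_mem h1 h2
      | smul c x _ h1 => rw [map_smul]; exact Submodule.smul_mem _ _ h1
    | @mul p q v w α β hα hβ h1 h2 =>
      have hα' : α ∈ homog f 𝒜 p v := Submodule.subset_span hα
      have hβ' : β ∈ homog f 𝒜 q w := Submodule.subset_span hβ
      rw [contraction_mul]
      refine add_mem ?_ ?_
      · generalize contraction hf Θ α = t at h1
        induction h1 using Submodule.span_induction with
        | mem t ht =>
          obtain ⟨p₁, p₂, w₁, w₂, x, hx, y, hy, hp, hw, rfl⟩ := ht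
          rw [Algebra.TensorProduct.tmul_mul_tmul, mul_one]
          exact Submodule.subset_span ⟨_, _, _, _, _, hx, _, mul_mem_homog f 𝒜 hy hβ',
            by omega, by linarith, rfl⟩
        | zero => simp
        | add x y _ _ h1 h2 => rw [add_mul]; exact add_mem h1 h2
        | smul c x _ h1 => rw [smul_mul_assoc]; exact Submodule.smul_mem _ _ h1
      · rw [passSign, AlgHom.comp_apply, weightSign_of_mem hf d hα', map_smul,
          formSign_of_mem f 𝒜 hα', smul_smul, ← TensorProduct.smul_tmul', smul_mul_assoc]
        refine Submodule.smul_mem _ _ ?_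
        generalize contraction hf Θ β = t at h2
        induction h2 using Submodule.span_induction with
        | mem t ht =>
          obtain ⟨p₁, p₂, w₁, w₂, x, hx, y, hy, hp, hw, rfl⟩ := ht
          rw [Algebra.TensorProduct.tmul_mul_tmul, one_mul]
          exact Submodule.subset_span ⟨_, _, _, _, _, mul_mem_homog f 𝒜 hα' hx, _, hy,
            by omega, by linarith, rfl⟩
        | zero => simp
        | add x y _ _ h1 h2 => rw [mul_add]; exact add_mem h1 h2
        | smul c x _ h1 => rw [mul_smul_comm]; exact Submodule.smul_mem _ _ h1
  exact hle h

theorem circ_rotate [CharZero k] {d : ℤ} {p q : ℕ} {v w : ℤ} {t : Forms f ⊗[k] Forms f}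
    {β : Forms f} (ht : t ∈ tensorHomog (f := f) (𝒜 := 𝒜) p (v + d)) (hβ : β ∈ homog f 𝒜 q w) :
    circ hf (t * (1 ⊗ₜ β)) =
      sgn k (v * w + p * q) • circ hf ((passSign hf d β ⊗ₜ 1) * t) := by
  rw [passSign, AlgHom.comp_apply, weightSign_of_mem hf d hβ, map_smul,
    formSign_of_mem f 𝒜 hβ, smul_smul, ← TensorProduct.smul_tmul', smul_mul_assoc, map_smul,
    smul_smul]
  induction ht using Submodule.span_induction with
  | mem t ht =>
    obtain ⟨p₁, p₂, w₁, w₂, x, hx, y, hy, hp, hw, rfl⟩ := ht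
    rw [Algebra.TensorProduct.tmul_mul_tmul, Algebra.TensorProduct.tmul_mul_tmul, mul_one,
      one_mul, circ_tmul hf hx (mul_mem_homog f 𝒜 hy hβ),
      circ_tmul hf (mul_mem_homog f 𝒜 hβ hx) hy, smul_smul, ← sgn_add, ← sgn_add, ← sgn_add,
      mul_assoc]
    congr 1
    apply sgn_congr
    subst hp
    obtain rfl : v = w₁ + w₂ - d := by linarith
    refine ⟨-(w * w₂) - (p₂ * q) - q, ?_⟩
    push_cast
    ring
  | zero => simp
  | add x y _ _ h1 h2 => simp only [add_mul, mul_add, map_add, smul_add, h1, h2]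
  | smul c x _ h1 =>
    rw [smul_mul_assoc, mul_smul_comm, map_smul, map_smul, h1, smul_comm]

/-- The reduced contraction `ι_Θ α = °(i_Θ α)`. -/
def reducedContraction {d : ℤ} (Θ : DoubleDer f 𝒜 d) : Forms f →ₗ[k] Forms f :=
  circ hf ∘ₗ contraction hf Θ

theorem reducedContraction_commutators [CharZero k] {d : ℤ} (Θ : DoubleDer f 𝒜 d) :
    commutators f 𝒜 ≤ LinearMap.ker (reducedContraction hf Θ) := by
  refine Submodule.span_le.2 ?_
  rintro _ ⟨p, q, v, w, α, hα, β, hβ, rfl⟩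
  rw [SetLike.mem_coe, LinearMap.mem_ker, map_sub, map_smul]
  simp only [reducedContraction, LinearMap.comp_apply, contraction_mul, map_add]
  rw [circ_rotate hf (contraction_mem hf Θ hα) hβ, circ_rotate hf (contraction_mem hf Θ hβ) hα,
    mul_comm w v, mul_comm (q : ℤ) p, smul_add, smul_smul, sgn_mul_self, one_smul]
  abel

end Forms

namespace DR

variable [CharZero k]

/-- The reduced contraction `ι_Θ : DR_R A → Ω_R A`, `[α] ↦ °(i_Θ α)`. -/
def reducedContraction {d : ℤ} (Θ : DoubleDer f 𝒜 d) : DR f 𝒜 →ₗ[k] Forms f :=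
  Submodule.liftQ _ (Forms.reducedContraction hf Θ) (Forms.reducedContraction_commutators hf Θ)

end DR

variable [CharZero k]

/-- `ω ∈ DR²_R A` is a bi-symplectic form of weight `N`: it is homogeneous of weight `N`, closed,
and `Θ ↦ ι_Θ ω` is a bijection from double derivations to 1-forms (in each weight, where it maps
weight `d` to weight `d + N`). -/
structure IsBisymplectic (N : ℕ) (ω : DR f 𝒜) : Prop where
  mem_homog : ω ∈ DR.homog f 𝒜 2 N
  closed : DR.d f 𝒜 ω = 0
  bijOn : ∀ d : ℤ, Set.BijOn (fun Θ : DoubleDer f 𝒜 d => DR.reducedContraction hf Θ ω)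
    Set.univ (Forms.homog f 𝒜 1 (d + N))

variable {hf} {N : ℕ} {ω : DR f 𝒜} (hω : IsBisymplectic hf N ω)

theorem IsBisymplectic.exists_hamiltonian (hω : IsBisymplectic hf N ω) (n : ℕ) (a : 𝒜 n) :
    ∃ H : DoubleDer f 𝒜 (n - N), DR.reducedContraction hf H ω = Forms.δ f a := by
  have h : Forms.δ f a ∈ Forms.homog f 𝒜 1 ((n - N : ℤ) + N) := by
    rw [sub_add_cancel]; exact Submodule.subset_span (.δ a.2)
  obtain ⟨H, -, hH⟩ := (hω.bijOn (n - N)).surjOn h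
  exact ⟨H, hH⟩

/-- The Hamiltonian double derivation `H_a` of a homogeneous `a`: `ι_{H_a} ω = d a`. -/
def IsBisymplectic.hamiltonian (n : ℕ) (a : 𝒜 n) : DoubleDer f 𝒜 (n - N) :=
  (hω.exists_hamiltonian n a).choose

open Classical in
/-- The double bracket `⦃a, b⦄_ω = H_a(b)`, extended additively to inhomogeneous `a`. -/
def IsBisymplectic.doubleBracket (a b : A) : A ⊗[k] A :=
  ∑ n ∈ (DirectSum.decompose 𝒜 a).support,
    (hω.hamiltonian n (DirectSum.decompose 𝒜 a n)).toLin b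

/-- The associated bracket `{a, b}_ω = m(⦃a, b⦄_ω)`. -/
def IsBisymplectic.bracket (a b : A) : A := LinearMap.mul' k A (hω.doubleBracket a b)

end Contraction
end Forms

/-! ## Double pre-Courant algebroids -/

section Courant

variable {k : Type*} [Field k]
variable {R : Type*} [Ring R] [Algebra k R]
variable {B : Type*} [Ring B] [Algebra k B]

/-- `B` is smooth over `R`: it is finitely generated over `R` and `Ω¹_R B` is a projective
`B`-bimodule. -/
structure IsSmooth (f : R →ₐ[k] B) : Prop where
  finite_type : ∃ s : Finset B, Algebra.adjoin k (Set.range f ∪ (s : Set B)) = ⊤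
  projective : Module.Projective (Env k B) (Kaehler f)

variable {E : Type*} [AddCommGroup E] [Module k E] [Module (Env k B) E]
  [IsScalarTower k (Env k B) E]

/-- The map `b ↦ b e`. -/
def lactOn (e : E) : B →ₗ[k] E :=
  (LinearMap.toSpanSingleton (Env k B) E e).restrictScalars k ∘ₗ
    (TensorProduct.mk k B Bᵐᵒᵖ).flip 1

/-- The map `b ↦ e b`. -/
def ractOn (e : E) : B →ₗ[k] E :=
  (LinearMap.toSpanSingleton (Env k B) E e).restrictScalars k ∘ₗ
    TensorProduct.mk k B Bᵐᵒᵖ 1 ∘ₗ (opLinearEquiv k : B ≃ₗ[k] Bᵐᵒᵖ).toLinearMap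

theorem lactOn_apply (e : E) (b : B) : lactOn (k := k) e b = lact k b e := rfl

theorem ractOn_apply (e : E) (b : B) : ractOn (k := k) e b = ract k b e := rfl

variable (k B E) in
/-- A symmetric non-degenerate pairing `⟨-,-⟩ : E ⊗ E → B ⊗ B` on a `B`-bimodule: `⟨p,-⟩` is
linear for the outer bimodule structure `b(u ⊗ v)c = bu ⊗ vc`, `⟨-,q⟩` is linear for the inner
one `b * (u ⊗ v) * c = uc ⊗ bv`, and `q ↦ ⟨-,q⟩` is a bijection from `E` onto the dual bimodule,
i.e. onto the bimodule maps `E → (B ⊗ B)_inn`. -/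
@[ext] structure InnerProduct where
  /-- The underlying bilinear map. -/
  toLin : E →ₗ[k] E →ₗ[k] B ⊗[k] B
  outer_left : ∀ p b q, toLin p (lact k b q) = (b ⊗ₜ 1) * toLin p q
  outer_right : ∀ p b q, toLin p (ract k b q) = toLin p q * (1 ⊗ₜ b)
  inner_left : ∀ p b q, toLin (lact k b p) q = (1 ⊗ₜ b) * toLin p q
  inner_right : ∀ p b q, toLin (ract k b p) q = toLin p q * (b ⊗ₜ 1)
  symm : ∀ p q, toLin p q = TensorProduct.comm k B B (toLin q p)
  nondegenerate : ∀ φ : E →ₗ[k] B ⊗[k] B,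
    (∀ b p, φ (lact k b p) = (1 ⊗ₜ b) * φ p) → (∀ b p, φ (ract k b p) = φ p * (b ⊗ₜ 1)) →
    ∃! q, ∀ p, toLin p q = φ p

/-- A bimodule map `ρ : E → 𝔻er_R B` into the `R`-linear double derivations of `B`; the bimodule
structure of `𝔻er_R B` comes from the inner one on `B ⊗ B`. -/
@[ext] structure Anchor (f : R →ₐ[k] B) (E : Type*) [AddCommGroup E] [Module k E]
    [Module (Env k B) E] [IsScalarTower k (Env k B) E] where
  /-- The map `e ↦ (b ↦ ρ(e)(b))`. -/
  toLin : E →ₗ[k] B →ₗ[k] B ⊗[k] B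
  leibniz : ∀ e b c, toLin e (b * c) = toLin e b * (1 ⊗ₜ c) + (b ⊗ₜ 1) * toLin e c
  map_base : ∀ e r, toLin e (f r) = 0
  inner_left : ∀ b e c, toLin (lact k b e) c = (1 ⊗ₜ b) * toLin e c
  inner_right : ∀ b e c, toLin (ract k b e) c = toLin e c * (b ⊗ₜ 1)

section CoAnchor

variable {f : R →ₐ[k] B} (P : InnerProduct k B E) (ρ : Anchor f E)

theorem Anchor.exists_dual (b : B) : ∃! q, ∀ p, P.toLin p q = ρ.toLin p b :=
  P.nondegenerate (ρ.toLin.flip b) (fun c p => ρ.inner_left c p b)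
    (fun c p => ρ.inner_right c p b)

/-- The map `ρ^∨ ∘ d : B → Ω¹_R B → E`.  The composite `Ω¹_R B → (𝔻er_R B)^∨ → E^∨ ≅ E` sends
`d b` to the element of `E` corresponding to `e ↦ i_{ρ(e)}(d b) = ρ(e)(b)`, that is,
`⟨e, ρ^∨ d b⟩ = ρ(e)(b)`. -/
def coAnchorD : B →ₗ[k] E where
  toFun b := (ρ.exists_dual P b).choose
  map_add' b c := (ρ.exists_dual P (b + c)).unique (ρ.exists_dual P (b + c)).choose_spec.1
    (fun p => by
      rw [map_add, map_add, (ρ.exists_dual P b).choose_spec.1,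
        (ρ.exists_dual P c).choose_spec.1])
  map_smul' r b := (ρ.exists_dual P (r • b)).unique (ρ.exists_dual P (r • b)).choose_spec.1
    (fun p => by
      rw [RingHom.id_apply, map_smul, map_smul, (ρ.exists_dual P b).choose_spec.1])

theorem inner_coAnchorD (e : E) (b : B) : P.toLin e (coAnchorD P ρ b) = ρ.toLin e b :=
  (ρ.exists_dual P b).choose_spec.1 e

/-- `ρ^∨ d` acting on `B ⊗ B` by the Leibniz rule,
`b ⊗ c ↦ ρ^∨(d b) ⊗ c + b ⊗ ρ^∨(d c)`. -/
def coAnchorDTensor : B ⊗[k] B →ₗ[k] (E ⊗[k] B) × (B ⊗[k] E) :=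
  LinearMap.prod (TensorProduct.map (coAnchorD P ρ) LinearMap.id)
    (TensorProduct.map LinearMap.id (coAnchorD P ρ))

end CoAnchor

/-! Operations on `E ⊗ B ⊕ B ⊗ E`. -/

section Mixed

variable (k B E) in
/-- The space `E ⊗ B ⊕ B ⊗ E`. -/
abbrev Mixed : Type _ := (E ⊗[k] B) × (B ⊗[k] E)

/-- The outer left action `b (u ⊗ v) = bu ⊗ v`. -/
def Mixed.outerLeft (b : B) : Mixed k B E →ₗ[k] Mixed k B E :=
  LinearMap.prodMap (TensorProduct.map (lact k b) LinearMap.id)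
    (TensorProduct.map (LinearMap.mulLeft k b) LinearMap.id)

/-- The outer right action `(u ⊗ v) b = u ⊗ vb`. -/
def Mixed.outerRight (b : B) : Mixed k B E →ₗ[k] Mixed k B E :=
  LinearMap.prodMap (TensorProduct.map LinearMap.id (LinearMap.mulRight k b))
    (TensorProduct.map LinearMap.id (ract k b))

/-- The inner left action `b * (u ⊗ v) = u ⊗ bv`. -/
def Mixed.innerLeft (b : B) : Mixed k B E →ₗ[k] Mixed k B E :=
  LinearMap.prodMap (TensorProduct.map LinearMap.id (LinearMap.mulLeft k b))
    (TensorProduct.map LinearMap.id (lact k b))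

/-- The inner right action `(u ⊗ v) * b = ub ⊗ v`. -/
def Mixed.innerRight (b : B) : Mixed k B E →ₗ[k] Mixed k B E :=
  LinearMap.prodMap (TensorProduct.map (ract k b) LinearMap.id)
    (TensorProduct.map (LinearMap.mulRight k b) LinearMap.id)

/-- The flip `x ↦ x^σ`. -/
def Mixed.flip : Mixed k B E →ₗ[k] Mixed k B E :=
  LinearMap.prod ((TensorProduct.comm k B E).toLinearMap ∘ₗ LinearMap.snd k _ _)
    ((TensorProduct.comm k E B).toLinearMap ∘ₗ LinearMap.fst k _ _)

/-- The map `t ↦ t e`, `b ⊗ c ↦ b ⊗ ce`. -/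
def Mixed.mulVec (e : E) : B ⊗[k] B →ₗ[k] Mixed k B E :=
  LinearMap.inr k _ _ ∘ₗ TensorProduct.map LinearMap.id (lactOn e)

/-- The map `t ↦ e t`, `b ⊗ c ↦ eb ⊗ c`. -/
def Mixed.vecMul (e : E) : B ⊗[k] B →ₗ[k] Mixed k B E :=
  LinearMap.inl k _ _ ∘ₗ TensorProduct.map (ractOn e) LinearMap.id

/-- `⟨-, e⟩_L`: `u ⊗ b ↦ ⟨u,e⟩' ⊗ b ⊗ ⟨u,e⟩''` and `b ⊗ u ↦ 0`. -/
def InnerProduct.pairL (P : InnerProduct k B E) (e : E) :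
    Mixed k B E →ₗ[k] B ⊗[k] (B ⊗[k] B) :=
  TensorProduct.map LinearMap.id (TensorProduct.comm k B B).toLinearMap ∘ₗ
    (TensorProduct.assoc k B B B).toLinearMap ∘ₗ
    TensorProduct.map (P.toLin.flip e) LinearMap.id ∘ₗ LinearMap.fst k _ _

/-- `⟨e, -⟩_R`: `b ⊗ u ↦ b ⊗ ⟨e,u⟩` and `u ⊗ b ↦ 0`. -/
def InnerProduct.pairR (P : InnerProduct k B E) (e : E) :
    Mixed k B E →ₗ[k] B ⊗[k] (B ⊗[k] B) :=
  TensorProduct.map LinearMap.id (P.toLin e) ∘ₗ LinearMap.snd k _ _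

/-- The extension `b ⊗ c ↦ θ(b) ⊗ c` of `θ : B → B ⊗ B`. -/
def extendFirst (θ : B →ₗ[k] B ⊗[k] B) : B ⊗[k] B →ₗ[k] B ⊗[k] (B ⊗[k] B) :=
  (TensorProduct.assoc k B B B).toLinearMap ∘ₗ TensorProduct.map θ LinearMap.id

end Mixed

/-- A double pre-Courant algebroid `(E, ⟨-,-⟩, ρ, ⟦-,-⟧)` over the `R`-algebra `B`. -/
@[ext] structure DoublePreCourant (f : R →ₐ[k] B) (E : Type*) [AddCommGroup E] [Module k E]
    [Module (Env k B) E] [IsScalarTower k (Env k B) E] where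
  finite : Module.Finite (Env k B) E
  projective : Module.Projective (Env k B) E
  /-- The inner product `⟨-,-⟩`. -/
  inner : InnerProduct k B E
  /-- The anchor `ρ`. -/
  anchor : Anchor f E
  /-- The double Dorfman bracket `⟦-,-⟧`. -/
  bracket : E →ₗ[k] E →ₗ[k] Mixed k B E
  bracket_base_left : ∀ r e₁ e₂,
    bracket e₁ (lact k (f r) e₂) = Mixed.outerLeft (f r) (bracket e₁ e₂)
  bracket_base_right : ∀ r e₁ e₂,
    bracket e₁ (ract k (f r) e₂) = Mixed.outerRight (f r) (bracket e₁ e₂)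
  base_left_bracket : ∀ r e₁ e₂,
    bracket (lact k (f r) e₁) e₂ = Mixed.innerLeft (f r) (bracket e₁ e₂)
  base_right_bracket : ∀ r e₁ e₂,
    bracket (ract k (f r) e₁) e₂ = Mixed.innerRight (f r) (bracket e₁ e₂)
  leibniz_left : ∀ b e₁ e₂, bracket e₁ (lact k b e₂) =
    Mixed.mulVec e₂ (anchor.toLin e₁ b) + Mixed.outerLeft b (bracket e₁ e₂)
  leibniz_right : ∀ b e₁ e₂, bracket e₁ (ract k b e₂) =
    Mixed.vecMul e₂ (anchor.toLin e₁ b) + Mixed.outerRight b (bracket e₁ e₂)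
  coAnchor_inner : ∀ e, coAnchorDTensor inner anchor (inner.toLin e e) =
    bracket e e + Mixed.flip (bracket e e)
  anchor_inner : ∀ e₁ e₂, extendFirst (anchor.toLin e₁) (inner.toLin e₂ e₂) =
    inner.pairL e₂ (bracket e₁ e₂) + inner.pairR e₂ (bracket e₁ e₂)

end Courant

/-! ## The tensor algebra `T_B (E₁[-1] ⊕ E₂[-2])` -/

section WeightTwo

variable (k : Type*) [Field k]
variable (B : Type*) [Ring B] [Algebra k B]
variable (E₁ : Type*) [AddCommGroup E₁] [Module k E₁] [Module (Env k B) E₁]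
  [IsScalarTower k (Env k B) E₁]
variable (E₂ : Type*) [AddCommGroup E₂] [Module k E₂] [Module (Env k B) E₂]
  [IsScalarTower k (Env k B) E₂]

/-- The underlying algebra of `T_B (E₁[-1] ⊕ E₂[-2])`. -/
abbrev TAlg : Type _ := TensorAlg k B (E₁ × E₂)

namespace TAlg

/-- The inclusion `B → A`. -/
abbrev ofB : B →ₐ[k] TAlg k B E₁ E₂ := TensorAlg.base k B (E₁ × E₂)

/-- The inclusion `E₁ → A`. -/
def ofE₁ : E₁ →ₗ[k] TAlg k B E₁ E₂ := TensorAlg.gen k B (E₁ × E₂) ∘ₗ LinearMap.inl k E₁ E₂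

/-- The inclusion `E₂ → A`. -/
def ofE₂ : E₂ →ₗ[k] TAlg k B E₁ E₂ := TensorAlg.gen k B (E₁ × E₂) ∘ₗ LinearMap.inr k E₁ E₂

/-- Products of elements of `B` (weight 0), `E₁` (weight 1) and `E₂` (weight 2), with their
weight. -/
inductive IsMonomial : ℕ → TAlg k B E₁ E₂ → Prop
  | ofB (b : B) : IsMonomial 0 (ofB k B E₁ E₂ b)
  | ofE₁ (e : E₁) : IsMonomial 1 (ofE₁ k B E₁ E₂ e)
  | ofE₂ (e : E₂) : IsMonomial 2 (ofE₂ k B E₁ E₂ e)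
  | mul {m n : ℕ} {x y : TAlg k B E₁ E₂} (hx : IsMonomial m x) (hy : IsMonomial n y) :
      IsMonomial (m + n) (x * y)

/-- The weight `n` part of `T_B (E₁[-1] ⊕ E₂[-2])`. -/
def part (n : ℕ) : Submodule k (TAlg k B E₁ E₂) := Submodule.span k {x | IsMonomial k B E₁ E₂ n x}

instance : SetLike.GradedMonoid (part k B E₁ E₂) where
  one_mem := by
    have h : ofB k B E₁ E₂ 1 ∈ part k B E₁ E₂ 0 := Submodule.subset_span (.ofB 1)
    rwa [map_one] at h
  mul_mem m n x y hx hy := by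
    have := Submodule.mul_mem_mul hx hy
    rw [part, part, Submodule.span_mul_span] at this
    refine Submodule.span_mono ?_ this
    rintro _ ⟨x, hx, y, hy, rfl⟩
    exact IsMonomial.mul hx hy

/-- `B`, as the weight 0 component. -/
def comp₀ : B →ₗ[k] DirectSum ℕ fun n => part k B E₁ E₂ n :=
  DirectSum.lof k ℕ (fun n => part k B E₁ E₂ n) 0 ∘ₗ
    LinearMap.codRestrict (part k B E₁ E₂ 0) (ofB k B E₁ E₂).toLinearMap
      fun b => Submodule.subset_span (IsMonomial.ofB b)

/-- `E₁`, inside the weight 1 component. -/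
def comp₁ : E₁ →ₗ[k] DirectSum ℕ fun n => part k B E₁ E₂ n :=
  DirectSum.lof k ℕ (fun n => part k B E₁ E₂ n) 1 ∘ₗ
    LinearMap.codRestrict (part k B E₁ E₂ 1) (ofE₁ k B E₁ E₂)
      fun e => Submodule.subset_span (IsMonomial.ofE₁ e)

/-- `E₂`, inside the weight 2 component. -/
def comp₂ : E₂ →ₗ[k] DirectSum ℕ fun n => part k B E₁ E₂ n :=
  DirectSum.lof k ℕ (fun n => part k B E₁ E₂ n) 2 ∘ₗ
    LinearMap.codRestrict (part k B E₁ E₂ 2) (ofE₂ k B E₁ E₂)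
      fun e => Submodule.subset_span (IsMonomial.ofE₂ e)

theorem lof_mul_lof {i j l : ℕ} (x : part k B E₁ E₂ i) (y : part k B E₁ E₂ j)
    (z : part k B E₁ E₂ l) (hl : i + j = l) (h : (x : TAlg k B E₁ E₂) * y = z) :
    DirectSum.lof k ℕ (fun n => part k B E₁ E₂ n) l z =
      DirectSum.lof k ℕ (fun n => part k B E₁ E₂ n) i x *
        DirectSum.lof k ℕ (fun n => part k B E₁ E₂ n) j y := by
  subst hl
  refine Eq.trans ?_ (DirectSum.of_mul_of (A := fun n => part k B E₁ E₂ n) x y).symm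
  exact DirectSum.of_eq_of_gradedMonoid_eq (A := fun n => part k B E₁ E₂ n)
    (Sigma.subtype_ext rfl h.symm)

theorem base_mul_ofE₁ (b : B) (e : E₁) :
    ofB k B E₁ E₂ b * ofE₁ k B E₁ E₂ e = ofE₁ k B E₁ E₂ (lact k b e) := by
  refine (TensorAlg.base_mul_gen b ((e, 0) : E₁ × E₂)).trans
    (congrArg (TensorAlg.gen k B (E₁ × E₂)) (Prod.ext rfl (smul_zero _)))

theorem ofE₁_mul_base (b : B) (e : E₁) :
    ofE₁ k B E₁ E₂ e * ofB k B E₁ E₂ b = ofE₁ k B E₁ E₂ (ract k b e) :=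
  (TensorAlg.gen_mul_base b ((e, 0) : E₁ × E₂)).trans
    (congrArg (TensorAlg.gen k B (E₁ × E₂)) (Prod.ext rfl (smul_zero _)))

theorem base_mul_ofE₂ (b : B) (e : E₂) :
    ofB k B E₁ E₂ b * ofE₂ k B E₁ E₂ e = ofE₂ k B E₁ E₂ (lact k b e) :=
  (TensorAlg.base_mul_gen b ((0, e) : E₁ × E₂)).trans
    (congrArg (TensorAlg.gen k B (E₁ × E₂)) (Prod.ext (smul_zero _) rfl))

theorem ofE₂_mul_base (b : B) (e : E₂) :
    ofE₂ k B E₁ E₂ e * ofB k B E₁ E₂ b = ofE₂ k B E₁ E₂ (ract k b e) :=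
  (TensorAlg.gen_mul_base b ((0, e) : E₁ × E₂)).trans
    (congrArg (TensorAlg.gen k B (E₁ × E₂)) (Prod.ext (smul_zero _) rfl))

theorem comp₀_one : comp₀ k B E₁ E₂ 1 = 1 :=
  DirectSum.of_eq_of_gradedMonoid_eq (A := fun n => part k B E₁ E₂ n)
    (Sigma.subtype_ext rfl (map_one (ofB k B E₁ E₂)))

theorem comp₀_mul (b c : B) :
    comp₀ k B E₁ E₂ (b * c) = comp₀ k B E₁ E₂ b * comp₀ k B E₁ E₂ c :=
  lof_mul_lof k B E₁ E₂ _ _ _ rfl (map_mul (ofB k B E₁ E₂) b c).symm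

/-- The map sending an element to the family of its homogeneous components. -/
def components : TAlg k B E₁ E₂ →ₐ[k] DirectSum ℕ fun n => part k B E₁ E₂ n :=
  TensorAlg.lift
    (AlgHom.ofLinearMap (comp₀ k B E₁ E₂) (comp₀_one k B E₁ E₂) (comp₀_mul k B E₁ E₂))
    (LinearMap.coprod (comp₁ k B E₁ E₂) (comp₂ k B E₁ E₂))
    (fun b m => by
      change comp₁ k B E₁ E₂ (lact k b m.1) + comp₂ k B E₁ E₂ (lact k b m.2) =
        comp₀ k B E₁ E₂ b * (comp₁ k B E₁ E₂ m.1 + comp₂ k B E₁ E₂ m.2)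
      rw [mul_add]
      exact congrArg₂ _ (lof_mul_lof k B E₁ E₂ _ _ _ rfl (base_mul_ofE₁ k B E₁ E₂ b m.1))
        (lof_mul_lof k B E₁ E₂ _ _ _ rfl (base_mul_ofE₂ k B E₁ E₂ b m.2)))
    (fun b m => by
      change comp₁ k B E₁ E₂ (ract k b m.1) + comp₂ k B E₁ E₂ (ract k b m.2) =
        (comp₁ k B E₁ E₂ m.1 + comp₂ k B E₁ E₂ m.2) * comp₀ k B E₁ E₂ b
      rw [add_mul]
      exact congrArg₂ _ (lof_mul_lof k B E₁ E₂ _ _ _ rfl (ofE₁_mul_base k B E₁ E₂ b m.1))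
        (lof_mul_lof k B E₁ E₂ _ _ _ rfl (ofE₂_mul_base k B E₁ E₂ b m.2)))

theorem components_ofB (b : B) : components k B E₁ E₂ (ofB k B E₁ E₂ b) = comp₀ k B E₁ E₂ b :=
  TensorAlg.lift_base _ _ _ _ b

theorem components_ofE₁ (e : E₁) :
    components k B E₁ E₂ (ofE₁ k B E₁ E₂ e) = comp₁ k B E₁ E₂ e :=
  (TensorAlg.lift_gen _ _ _ _ ((e, 0) : E₁ × E₂)).trans (by simp)

theorem components_ofE₂ (e : E₂) :
    components k B E₁ E₂ (ofE₂ k B E₁ E₂ e) = comp₂ k B E₁ E₂ e :=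
  (TensorAlg.lift_gen _ _ _ _ ((0, e) : E₁ × E₂)).trans (by simp)

theorem components_of_isMonomial {n : ℕ} {x : TAlg k B E₁ E₂} (hx : IsMonomial k B E₁ E₂ n x) :
    components k B E₁ E₂ x =
      DirectSum.lof k ℕ (fun n => part k B E₁ E₂ n) n ⟨x, Submodule.subset_span hx⟩ := by
  induction hx with
  | ofB b => exact components_ofB k B E₁ E₂ b
  | ofE₁ e => exact components_ofE₁ k B E₁ E₂ e
  | ofE₂ e => exact components_ofE₂ k B E₁ E₂ e
  | mul hx hy h1 h2 =>
    rw [map_mul, h1, h2]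
    exact (lof_mul_lof k B E₁ E₂ _ _ _ rfl rfl).symm

/-- The weight grading of `T_B (E₁[-1] ⊕ E₂[-2])`. -/
instance : GradedAlgebra (part k B E₁ E₂) :=
  GradedAlgebra.ofAlgHom _ (components k B E₁ E₂)
    (by
      have h : ∀ n (x : part k B E₁ E₂ n), DirectSum.coeAlgHom (part k B E₁ E₂)
          (DirectSum.lof k ℕ (fun n => part k B E₁ E₂ n) n x) = x :=
        fun n x => DirectSum.coeAlgHom_of _ _ _
      apply TensorAlg.algHom_ext
      · intro b
        change DirectSum.coeAlgHom (part k B E₁ E₂) (components k B E₁ E₂ (ofB k B E₁ E₂ b)) = _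
        rw [components_ofB]
        exact h _ _
      · intro m
        have hm : TensorAlg.gen k B (E₁ × E₂) m =
            ofE₁ k B E₁ E₂ m.1 + ofE₂ k B E₁ E₂ m.2 := by
          change _ = TensorAlg.gen k B (E₁ × E₂) _ + TensorAlg.gen k B (E₁ × E₂) _
          rw [← map_add]
          simp
        change DirectSum.coeAlgHom (part k B E₁ E₂) (components k B E₁ E₂ _) = _
        rw [hm, map_add, components_ofE₁, components_ofE₂, map_add]
        exact congrArg₂ _ (h _ _) (h _ _))
    (by
      rintro n ⟨x, hx⟩
      change components k B E₁ E₂ x = DirectSum.lof k ℕ (fun n => part k B E₁ E₂ n) n ⟨x, hx⟩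
      induction hx using Submodule.span_induction with
      | mem x hx => exact components_of_isMonomial k B E₁ E₂ hx
      | zero => exact (map_zero _).trans (map_zero _).symm
      | add x y hx hy h1 h2 =>
        rw [map_add, h1, h2, ← map_add]; rfl
      | smul c x hx h1 =>
        rw [map_smul, h1, ← map_smul]; rfl)

variable {k B} {R : Type*} [Ring R] [Algebra k R]

/-- `A = T_B (E₁[-1] ⊕ E₂[-2])` as an `R`-algebra. -/
abbrev ofR (f : R →ₐ[k] B) : R →ₐ[k] TAlg k B E₁ E₂ := (ofB k B E₁ E₂).comp f

theorem ofR_mem (f : R →ₐ[k] B) (r : R) : ofR E₁ E₂ f r ∈ part k B E₁ E₂ 0 :=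
  Submodule.subset_span (.ofB (f r))

variable (k B)

/-- The inclusion `B ⊗ B → A ⊗ A`. -/
def inclBB : B ⊗[k] B →ₗ[k] TAlg k B E₁ E₂ ⊗[k] TAlg k B E₁ E₂ :=
  TensorProduct.map (ofB k B E₁ E₂).toLinearMap (ofB k B E₁ E₂).toLinearMap

/-- The inclusion `E₁ ⊗ B ⊕ B ⊗ E₁ → A ⊗ A`. -/
def inclMixed : Mixed k B E₁ →ₗ[k] TAlg k B E₁ E₂ ⊗[k] TAlg k B E₁ E₂ :=
  LinearMap.coprod (TensorProduct.map (ofE₁ k B E₁ E₂) (ofB k B E₁ E₂).toLinearMap)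
    (TensorProduct.map (ofB k B E₁ E₂).toLinearMap (ofE₁ k B E₁ E₂))

end TAlg
end WeightTwo
end NCCourant

end

open scoped TensorProduct
open MulOpposite

noncomputable section

namespace NCCourant

set_option linter.unusedSectionVars false
set_option linter.unusedSimpArgs false

/-! ## Sign calculus for double derivations -/

section SignCalculus

variable {k : Type*} [Field k]

/-! The structure is a derived bracket. Since `ω` has weight 2, the double bracket it defines has
weight -2, and `{S, -}` has weight 1. Hence `⦃e₁, e₂⦄` and `⦃{S, e}, b⦄` have weight 0 and `⦃{S,
e₁}, e₂⦄` has weight 1. In these weights `A ⊗ A` is just `B ⊗ B` and `E ⊗ B ⊕ B ⊗ E`. The axioms are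
then low-weight components of the Leibniz rule, of skew-symmetry and of two forms of the Jacobi
identity.

The last two come from a Cartan calculus on noncommutative forms. Write `°` for the signed opposite
multiplication `opMul`, and lift `ω` to a 2-form `w`. For double derivations `X`, `Y` of forms,
`opMul_bracket` expresses the difference of `X(°Y w)` and the flip of `Y(°X w)` through the triple
brackets `(X ⊗ 1)Y ∓ (1 ⊗ Y)X` and `(Y ⊗ 1)X ∓ (1 ⊗ X)Y`. These are triple derivations
(`tripleBracket_mul`), hence determined by functions and exact 1-forms. For two contractions they
vanish, and evaluating at `w` gives skew-symmetry (`Forms.skew`). Closedness of `ω` and the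
Hamiltonian equation `ι_D w = ds` make the reduced Lie derivative `°(L_D w)` vanish
(`Forms.opMul_lieDer`). Two consequences follow. The derivation `{s, -}` acts on double brackets by
the Leibniz rule (`exists_hamiltonian_bracket`). A double Jacobi identity holds after a functional
on `B` is evaluated on the middle tensor factor (`exists_hamiltonian_midEval`). The functional keeps
the identity among double derivations of `A`, where injectivity of `Θ ↦ ι_Θ ω` applies; varying it
recovers the identity in `B ⊗ B ⊗ B` (`eq_zero_of_midEval`).

Axioms (a) and (b) are the Leibniz rule for the Hamiltonian double derivation of `{S, e₁}`. For (c),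
the Leibniz rule for `{S, -}` applied to `⦃e, e⦄` gives `⦃{S, e}, e⦄ = {S, ⦃e, e⦄} + ⦃e, {S, e}⦄`.
The last term is minus the flip of the left side, and `ρ^∨ d b = {S, b}`. Axiom (d) is the double
Jacobi identity for `{S, e₁}`, `e₂`, `e₂`.

For non-degeneracy (`TAlg.pairing_nondegenerate`), an Euler-type algebra map recovers `e` from `de`.
The `E`-component of its value on `ι_Θ w` sees only the restriction of `Θ` to `E` when `Θ` has
weight -1. Expanding the Hamiltonian double derivation of `p` in a dual basis of `E` therefore
writes `p` in terms of the `⟨p, eᵢ⟩`, and applying an inner-linear `φ` exhibits the element that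
represents it.

Uniqueness holds because `B ⊗ B` and `E ⊗ B ⊕ B ⊗ E` embed in `A ⊗ A`. -/

theorem sgn_of_even {n : ℤ} (h : Even n) : sgn k n = 1 := by
  rw [sgn_congr (n := 0) (by simpa using h), sgn_zero]

theorem sgn_of_not_even {n : ℤ} (h : ¬ Even n) : sgn k n = -1 := by
  rw [sgn_congr (n := 1) (by
    rw [Int.not_even_iff_odd] at h; exact h.sub_odd odd_one), sgn_one]

section Twist

variable {V W : Type*} [AddCommGroup V] [Module k V] [AddCommGroup W] [Module k W]

/-- The map `x ⊗ y ↦ (-1)^{|x||y|} x ⊗ y` for two involutions with eigenvalues `(-1)^{|x|}`. -/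
def signTwist (ε : V →ₗ[k] V) (ε' : W →ₗ[k] W) : V ⊗[k] W →ₗ[k] V ⊗[k] W :=
  (2⁻¹ : k) • (LinearMap.id + TensorProduct.map ε LinearMap.id +
    TensorProduct.map LinearMap.id ε' - TensorProduct.map ε ε')

/-- For signs `s`, `t` the number `(1 + s + t - st)/2` is -1 exactly when both are -1. This makes
the Koszul sign a linear map, with no decomposition into homogeneous parts. -/
theorem signTwist_tmul [CharZero k] {ε : V →ₗ[k] V} {ε' : W →ₗ[k] W}
    {x : V} {y : W} {m n : ℤ} (hx : ε x = sgn k m • x) (hy : ε' y = sgn k n • y) :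
    signTwist ε ε' (x ⊗ₜ[k] y) = sgn k (m * n) • (x ⊗ₜ[k] y) := by
  have hs : (2⁻¹ : k) * (1 + sgn k m + sgn k n - sgn k m * sgn k n) = sgn k (m * n) := by
    rcases Int.even_or_odd m with hm | hm <;> rcases Int.even_or_odd n with hn | hn <;>
      simp [sgn, Int.negOnePow_even, Int.negOnePow_odd, hm, hn, Int.even_mul, Int.odd_mul] <;>
      norm_num
  simp only [signTwist, LinearMap.smul_apply, LinearMap.sub_apply, LinearMap.add_apply,
    LinearMap.id_apply, TensorProduct.map_tmul, hx, hy, TensorProduct.tmul_smul,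
    ← TensorProduct.smul_tmul', smul_smul]
  rw [← hs]
  module

/-- `v` is a joint eigenvector of `ε₁`, `ε₂` with eigenvalues `(-1)^p`, `(-1)^w`. -/
def IsPar (ε₁ ε₂ : V →ₗ[k] V) (p w : ℤ) (v : V) : Prop :=
  ε₁ v = sgn k p • v ∧ ε₂ v = sgn k w • v

/-- The Koszul flip `x ⊗ y ↦ (-1)^{(x|y)} y ⊗ x`. -/
def signFlip (ε₁ ε₂ : V →ₗ[k] V) (ε₁' ε₂' : W →ₗ[k] W) : V ⊗[k] W →ₗ[k] W ⊗[k] V :=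
  (TensorProduct.comm k V W).toLinearMap ∘ₗ signTwist ε₂ ε₂' ∘ₗ signTwist ε₁ ε₁'

theorem signFlip_tmul [CharZero k] {ε₁ ε₂ : V →ₗ[k] V} {ε₁' ε₂' : W →ₗ[k] W} {x : V} {y : W}
    {p w q v : ℤ} (hx : IsPar ε₁ ε₂ p w x) (hy : IsPar ε₁' ε₂' q v y) :
    signFlip ε₁ ε₂ ε₁' ε₂' (x ⊗ₜ y) = sgn k (p * q + w * v) • (y ⊗ₜ x) := by
  simp only [signFlip, LinearMap.comp_apply]
  rw [signTwist_tmul hx.1 hy.1, map_smul, signTwist_tmul hx.2 hy.2, smul_smul, map_smul, ← sgn_add]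
  rfl

end Twist

variable {Ω : Type*} [Ring Ω] [Algebra k Ω]

/-- The power `e ^ n` of an involution. -/
def signPow (e : Ω →ₐ[k] Ω) (n : ℤ) : Ω →ₐ[k] Ω := if Even n then AlgHom.id k Ω else e

theorem signPow_apply_of_eq {e : Ω →ₐ[k] Ω} {x : Ω} {m : ℤ} (n : ℤ) (h : e x = sgn k m • x) :
    signPow e n x = sgn k (n * m) • x := by
  unfold signPow
  split_ifs with hn
  · rw [sgn_of_even (hn.mul_right m)]; simp
  · rw [h, sgn_congr (m := n * m) (n := m)]
    rw [Int.not_even_iff_odd] at hn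
    obtain ⟨r, rfl⟩ := hn
    exact ⟨r * m, by ring⟩

/-- The sign by which an operator of bidegree `(p, d)` passes an element. -/
def passBy (e₁ e₂ : Ω →ₐ[k] Ω) (p d : ℤ) : Ω →ₐ[k] Ω := (signPow e₁ p).comp (signPow e₂ d)

variable {e₁ e₂ : Ω →ₐ[k] Ω}

theorem passBy_of_isPar {p w : ℤ} {x : Ω} (q d : ℤ)
    (h : IsPar e₁.toLinearMap e₂.toLinearMap p w x) :
    passBy e₁ e₂ q d x = sgn k (q * p + d * w) • x := by
  have h2 : e₂ x = sgn k w • x := h.2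
  have h1 : e₁ x = sgn k p • x := h.1
  rw [passBy, AlgHom.comp_apply, signPow_apply_of_eq d h2, map_smul, signPow_apply_of_eq q h1,
    smul_smul, ← sgn_add, add_comm]

variable (e₁ e₂) in
/-- `e₁` and `e₂` are commuting involutions. -/
structure IsSignPair : Prop where
  sq₁ : ∀ x, e₁ (e₁ x) = x
  sq₂ : ∀ x, e₂ (e₂ x) = x
  comm : ∀ x, e₁ (e₂ x) = e₂ (e₁ x)

/-- An additive property holds for all elements if it holds for joint eigenvectors. -/
theorem IsSignPair.induction [CharZero k] (he : IsSignPair e₁ e₂) {p : Ω → Prop}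
    (hadd : ∀ x y, p x → p y → p (x + y))
    (h : ∀ (q w : ℤ) x, IsPar e₁.toLinearMap e₂.toLinearMap q w x → p x) (x : Ω) : p x := by
  -- The four summands are the images of `x` under the projectors `(1 ± e₁)(1 ± e₂)/4` onto the
  -- joint eigenspaces.
  have hx : x = (4⁻¹ : k) • (x + e₁ x + e₂ x + e₁ (e₂ x)) +
      (4⁻¹ : k) • (x - e₁ x + e₂ x - e₁ (e₂ x)) + (4⁻¹ : k) • (x + e₁ x - e₂ x - e₁ (e₂ x)) +
      (4⁻¹ : k) • (x - e₁ x - e₂ x + e₁ (e₂ x)) := by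
    have h4 : (4⁻¹ : k) * 4 = 1 := by norm_num
    nth_rewrite 1 [← one_smul k x]
    rw [← h4]
    module
  rw [hx]
  refine hadd _ _ (hadd _ _ (hadd _ _ ?_ ?_) ?_) ?_
  · refine h 0 0 _ ⟨?_, ?_⟩ <;>
      simp only [AlgHom.toLinearMap_apply, map_smul, map_add, he.sq₁, he.sq₂, ← he.comm, sgn_zero] <;>
      module
  · refine h 1 0 _ ⟨?_, ?_⟩ <;>
      simp only [AlgHom.toLinearMap_apply, map_smul, map_add, map_sub, he.sq₁, he.sq₂, ← he.comm,
        sgn_zero, sgn_one] <;>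
      module
  · refine h 0 1 _ ⟨?_, ?_⟩ <;>
      simp only [AlgHom.toLinearMap_apply, map_smul, map_add, map_sub, he.sq₁, he.sq₂, ← he.comm,
        sgn_zero, sgn_one] <;>
      module
  · refine h 1 1 _ ⟨?_, ?_⟩ <;>
      simp only [AlgHom.toLinearMap_apply, map_smul, map_add, map_sub, he.sq₁, he.sq₂, ← he.comm,
        sgn_zero, sgn_one] <;>
      module

theorem IsSignPair.ext_tmul [CharZero k] (he : IsSignPair e₁ e₂) {V : Type*} [AddCommGroup V]
    [Module k V] {F G : Ω ⊗[k] Ω →ₗ[k] V}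
    (h : ∀ (p w q v : ℤ) x y, IsPar e₁.toLinearMap e₂.toLinearMap p w x →
      IsPar e₁.toLinearMap e₂.toLinearMap q v y → F (x ⊗ₜ y) = G (x ⊗ₜ y)) : F = G := by
  refine TensorProduct.ext' fun x y => ?_
  induction x using he.induction with
  | hadd x x' h1 h2 => rw [TensorProduct.add_tmul, map_add, map_add, h1, h2]
  | h p w x hx =>
    induction y using he.induction with
    | hadd x x' h1 h2 => rw [TensorProduct.tmul_add, map_add, map_add, h1, h2]
    | h q v y hy => exact h p w q v x y hx hy

theorem IsPar.mul {p w q v : ℤ} {x y : Ω} (hx : IsPar e₁.toLinearMap e₂.toLinearMap p w x)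
    (hy : IsPar e₁.toLinearMap e₂.toLinearMap q v y) :
    IsPar e₁.toLinearMap e₂.toLinearMap (p + q) (w + v) (x * y) := by
  obtain ⟨h1, h2⟩ := hx
  obtain ⟨h3, h4⟩ := hy
  simp only [AlgHom.toLinearMap_apply] at h1 h2 h3 h4
  constructor <;> simp [h1, h2, h3, h4, sgn_add, smul_smul, mul_comm]

variable (e₁ e₂) in
/-- Being a joint eigenvector in `Ω ⊗ Ω`. -/
abbrev IsPar₂ (p w : ℤ) (t : Ω ⊗[k] Ω) : Prop :=
  IsPar (TensorProduct.map e₁.toLinearMap e₁.toLinearMap)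
    (TensorProduct.map e₂.toLinearMap e₂.toLinearMap) p w t

theorem IsPar.tmul {p w q v : ℤ} {x y : Ω} (hx : IsPar e₁.toLinearMap e₂.toLinearMap p w x)
    (hy : IsPar e₁.toLinearMap e₂.toLinearMap q v y) :
    IsPar₂ e₁ e₂ (p + q) (w + v) (x ⊗ₜ y) := by
  obtain ⟨h1, h2⟩ := hx
  obtain ⟨h3, h4⟩ := hy
  simp only [AlgHom.toLinearMap_apply] at h1 h2 h3 h4
  constructor <;> simp only [TensorProduct.map_tmul, AlgHom.toLinearMap_apply, h1, h2, h3, h4,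
    sgn_add, TensorProduct.tmul_smul, ← TensorProduct.smul_tmul', smul_smul] <;>
    congr 1 <;> ring

variable (e₁ e₂) in
/-- `X` is a double derivation of bidegree `(p, d)`. -/
structure IsDD (p d : ℤ) (X : Ω →ₗ[k] Ω ⊗[k] Ω) : Prop where
  leibniz : ∀ α β, X (α * β) = X α * (1 ⊗ₜ β) + (passBy e₁ e₂ p d α ⊗ₜ 1) * X β
  par₁ : ∀ α, TensorProduct.map e₁.toLinearMap e₁.toLinearMap (X α) = sgn k p • X (e₁ α)
  par₂ : ∀ α, TensorProduct.map e₂.toLinearMap e₂.toLinearMap (X α) = sgn k d • X (e₂ α)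

variable {p d q v : ℤ} {X Y : Ω →ₗ[k] Ω ⊗[k] Ω}

theorem IsDD.isPar (hX : IsDD e₁ e₂ p d X) {α : Ω}
    (h : IsPar e₁.toLinearMap e₂.toLinearMap q v α) : IsPar₂ e₁ e₂ (p + q) (d + v) (X α) := by
  have h1 : e₁ α = sgn k q • α := h.1
  have h2 : e₂ α = sgn k v • α := h.2
  constructor
  · rw [hX.par₁, h1, map_smul, smul_smul, sgn_add]
  · rw [hX.par₂, h2, map_smul, smul_smul, sgn_add]

theorem map_signPow {r : ℤ} (e : Ω →ₐ[k] Ω)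
    (h : ∀ α, TensorProduct.map e.toLinearMap e.toLinearMap (X α) = sgn k r • X (e α)) (n : ℤ)
    (α : Ω) : TensorProduct.map (signPow e n).toLinearMap (signPow e n).toLinearMap (X α) =
      sgn k (n * r) • X (signPow e n α) := by
  unfold signPow
  split_ifs with hn
  · rw [sgn_of_even (hn.mul_right r)]
    simp
  · rw [h, sgn_congr (m := n * r) (n := r)]
    rw [Int.not_even_iff_odd] at hn
    obtain ⟨s, rfl⟩ := hn
    exact ⟨s * r, by ring⟩

theorem IsDD.map_passBy (hX : IsDD e₁ e₂ p d X) (q v : ℤ) (α : Ω) :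
    TensorProduct.map (passBy e₁ e₂ q v).toLinearMap (passBy e₁ e₂ q v).toLinearMap (X α) =
      sgn k (q * p + v * d) • X (passBy e₁ e₂ q v α) := by
  have h : (passBy e₁ e₂ q v).toLinearMap =
      (signPow e₁ q).toLinearMap ∘ₗ (signPow e₂ v).toLinearMap := rfl
  rw [h, TensorProduct.map_comp, LinearMap.comp_apply, map_signPow e₂ hX.par₂, map_smul,
    map_signPow e₁ hX.par₁, smul_smul, ← sgn_add, add_comm]
  rfl

/-! ### The triple bracket -/

/-- `X ⊗ 1 : Ω ⊗ Ω → Ω ⊗ Ω ⊗ Ω`. -/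
def actFirst (X : Ω →ₗ[k] Ω ⊗[k] Ω) : Ω ⊗[k] Ω →ₗ[k] Ω ⊗[k] (Ω ⊗[k] Ω) :=
  (TensorProduct.assoc k Ω Ω Ω).toLinearMap ∘ₗ TensorProduct.map X LinearMap.id

/-- `1 ⊗ X : Ω ⊗ Ω → Ω ⊗ Ω ⊗ Ω` with the sign `c` of passing the first factor. -/
def actSecond (c : Ω →ₐ[k] Ω) (X : Ω →ₗ[k] Ω ⊗[k] Ω) : Ω ⊗[k] Ω →ₗ[k] Ω ⊗[k] (Ω ⊗[k] Ω) :=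
  TensorProduct.map c.toLinearMap X

/-- The element `t ⊗ 1`. -/
def inTwelve (t : Ω ⊗[k] Ω) : Ω ⊗[k] (Ω ⊗[k] Ω) := TensorProduct.assoc k Ω Ω Ω (t ⊗ₜ 1)

theorem actFirst_tmul_right (X : Ω →ₗ[k] Ω ⊗[k] Ω) (t : Ω ⊗[k] Ω) (β : Ω) :
    actFirst X (t * (1 ⊗ₜ β)) = actFirst X t * (1 ⊗ₜ (1 ⊗ₜ β)) := by
  induction t with
  | zero => simp
  | add t t' h h' => simp only [add_mul, map_add, h, h']
  | tmul x y =>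
    simp only [actFirst, Algebra.TensorProduct.tmul_mul_tmul, LinearMap.comp_apply, mul_one,
      TensorProduct.map_tmul, LinearMap.id_apply, LinearEquiv.coe_coe]
    generalize X x = s
    induction s with
    | zero => simp
    | add t t' h h' => simp only [TensorProduct.add_tmul, map_add, add_mul, h, h']
    | tmul u v => simp

/-- Besides the expected term, `X` may hit the multiplier `γ`. This cross term, and the one in
`actSecond_tmul_right`, are what has to cancel in the triple bracket. -/
theorem actFirst_tmul_left (hX : IsDD e₁ e₂ p d X) (γ : Ω) (t : Ω ⊗[k] Ω) :
    actFirst X ((γ ⊗ₜ 1) * t) = inTwelve (X γ) * (1 ⊗ₜ t) +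
      (passBy e₁ e₂ p d γ ⊗ₜ 1) * actFirst X t := by
  induction t with
  | zero => simp
  | add t t' h h' => simp only [mul_add, map_add, TensorProduct.tmul_add, h, h']; abel
  | tmul x y =>
    simp only [actFirst, Algebra.TensorProduct.tmul_mul_tmul, LinearMap.comp_apply, one_mul,
      TensorProduct.map_tmul, LinearMap.id_apply, LinearEquiv.coe_coe, hX.leibniz,
      TensorProduct.add_tmul, map_add]
    congr 1
    · unfold inTwelve
      generalize X γ = s
      induction s with
      | zero => simp
      | add t t' h h' => simp only [TensorProduct.add_tmul, map_add, add_mul, h, h']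
      | tmul u v => simp
    · generalize X x = s
      induction s with
      | zero => simp
      | add t t' h h' => simp only [TensorProduct.add_tmul, map_add, mul_add, h, h']
      | tmul u v => simp

theorem actSecond_tmul_right (hX : IsDD e₁ e₂ p d X) (t : Ω ⊗[k] Ω) (β : Ω) :
    actSecond (passBy e₁ e₂ p d) X (t * (1 ⊗ₜ β)) =
      actSecond (passBy e₁ e₂ p d) X t * (1 ⊗ₜ (1 ⊗ₜ β)) +
      inTwelve (TensorProduct.map (passBy e₁ e₂ p d).toLinearMap
        (passBy e₁ e₂ p d).toLinearMap t) * (1 ⊗ₜ X β) := by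
  induction t with
  | zero => simp [inTwelve]
  | add t t' h h' =>
    have : ∀ s s' : Ω ⊗[k] Ω, inTwelve (s + s') = inTwelve s + inTwelve s' := by
      intro s s'; simp [inTwelve, TensorProduct.add_tmul]
    simp only [add_mul, map_add, h, h', this]; abel
  | tmul x y =>
    simp [actSecond, inTwelve, hX.leibniz, TensorProduct.tmul_add]

theorem actSecond_tmul_left (c : Ω →ₐ[k] Ω) (X : Ω →ₗ[k] Ω ⊗[k] Ω) (γ : Ω) (t : Ω ⊗[k] Ω) :
    actSecond c X ((γ ⊗ₜ 1) * t) = (c γ ⊗ₜ 1) * actSecond c X t := by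
  induction t with
  | zero => simp
  | add t t' h h' => simp only [mul_add, map_add, h, h']
  | tmul x y => simp [actSecond]

variable (e₁ e₂) in
/-- The bracket `(X ⊗ 1) Y - (-1)^{(X|Y)} (1 ⊗ Y) X` of double derivations of bidegrees `(p, d)`
and `(q, v)`. -/
def tripleBracket (p d q v : ℤ) (X Y : Ω →ₗ[k] Ω ⊗[k] Ω) : Ω →ₗ[k] Ω ⊗[k] (Ω ⊗[k] Ω) :=
  actFirst X ∘ₗ Y - sgn k (p * q + d * v) • (actSecond (passBy e₁ e₂ q v) Y ∘ₗ X)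

theorem passBy_comm (he : IsSignPair e₁ e₂) (p d q v : ℤ) (x : Ω) :
    passBy e₁ e₂ p d (passBy e₁ e₂ q v x) = passBy e₁ e₂ q v (passBy e₁ e₂ p d x) := by
  simp only [passBy, signPow, AlgHom.comp_apply]
  split_ifs <;> simp [he.comm]

/-- The triple bracket is a triple derivation for the outer bimodule structure. -/
theorem tripleBracket_mul (he : IsSignPair e₁ e₂) (hX : IsDD e₁ e₂ p d X) (hY : IsDD e₁ e₂ q v Y)
    (α β : Ω) : tripleBracket e₁ e₂ p d q v X Y (α * β) =
      tripleBracket e₁ e₂ p d q v X Y α * (1 ⊗ₜ (1 ⊗ₜ β)) +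
      (passBy e₁ e₂ p d (passBy e₁ e₂ q v α) ⊗ₜ 1) * tripleBracket e₁ e₂ p d q v X Y β := by
  simp only [tripleBracket, LinearMap.sub_apply, LinearMap.comp_apply, LinearMap.smul_apply,
    hX.leibniz, hY.leibniz, map_add, actFirst_tmul_right, actFirst_tmul_left hX,
    actSecond_tmul_right hY, actSecond_tmul_left, hX.map_passBy, sub_mul, mul_sub, smul_add,
    smul_mul_assoc, mul_smul_comm, passBy_comm he q v p d]
  -- The two cross terms, with `X` on `α` and `Y` on `β`, agree up to the sign from moving `passBy`
  -- through `X`. That sign is its own inverse, so they cancel.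
  have h : ∀ t : Ω ⊗[k] Ω, sgn k (p * q + d * v) • inTwelve (sgn k (q * p + v * d) • t) =
      inTwelve t := by
    intro t
    rw [inTwelve, ← TensorProduct.smul_tmul', map_smul, smul_smul, mul_comm q, mul_comm v,
      sgn_mul_self, one_smul]
    rfl
  rw [← smul_mul_assoc (sgn k (p * q + d * v)) (inTwelve _), h]
  abel

/-- `x ⊗ (m ⊗ z) ↦ ± m ⊗ z x`. -/
def moveFirst (e₁ e₂ : Ω →ₐ[k] Ω) : Ω ⊗[k] (Ω ⊗[k] Ω) →ₗ[k] Ω ⊗[k] Ω :=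
  TensorProduct.lift ((LinearMap.mul k (Ω ⊗[k] Ω)).compl₂
    (TensorProduct.mk k Ω Ω 1)) ∘ₗ
  signFlip e₁.toLinearMap e₂.toLinearMap (TensorProduct.map e₁.toLinearMap e₁.toLinearMap)
    (TensorProduct.map e₂.toLinearMap e₂.toLinearMap)

/-- `(x ⊗ m) ⊗ z ↦ ± z x ⊗ m`. -/
def moveLast (e₁ e₂ : Ω →ₐ[k] Ω) : Ω ⊗[k] (Ω ⊗[k] Ω) →ₗ[k] Ω ⊗[k] Ω :=
  TensorProduct.lift ((LinearMap.mul k (Ω ⊗[k] Ω)) ∘ₗ (TensorProduct.mk k Ω Ω).flip 1) ∘ₗ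
  signFlip (TensorProduct.map e₁.toLinearMap e₁.toLinearMap)
    (TensorProduct.map e₂.toLinearMap e₂.toLinearMap) e₁.toLinearMap e₂.toLinearMap ∘ₗ
  (TensorProduct.assoc k Ω Ω Ω).symm.toLinearMap

variable [CharZero k]

theorem moveFirst_tmul {x : Ω} {t : Ω ⊗[k] Ω}
    (hx : IsPar e₁.toLinearMap e₂.toLinearMap p d x) (ht : IsPar₂ e₁ e₂ q v t) :
    moveFirst e₁ e₂ (x ⊗ₜ t) = sgn k (p * q + d * v) • (t * (1 ⊗ₜ x)) := by
  rw [moveFirst, LinearMap.comp_apply, signFlip_tmul hx ht, map_smul]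
  simp

theorem moveLast_tmul {x : Ω} {t : Ω ⊗[k] Ω}
    (ht : IsPar₂ e₁ e₂ q v t) (hx : IsPar e₁.toLinearMap e₂.toLinearMap p d x) :
    moveLast e₁ e₂ (TensorProduct.assoc k Ω Ω Ω (t ⊗ₜ x)) =
      sgn k (q * p + v * d) • ((x ⊗ₜ 1) * t) := by
  rw [moveLast, LinearMap.comp_apply, LinearMap.comp_apply, LinearEquiv.coe_coe,
    LinearEquiv.symm_apply_apply, signFlip_tmul ht hx, map_smul]
  simp

variable (e₁ e₂) in
/-- The Koszul flip of `Ω ⊗ Ω`. -/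
abbrev flip₂ : Ω ⊗[k] Ω →ₗ[k] Ω ⊗[k] Ω :=
  signFlip e₁.toLinearMap e₂.toLinearMap e₁.toLinearMap e₂.toLinearMap

variable (e₁ e₂) in
/-- The signed opposite multiplication `x ⊗ y ↦ ± y x`. -/
def opMul : Ω ⊗[k] Ω →ₗ[k] Ω := LinearMap.mul' k Ω ∘ₗ flip₂ e₁ e₂

theorem opMul_tmul {x y : Ω} (hx : IsPar e₁.toLinearMap e₂.toLinearMap p d x)
    (hy : IsPar e₁.toLinearMap e₂.toLinearMap q v y) :
    opMul e₁ e₂ (x ⊗ₜ y) = sgn k (p * q + d * v) • (y * x) := by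
  rw [opMul, LinearMap.comp_apply, flip₂, signFlip_tmul hx hy, map_smul]
  simp

/-- Apply the Leibniz rule to `± y x`. When `X` hits `y`, the factor `x` is reattached on the far
right (`moveFirst`); when it hits `x`, the factor `y` is reattached on the far left (`moveLast`). -/
theorem IsDD.comp_opMul (he : IsSignPair e₁ e₂) (hX : IsDD e₁ e₂ p d X) :
    X ∘ₗ opMul e₁ e₂ = moveFirst e₁ e₂ ∘ₗ actSecond (passBy e₁ e₂ p d) X +
      moveLast e₁ e₂ ∘ₗ actFirst X := by
  refine he.ext_tmul fun q w r v x y hx hy => ?_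
  simp only [LinearMap.comp_apply, LinearMap.add_apply, actSecond, actFirst,
    TensorProduct.map_tmul, AlgHom.toLinearMap_apply, LinearMap.id_apply, LinearEquiv.coe_coe]
  rw [opMul_tmul hx hy, map_smul, hX.leibniz, passBy_of_isPar _ _ hx, passBy_of_isPar _ _ hy,
    ← TensorProduct.smul_tmul', ← TensorProduct.smul_tmul', map_smul,
    moveFirst_tmul hx (hX.isPar hy), moveLast_tmul (hX.isPar hx) hy, smul_add, smul_mul_assoc,
    smul_smul, smul_smul, ← sgn_add, ← sgn_add]
  congr 2
  · apply sgn_congr; exact ⟨-(p * q + d * w), by ring⟩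
  · congr 1; ring

/-- Both rotations of `x ⊗ m ⊗ z` form the product `z x` and differ only in the side on which `m`
stands. The Koszul signs match. -/
theorem flip₂_moveFirst (he : IsSignPair e₁ e₂) (t : Ω ⊗[k] (Ω ⊗[k] Ω)) :
    flip₂ e₁ e₂ (moveFirst e₁ e₂ t) = moveLast e₁ e₂ t := by
  induction t with
  | zero => simp
  | add t t' h h' => simp only [map_add, h, h']
  | tmul x s =>
    induction x using he.induction with
    | hadd x x' h1 h2 => simp only [TensorProduct.add_tmul, map_add, h1, h2]
    | h p w x hx =>
    induction s with
    | zero => simp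
    | add s s' h h' => simp only [TensorProduct.tmul_add, map_add, h, h']
    | tmul y z =>
    induction y using he.induction with
    | hadd y y' h1 h2 => simp only [TensorProduct.tmul_add, TensorProduct.add_tmul, map_add, h1, h2]
    | h q u y hy =>
    induction z using he.induction with
    | hadd z z' h1 h2 => simp only [TensorProduct.tmul_add, map_add, h1, h2]
    | h r v z hz =>
    have h := moveLast_tmul (hx.tmul hy) hz
    rw [TensorProduct.assoc_tmul] at h
    rw [h, moveFirst_tmul hx (hy.tmul hz), map_smul, Algebra.TensorProduct.tmul_mul_tmul, mul_one,
      signFlip_tmul hy (hz.mul hx),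
      smul_smul, Algebra.TensorProduct.tmul_mul_tmul, one_mul, ← sgn_add]
    refine congrArg (fun c : k => c • ((z * x) ⊗ₜ[k] y)) (sgn_congr ?_)
    exact ⟨p * q + w * u, by ring⟩

theorem flip₂_flip₂ (he : IsSignPair e₁ e₂) (t : Ω ⊗[k] Ω) :
    flip₂ e₁ e₂ (flip₂ e₁ e₂ t) = t := by
  suffices h : flip₂ e₁ e₂ ∘ₗ flip₂ e₁ e₂ = LinearMap.id from LinearMap.congr_fun h t
  refine he.ext_tmul fun q u r v y z hy hz => ?_
  rw [LinearMap.comp_apply, signFlip_tmul hy hz, map_smul, signFlip_tmul hz hy, smul_smul,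
    ← sgn_add, sgn_of_even, one_smul, LinearMap.id_apply]
  exact ⟨q * r + u * v, by ring⟩

theorem flip₂_moveLast (he : IsSignPair e₁ e₂) (t : Ω ⊗[k] (Ω ⊗[k] Ω)) :
    flip₂ e₁ e₂ (moveLast e₁ e₂ t) = moveFirst e₁ e₂ t := by
  rw [← flip₂_moveFirst he, flip₂_flip₂ he]

/-- The fundamental identity of the reduced calculus. -/
theorem opMul_bracket (he : IsSignPair e₁ e₂) (hX : IsDD e₁ e₂ p d X) (hY : IsDD e₁ e₂ q v Y)
    (α : Ω) :
    X (opMul e₁ e₂ (Y α)) - sgn k (p * q + d * v) • flip₂ e₁ e₂ (Y (opMul e₁ e₂ (X α))) =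
      moveLast e₁ e₂ (tripleBracket e₁ e₂ p d q v X Y α) -
      sgn k (p * q + d * v) • moveFirst e₁ e₂ (tripleBracket e₁ e₂ q v p d Y X α) := by
  have h1 := LinearMap.congr_fun (hX.comp_opMul he) (Y α)
  have h2 := LinearMap.congr_fun (hY.comp_opMul he) (X α)
  simp only [LinearMap.comp_apply, LinearMap.add_apply] at h1 h2
  -- The flip exchanges the rotations in the second expansion, so the four terms regroup into one
  -- triple bracket under `moveLast` and one under `moveFirst`.
  rw [h1, h2, map_add, flip₂_moveFirst he, flip₂_moveLast he]
  simp only [tripleBracket, LinearMap.sub_apply, LinearMap.comp_apply, LinearMap.smul_apply,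
    map_sub, map_smul, smul_sub, smul_add, smul_smul]
  rw [mul_comm q p, mul_comm v d, sgn_mul_self, one_smul]
  abel

end SignCalculus

section SignCalculus

variable {k : Type*} [Field k] {Ω : Type*} [Ring Ω] [Algebra k Ω]
variable {e₁ e₂ : Ω →ₐ[k] Ω} {p d q v : ℤ} {X Y : Ω →ₗ[k] Ω ⊗[k] Ω}

/-! ### Graded derivations -/

variable (e₁ e₂) in
/-- `D` is a graded derivation of bidegree `(p, d)`. -/
structure IsDer (p d : ℤ) (D : Ω →ₗ[k] Ω) : Prop where
  leibniz : ∀ α β, D (α * β) = D α * β + passBy e₁ e₂ p d α * D β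
  par₁ : ∀ α, e₁ (D α) = sgn k p • D (e₁ α)
  par₂ : ∀ α, e₂ (D α) = sgn k d • D (e₂ α)

/-- Multiplication is a bimodule map from the outer structure on `Ω ⊗ Ω` and commutes with algebra
automorphisms, so it preserves both the Leibniz rule and the parities. -/
theorem IsDD.mul'_isDer (hX : IsDD e₁ e₂ p d X) :
    IsDer e₁ e₂ p d (LinearMap.mul' k Ω ∘ₗ X) := by
  have hr : ∀ (t : Ω ⊗[k] Ω) (β : Ω),
      LinearMap.mul' k Ω (t * (1 ⊗ₜ β)) = LinearMap.mul' k Ω t * β := by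
    intro t β
    induction t with
    | zero => simp
    | add t t' h h' => simp only [add_mul, map_add, h, h']
    | tmul x y => simp [mul_assoc]
  have hl : ∀ (t : Ω ⊗[k] Ω) (β : Ω),
      LinearMap.mul' k Ω ((β ⊗ₜ 1) * t) = β * LinearMap.mul' k Ω t := by
    intro t β
    induction t with
    | zero => simp
    | add t t' h h' => simp only [mul_add, map_add, h, h']
    | tmul x y => simp [mul_assoc]
  have he : ∀ (e : Ω →ₐ[k] Ω) (t : Ω ⊗[k] Ω), e (LinearMap.mul' k Ω t) =
      LinearMap.mul' k Ω (TensorProduct.map e.toLinearMap e.toLinearMap t) := by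
    intro e t
    induction t with
    | zero => simp
    | add t t' h h' => simp only [map_add, h, h']
    | tmul x y => simp
  refine ⟨fun α β => ?_, fun α => ?_, fun α => ?_⟩
  · simp only [LinearMap.comp_apply, hX.leibniz, map_add, hr, hl]
  · simp only [LinearMap.comp_apply, he, hX.par₁, map_smul]
  · simp only [LinearMap.comp_apply, he, hX.par₂, map_smul]

variable {D : Ω →ₗ[k] Ω}

/-- A derivation acting on `Ω ⊗ Ω`. -/
def derTensor (c : Ω →ₐ[k] Ω) (D : Ω →ₗ[k] Ω) : Ω ⊗[k] Ω →ₗ[k] Ω ⊗[k] Ω :=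
  TensorProduct.map D LinearMap.id + TensorProduct.map c.toLinearMap D

theorem derTensor_tmul (c : Ω →ₐ[k] Ω) (D : Ω →ₗ[k] Ω) (x y : Ω) :
    derTensor c D (x ⊗ₜ y) = D x ⊗ₜ y + c x ⊗ₜ D y := rfl

theorem derTensor_tmul_right (hD : IsDer e₁ e₂ p d D) (t : Ω ⊗[k] Ω) (β : Ω) :
    derTensor (passBy e₁ e₂ p d) D (t * (1 ⊗ₜ β)) =
      derTensor (passBy e₁ e₂ p d) D t * (1 ⊗ₜ β) +
        TensorProduct.map (passBy e₁ e₂ p d).toLinearMap (passBy e₁ e₂ p d).toLinearMap t *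
          (1 ⊗ₜ D β) := by
  induction t with
  | zero => simp
  | add t t' h h' => simp only [add_mul, map_add, h, h']; abel
  | tmul x y =>
    simp [derTensor_tmul, hD.leibniz, TensorProduct.tmul_add, add_mul, add_assoc]

theorem derTensor_tmul_left (hD : IsDer e₁ e₂ p d D) (γ : Ω) (t : Ω ⊗[k] Ω) :
    derTensor (passBy e₁ e₂ p d) D ((γ ⊗ₜ 1) * t) = (D γ ⊗ₜ 1) * t +
      (passBy e₁ e₂ p d γ ⊗ₜ 1) * derTensor (passBy e₁ e₂ p d) D t := by
  induction t with
  | zero => simp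
  | add t t' h h' => simp only [mul_add, map_add, h, h']; abel
  | tmul x y =>
    simp [derTensor_tmul, hD.leibniz, TensorProduct.add_tmul, mul_add, add_assoc]

theorem IsDer.signPow_apply {r : ℤ} {e : Ω →ₐ[k] Ω} (h : ∀ α, e (D α) = sgn k r • D (e α)) (n : ℤ)
    (α : Ω) : signPow e n (D α) = sgn k (n * r) • D (signPow e n α) := by
  unfold signPow
  split_ifs with hn
  · rw [sgn_of_even (hn.mul_right r)]
    simp
  · rw [h, sgn_congr (m := n * r) (n := r)]
    rw [Int.not_even_iff_odd] at hn
    obtain ⟨s, rfl⟩ := hn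
    exact ⟨s * r, by ring⟩

theorem IsDer.passBy_apply (hD : IsDer e₁ e₂ p d D) (q v : ℤ) (α : Ω) :
    passBy e₁ e₂ q v (D α) = sgn k (p * q + d * v) • D (passBy e₁ e₂ q v α) := by
  rw [passBy, AlgHom.comp_apply, IsDer.signPow_apply hD.par₂, map_smul,
    IsDer.signPow_apply hD.par₁, smul_smul, ← sgn_add, add_comm, mul_comm q, mul_comm v]
  rfl

variable (e₁ e₂) in
/-- The commutator of a derivation and a double derivation. -/
def derBracket (p d q v : ℤ) (D : Ω →ₗ[k] Ω) (Y : Ω →ₗ[k] Ω ⊗[k] Ω) : Ω →ₗ[k] Ω ⊗[k] Ω :=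
  derTensor (passBy e₁ e₂ p d) D ∘ₗ Y - sgn k (p * q + d * v) • (Y ∘ₗ D)

/-- As for the triple bracket, the terms in which `D` and `Y` hit different factors of `αβ` occur
twice and cancel in the graded commutator. -/
theorem derBracket_mul (he : IsSignPair e₁ e₂) (hD : IsDer e₁ e₂ p d D) (hY : IsDD e₁ e₂ q v Y)
    (α β : Ω) : derBracket e₁ e₂ p d q v D Y (α * β) =
      derBracket e₁ e₂ p d q v D Y α * (1 ⊗ₜ β) +
      (passBy e₁ e₂ p d (passBy e₁ e₂ q v α) ⊗ₜ 1) * derBracket e₁ e₂ p d q v D Y β := by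
  simp only [derBracket, LinearMap.sub_apply, LinearMap.comp_apply, LinearMap.smul_apply,
    hD.leibniz, hY.leibniz, map_add, derTensor_tmul_right hD, derTensor_tmul_left hD,
    hY.map_passBy, sub_mul, mul_sub, smul_add, smul_mul_assoc, mul_smul_comm,
    passBy_comm he q v p d, hD.passBy_apply, ← TensorProduct.smul_tmul', smul_smul, sgn_mul_self,
    one_smul]
  abel

theorem IsDer.isPar (hX : IsDer e₁ e₂ p d D) {α : Ω}
    (h : IsPar e₁.toLinearMap e₂.toLinearMap q v α) :
    IsPar e₁.toLinearMap e₂.toLinearMap (p + q) (d + v) (D α) := by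
  have h1 : e₁ α = sgn k q • α := h.1
  have h2 : e₂ α = sgn k v • α := h.2
  constructor
  · rw [AlgHom.toLinearMap_apply, hX.par₁, h1, map_smul, smul_smul, sgn_add]
  · rw [AlgHom.toLinearMap_apply, hX.par₂, h2, map_smul, smul_smul, sgn_add]

theorem IsDer.comp_opMul [CharZero k] (he : IsSignPair e₁ e₂) (hD : IsDer e₁ e₂ p d D) :
    D ∘ₗ opMul e₁ e₂ = opMul e₁ e₂ ∘ₗ derTensor (passBy e₁ e₂ p d) D := by
  refine he.ext_tmul fun q w r v x y hx hy => ?_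
  simp only [LinearMap.comp_apply, derTensor_tmul, map_add]
  rw [opMul_tmul hx hy, map_smul, hD.leibniz, passBy_of_isPar _ _ hx, passBy_of_isPar _ _ hy,
    ← TensorProduct.smul_tmul', map_smul, opMul_tmul (hD.isPar hx) hy, opMul_tmul hx (hD.isPar hy),
    smul_add, smul_mul_assoc, smul_smul, smul_smul, ← sgn_add, ← sgn_add, add_comm]
  refine congrArg₂ _ ?_ ?_
  · exact congrArg (fun c : k => c • (y * D x)) (congrArg _ (by ring))
  · refine congrArg (fun c : k => c • (D y * x)) (sgn_congr ?_)
    exact ⟨-(p * q + d * w), by ring⟩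

/-! ### Applying a functional to one tensor factor -/

/-- `x ⊗ (m ⊗ z) ↦ l(m) x ⊗ z`. -/
def midEval (l : Ω →ₗ[k] k) : Ω ⊗[k] (Ω ⊗[k] Ω) →ₗ[k] Ω ⊗[k] Ω :=
  TensorProduct.map LinearMap.id ((TensorProduct.lid k Ω).toLinearMap ∘ₗ
    TensorProduct.map l LinearMap.id)

/-- `x ⊗ m ↦ l(m) x`. -/
def lastEval (l : Ω →ₗ[k] k) : Ω ⊗[k] Ω →ₗ[k] Ω :=
  (TensorProduct.rid k Ω).toLinearMap ∘ₗ TensorProduct.map LinearMap.id l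

theorem midEval_tmul (l : Ω →ₗ[k] k) (x m z : Ω) :
    midEval l (x ⊗ₜ (m ⊗ₜ z)) = l m • (x ⊗ₜ z) := by
  simp [midEval]

theorem lastEval_tmul (l : Ω →ₗ[k] k) (x m : Ω) : lastEval l (x ⊗ₜ m) = l m • x := by
  simp [lastEval]

theorem midEval_tmul_right (l : Ω →ₗ[k] k) (t : Ω ⊗[k] (Ω ⊗[k] Ω)) (β : Ω) :
    midEval l (t * (1 ⊗ₜ (1 ⊗ₜ β))) = midEval l t * (1 ⊗ₜ β) := by
  induction t with
  | zero => simp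
  | add t t' h h' => simp only [add_mul, map_add, h, h']
  | tmul x s =>
    induction s with
    | zero => simp
    | add t t' h h' => simp only [TensorProduct.tmul_add, add_mul, map_add, h, h']
    | tmul m z => simp [midEval_tmul]

theorem midEval_tmul_left (l : Ω →ₗ[k] k) (t : Ω ⊗[k] (Ω ⊗[k] Ω)) (β : Ω) :
    midEval l ((β ⊗ₜ 1) * t) = (β ⊗ₜ 1) * midEval l t := by
  induction t with
  | zero => simp
  | add t t' h h' => simp only [mul_add, map_add, h, h']
  | tmul x s =>
    induction s with
    | zero => simp
    | add t t' h h' => simp only [TensorProduct.tmul_add, mul_add, map_add, h, h']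
    | tmul m z => simp [midEval_tmul]

/-- A functional invariant under a sign automorphism vanishes on odd elements. Koszul signs
involving an element on which it is evaluated may therefore be dropped. -/
theorem sgn_mul_of_even_functional [CharZero k] {q : ℤ} {c : k} (h : sgn k q * c = c) (r : ℤ) :
    sgn k (q * r) * c = c := by
  by_cases hq : Even q
  · rw [sgn_of_even (hq.mul_right r), one_mul]
  · rw [sgn_of_not_even hq, neg_one_mul, neg_eq_iff_add_eq_zero, ← two_mul] at h
    have : c = 0 := by simpa using h
    rw [this, mul_zero]

/-- Rotating `x ⊗ m ⊗ z` to `± z x ⊗ m` puts the middle factor last. Evaluating `l` there leaves `±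
z x`, and the signs involving `m` disappear by invariance of `l`. -/
theorem lastEval_moveLast [CharZero k] (he : IsSignPair e₁ e₂) (l : Ω →ₗ[k] k)
    (h₁ : ∀ x, l (e₁ x) = l x) (h₂ : ∀ x, l (e₂ x) = l x) (t : Ω ⊗[k] (Ω ⊗[k] Ω)) :
    lastEval l (moveLast e₁ e₂ t) = opMul e₁ e₂ (midEval l t) := by
  induction t with
  | zero => simp
  | add t t' h h' => simp only [map_add, h, h']
  | tmul x s =>
    induction s with
    | zero => simp
    | add s s' h h' => simp only [TensorProduct.tmul_add, map_add, h, h']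
    | tmul y z =>
    induction x using he.induction with
    | hadd x x' h1 h2 => simp only [TensorProduct.add_tmul, map_add, h1, h2]
    | h p w x hx =>
    induction y using he.induction with
    | hadd y y' h1 h2 => simp only [TensorProduct.tmul_add, TensorProduct.add_tmul, map_add, h1, h2]
    | h q u y hy =>
    induction z using he.induction with
    | hadd z z' h1 h2 => simp only [TensorProduct.tmul_add, map_add, h1, h2]
    | h r v z hz =>
    have h := moveLast_tmul (hx.tmul hy) hz
    rw [TensorProduct.assoc_tmul] at h
    have hq : sgn k q * l y = l y := by
      rw [← smul_eq_mul, ← map_smul, ← hy.1]; exact h₁ y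
    have hu : sgn k u * l y = l y := by
      rw [← smul_eq_mul, ← map_smul, ← hy.2]; exact h₂ y
    rw [h, Algebra.TensorProduct.tmul_mul_tmul, one_mul, map_smul, lastEval_tmul, midEval_tmul,
      map_smul, opMul_tmul hx hz, smul_smul, smul_smul]
    refine congrArg (fun c : k => c • (z * x)) ?_
    have e : (p + q) * r + (w + u) * v = (p * r + w * v) + q * r + u * v := by ring
    rw [e, sgn_add, sgn_add, mul_assoc, sgn_mul_of_even_functional hu, mul_assoc,
      sgn_mul_of_even_functional hq, mul_comm]

/-- The rotation gives `± m ⊗ z x`, and `l(π(z x))` depends only on `π z` and `π x`. The value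
therefore factors through applying `π` to the two outer factors. -/
theorem lastEval_moveFirst [CharZero k] (he : IsSignPair e₁ e₂) {C : Type*} [Ring C] [Algebra k C]
    (π : Ω →ₐ[k] C) (h₁ : ∀ x, π (e₁ x) = π x) (h₂ : ∀ x, π (e₂ x) = π x) (l : C →ₗ[k] k)
    (t : Ω ⊗[k] (Ω ⊗[k] Ω))
    (ht : TensorProduct.map π.toLinearMap (TensorProduct.map LinearMap.id π.toLinearMap) t = 0) :
    lastEval (l ∘ₗ π.toLinearMap) (moveFirst e₁ e₂ t) = 0 := by
  -- The factorization: `G` sends `b ⊗ y ⊗ c` to `l(c b) y`.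
  let G : C ⊗[k] (Ω ⊗[k] C) →ₗ[k] Ω :=
    TensorProduct.lift (LinearMap.mk₂ k
      (fun b s => TensorProduct.rid k Ω (TensorProduct.map LinearMap.id
        (l ∘ₗ LinearMap.mulRight k b) s))
      (fun b b' s => by
        have : LinearMap.mulRight k (b + b') = LinearMap.mulRight k b + LinearMap.mulRight k b' := by
          ext; simp [mul_add]
        simp [this, LinearMap.comp_add, TensorProduct.map_add_right])
      (fun c b s => by
        have : LinearMap.mulRight k (c • b) = c • LinearMap.mulRight k b := by
          ext; simp
        simp [this, LinearMap.comp_smul, TensorProduct.map_smul_right])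
      (fun b s s' => by simp)
      (fun c b s => by simp))
  have key : ∀ t, lastEval (l ∘ₗ π.toLinearMap) (moveFirst e₁ e₂ t) =
      G (TensorProduct.map π.toLinearMap (TensorProduct.map LinearMap.id π.toLinearMap) t) := by
    intro t
    induction t with
    | zero => simp
    | add t t' h h' => simp only [map_add, h, h']
    | tmul x s =>
      induction s with
      | zero => simp
      | add s s' h h' => simp only [TensorProduct.tmul_add, map_add, h, h']
      | tmul y z =>
      induction x using he.induction with
      | hadd x x' h1 h2 => simp only [TensorProduct.add_tmul, map_add, h1, h2]
      | h p w x hx =>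
      induction y using he.induction with
      | hadd y y' h1 h2 =>
        simp only [TensorProduct.tmul_add, TensorProduct.add_tmul, map_add, h1, h2]
      | h q u y hy =>
      induction z using he.induction with
      | hadd z z' h1 h2 => simp only [TensorProduct.tmul_add, map_add, h1, h2]
      | h r v z hz =>
      have hq : sgn k p * l (π (z * x)) = l (π (z * x)) := by
        rw [← smul_eq_mul, ← map_smul, map_mul, ← mul_smul_comm, ← map_smul, ← hx.1]
        exact congrArg (fun y => l (π z * y)) (h₁ x)
      have hu : sgn k w * l (π (z * x)) = l (π (z * x)) := by
        rw [← smul_eq_mul, ← map_smul, map_mul, ← mul_smul_comm, ← map_smul, ← hx.2]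
        exact congrArg (fun y => l (π z * y)) (h₂ x)
      have hG : G (π x ⊗ₜ (y ⊗ₜ π z)) = l (π z * π x) • y := by simp [G]
      rw [moveFirst_tmul hx (hy.tmul hz), Algebra.TensorProduct.tmul_mul_tmul, mul_one, map_smul,
        lastEval_tmul, TensorProduct.map_tmul, TensorProduct.map_tmul, AlgHom.toLinearMap_apply,
        AlgHom.toLinearMap_apply, LinearMap.id_apply, hG, smul_smul, LinearMap.comp_apply,
        AlgHom.toLinearMap_apply, sgn_add, mul_assoc, sgn_mul_of_even_functional hu,
        sgn_mul_of_even_functional hq, map_mul]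
  rw [key, ht, map_zero]

end SignCalculus

/-! ### Closure of double derivations under commutators with derivations -/

section SignCalculus

variable {k : Type*} [Field k] {Ω : Type*} [Ring Ω] [Algebra k Ω]
variable {e₁ e₂ : Ω →ₐ[k] Ω} {p d q v : ℤ} {Y : Ω →ₗ[k] Ω ⊗[k] Ω} {D : Ω →ₗ[k] Ω}

theorem signPow_signPow {e : Ω →ₐ[k] Ω} (he : ∀ x, e (e x) = x) (m n : ℤ) (x : Ω) :
    signPow e m (signPow e n x) = signPow e (m + n) x := by
  unfold signPow
  by_cases hm : Even m <;> by_cases hn : Even n <;> simp [hm, hn, Int.even_add, he]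

theorem passBy_passBy (he : IsSignPair e₁ e₂) (p d q v : ℤ) (x : Ω) :
    passBy e₁ e₂ p d (passBy e₁ e₂ q v x) = passBy e₁ e₂ (p + q) (d + v) x := by
  have hc : ∀ y, signPow e₂ d (signPow e₁ q y) = signPow e₁ q (signPow e₂ d y) := by
    intro y
    unfold signPow
    split_ifs <;> simp [he.comm]
  simp only [passBy, AlgHom.comp_apply, hc, signPow_signPow he.sq₁, signPow_signPow he.sq₂]

/-- Applied to the de Rham differential and a contraction, this makes the double Lie derivative a
double derivation of form degree 0. -/
theorem derBracket_isDD (he : IsSignPair e₁ e₂) (hD : IsDer e₁ e₂ p d D) (hY : IsDD e₁ e₂ q v Y) :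
    IsDD e₁ e₂ (p + q) (d + v) (derBracket e₁ e₂ p d q v D Y) := by
  have key : ∀ (e : Ω →ₐ[k] Ω) (r s : ℤ) (_ : ∀ α, e (D α) = sgn k r • D (e α))
      (_ : ∀ x, e (passBy e₁ e₂ p d x) = passBy e₁ e₂ p d (e x))
      (_ : ∀ α, TensorProduct.map e.toLinearMap e.toLinearMap (Y α) = sgn k s • Y (e α)) (α : Ω),
      TensorProduct.map e.toLinearMap e.toLinearMap (derBracket e₁ e₂ p d q v D Y α) =
        sgn k (r + s) • derBracket e₁ e₂ p d q v D Y (e α) := by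
    intro e r s h1 h2 h3 α
    have h : ∀ t : Ω ⊗[k] Ω, TensorProduct.map e.toLinearMap e.toLinearMap
        (derTensor (passBy e₁ e₂ p d) D t) =
        sgn k r • derTensor (passBy e₁ e₂ p d) D
          (TensorProduct.map e.toLinearMap e.toLinearMap t) := by
      intro t
      induction t with
      | zero => simp
      | add t t' h h' => simp only [map_add, h, h', smul_add]
      | tmul x y =>
        simp only [derTensor_tmul, map_add, TensorProduct.map_tmul, AlgHom.toLinearMap_apply, h1, h2,
          smul_add, TensorProduct.tmul_smul, TensorProduct.smul_tmul']
    simp only [derBracket, LinearMap.sub_apply, LinearMap.comp_apply, LinearMap.smul_apply, map_sub,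
      map_smul, h, h3, h1, smul_sub, sgn_add, smul_smul]
    congr 2
    ring
  refine ⟨fun α β => ?_, fun α => key e₁ p q hD.par₁ (fun x => ?_) hY.par₁ α,
    fun α => key e₂ d v hD.par₂ (fun x => ?_) hY.par₂ α⟩
  · rw [derBracket_mul he hD hY, passBy_passBy he]
  · simp only [passBy, signPow, AlgHom.comp_apply]
    split_ifs <;> simp [he.comm]
  · simp only [passBy, signPow, AlgHom.comp_apply]
    split_ifs <;> simp [he.comm]

end SignCalculus

/-! ## Contractions and Lie derivatives on noncommutative forms -/

section FormsCalculus

variable {k : Type*} [Field k]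
variable {R : Type*} [Ring R] [Algebra k R]
variable {A : Type*} [Ring A] [Algebra k A]
variable {f : R →ₐ[k] A} {𝒜 : ℕ → Submodule k A} [GradedAlgebra 𝒜] (hf : ∀ r, f r ∈ 𝒜 0)

theorem weightSign_eq_signPow (d : ℤ) : weightSign 𝒜 d = signPow (weightSign 𝒜 1) d := by
  ext a
  induction a using DirectSum.Decomposition.inductionOn 𝒜 with
  | zero => simp
  | @homogeneous n a =>
    have h : weightSign 𝒜 1 (a : A) = sgn k n • (a : A) := by
      simpa using weightSign_of_mem 𝒜 1 a.2
    rw [signPow_apply_of_eq d h, weightSign_of_mem 𝒜 d a.2]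
  | add x y hx hy => rw [map_add, map_add, hx, hy]

theorem weightSign_weightSign (a : A) : weightSign 𝒜 1 (weightSign 𝒜 1 a) = a := by
  induction a using DirectSum.Decomposition.inductionOn 𝒜 with
  | zero => simp
  | @homogeneous n a =>
    rw [weightSign_of_mem 𝒜 1 a.2, map_smul, weightSign_of_mem 𝒜 1 a.2, smul_smul, sgn_mul_self,
      one_smul]
  | add x y hx hy => rw [map_add, map_add, hx, hy]

namespace Forms

theorem algHom_ext {C : Type*} [Ring C] [Algebra k C] {g h : Forms f →ₐ[k] C}
    (ho : ∀ a, g (of f a) = h (of f a)) (hδ : ∀ a, g (δ f a) = h (δ f a)) : g = h := by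
  ext x
  induction x using Forms.induction with
  | ho a => exact ho a
  | hδ a => exact hδ a
  | hadd x y hx hy => rw [map_add, map_add, hx, hy]
  | hmul x y hx hy => rw [map_mul, map_mul, hx, hy]

theorem weightSign_eq_signPow (d : ℤ) : weightSign hf d = signPow (weightSign hf 1) d := by
  have h := NCCourant.weightSign_eq_signPow (𝒜 := 𝒜) d
  unfold signPow at h ⊢
  split_ifs with hd
  · rw [if_pos hd] at h
    exact algHom_ext (fun a => by simp [weightSign_of, h]) (fun a => by simp [weightSign_δ, h])
  · rw [if_neg hd] at h
    exact algHom_ext (fun a => by simp [weightSign_of, h]) (fun a => by simp [weightSign_δ, h])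

theorem isSignPair : IsSignPair (formSign f) (weightSign hf 1) where
  sq₁ x := by
    have : (formSign f).comp (formSign f) = AlgHom.id k _ :=
      algHom_ext (fun a => by simp [formSign_of]) (fun a => by simp [formSign_δ])
    exact DFunLike.congr_fun this x
  sq₂ x := by
    have : (weightSign hf 1).comp (weightSign hf 1) = AlgHom.id k _ :=
      algHom_ext (fun a => by simp [weightSign_of, weightSign_weightSign])
        (fun a => by simp [weightSign_δ, weightSign_weightSign])
    exact DFunLike.congr_fun this x
  comm x := by
    have : (formSign f).comp (weightSign hf 1) = (weightSign hf 1).comp (formSign f) :=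
      algHom_ext (fun a => by simp [weightSign_of, formSign_of])
        (fun a => by simp [weightSign_δ, formSign_δ])
    exact DFunLike.congr_fun this x

/-- The sign of passing a form by an operator of bidegree `(p, d)`. -/
abbrev pass (p d : ℤ) : Forms f →ₐ[k] Forms f := passBy (formSign f) (weightSign hf 1) p d

theorem passSign_eq (d : ℤ) : passSign hf d = pass hf (-1) d := by
  have h : ¬ Even (-1 : ℤ) := by decide
  unfold pass passBy
  rw [passSign, weightSign_eq_signPow, signPow.eq_1 (formSign f), if_neg h]

theorem pass_one_zero : pass hf 1 0 = formSign f := by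
  have h : ¬ Even (1 : ℤ) := by decide
  have h' : Even (0 : ℤ) := by decide
  unfold pass passBy signPow
  rw [if_neg h, if_pos h']
  rfl

theorem pass_of (p d : ℤ) (a : A) : pass hf p d (of f a) = of f (NCCourant.weightSign 𝒜 d a) := by
  rw [pass, passBy, AlgHom.comp_apply, ← weightSign_eq_signPow, weightSign_of]
  unfold signPow
  split_ifs <;> simp [formSign_of]

/-- The sum of the homogeneous pieces contains the generators `a` and `da` and is closed under
products, so it is everything. Directness of the sum is not needed. -/
theorem homog_induction {p : Forms f → Prop} (hadd : ∀ x y, p x → p y → p (x + y))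
    (h : ∀ q w, ∀ x ∈ homog f 𝒜 q w, p x) (x : Forms f) : p x := by
  have hle : ∀ q w, homog f 𝒜 q w ≤ ⨆ i : ℕ × ℤ, homog f 𝒜 i.1 i.2 := fun q w =>
    le_iSup (fun i : ℕ × ℤ => homog f 𝒜 i.1 i.2) (q, w)
  have key : ∀ x : Forms f, x ∈ ⨆ i : ℕ × ℤ, homog f 𝒜 i.1 i.2 := by
    clear x h hadd
    intro x
    induction x using Forms.induction with
    | ho a =>
      induction a using DirectSum.Decomposition.inductionOn 𝒜 with
      | zero => rw [map_zero]; exact zero_mem _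
      | @homogeneous n a => exact hle 0 n (Submodule.subset_span (.of a.2))
      | add x y hx hy => rw [map_add]; exact add_mem hx hy
    | hδ a =>
      induction a using DirectSum.Decomposition.inductionOn 𝒜 with
      | zero => rw [map_zero]; exact zero_mem _
      | @homogeneous n a => exact hle 1 n (Submodule.subset_span (.δ a.2))
      | add x y hx hy => rw [map_add]; exact add_mem hx hy
    | hadd x y hx hy => exact add_mem hx hy
    | hmul x y hx hy =>
      have hle' : (⨆ i : ℕ × ℤ, homog f 𝒜 i.1 i.2) * (⨆ i : ℕ × ℤ, homog f 𝒜 i.1 i.2) ≤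
          ⨆ i : ℕ × ℤ, homog f 𝒜 i.1 i.2 := by
        rw [Submodule.iSup_mul]
        refine iSup_le fun i => ?_
        rw [Submodule.mul_iSup]
        exact iSup_le fun j => Submodule.mul_le.2 fun x hx y hy =>
          hle _ _ (mul_mem_homog f 𝒜 hx hy)
      exact hle' (Submodule.mul_mem_mul hx hy)
  exact Submodule.iSup_induction _ (motive := p) (key x) (fun i x hx => h _ _ x hx)
    (h 0 0 0 (zero_mem _)) hadd

theorem isPar_of_mem {p : ℕ} {w : ℤ} {α : Forms f} (h : α ∈ homog f 𝒜 p w) :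
    IsPar (formSign f).toLinearMap (weightSign hf 1).toLinearMap p w α :=
  ⟨formSign_of_mem f 𝒜 h, by simpa using weightSign_of_mem hf 1 h⟩

theorem isPar₂_of_mem {p : ℕ} {w : ℤ} {t : Forms f ⊗[k] Forms f}
    (h : t ∈ tensorHomog (f := f) (𝒜 := 𝒜) p w) :
    IsPar₂ (formSign f) (weightSign hf 1) (-1 + p) w t := by
  induction h using Submodule.span_induction with
  | mem t ht =>
    obtain ⟨p₁, p₂, w₁, w₂, x, hx, y, hy, rfl, rfl, rfl⟩ := ht
    have := (isPar_of_mem hf hx).tmul (isPar_of_mem hf hy)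
    -- `tensorHomog p` has total form degree `p - 1`, indexed so that a contraction sends form
    -- degree `p` into it without subtraction in `ℕ`.
    rwa [show (-1 + ((p₁ + p₂ + 1 : ℕ) : ℤ)) = p₁ + p₂ by push_cast; ring]
  | zero => exact ⟨by simp, by simp⟩
  | add x y _ _ h1 h2 =>
    exact ⟨by rw [map_add, h1.1, h2.1, smul_add], by rw [map_add, h1.2, h2.2, smul_add]⟩
  | smul c x _ h1 =>
    exact ⟨by rw [map_smul, h1.1, smul_comm], by rw [map_smul, h1.2, smul_comm]⟩

theorem contraction_isDD {d : ℤ} (Θ : DoubleDer f 𝒜 d) :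
    IsDD (formSign f) (weightSign hf 1) (-1) d (contraction hf Θ) where
  leibniz α β := by rw [contraction_mul, passSign_eq]
  par₁ α := by
    induction α using homog_induction (𝒜 := 𝒜) with
    | hadd x y hx hy => simp only [map_add, smul_add, hx, hy]
    | h p w x hx =>
      have := (isPar₂_of_mem hf (contraction_mem hf Θ hx)).1
      rw [this, formSign_of_mem f 𝒜 hx, map_smul, smul_smul, sgn_add]
  par₂ α := by
    induction α using homog_induction (𝒜 := 𝒜) with
    | hadd x y hx hy => simp only [map_add, smul_add, hx, hy]
    | h p w x hx =>
      have h2 : weightSign hf 1 x = sgn k w • x := by simpa using weightSign_of_mem hf 1 hx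
      have := (isPar₂_of_mem hf (contraction_mem hf Θ hx)).2
      rw [this, h2, map_smul, smul_smul, ← sgn_add, add_comm]

theorem d_isDer : IsDer (formSign f) (weightSign hf 1) 1 0 (d f) where
  leibniz α β := by
    rw [d_mul, show passBy (formSign f) (weightSign hf 1) 1 0 = _ from pass_one_zero hf]
  par₁ α := by
    induction α using homog_induction (𝒜 := 𝒜) with
    | hadd x y hx hy => simp only [map_add, smul_add, hx, hy]
    | h p w x hx =>
      rw [formSign_of_mem f 𝒜 (d_mem_homog f 𝒜 hx), formSign_of_mem f 𝒜 hx, map_smul, smul_smul,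
        ← sgn_add]
      congr 2
      push_cast; ring
  par₂ α := by
    induction α using homog_induction (𝒜 := 𝒜) with
    | hadd x y hx hy => simp only [map_add, smul_add, hx, hy]
    | h p w x hx =>
      rw [weightSign_of_mem hf 1 (d_mem_homog f 𝒜 hx), weightSign_of_mem hf 1 hx, map_smul,
        sgn_zero, one_smul]

/-- The double Lie derivative `L_Θ = d i_Θ + i_Θ d : Ω → Ω ⊗ Ω`. -/
def lieDer {d : ℤ} (Θ : DoubleDer f 𝒜 d) : Forms f →ₗ[k] Forms f ⊗[k] Forms f :=
  derBracket (formSign f) (weightSign hf 1) 1 0 (-1) d (Forms.d f) (contraction hf Θ)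

theorem lieDer_isDD {d : ℤ} (Θ : DoubleDer f 𝒜 d) :
    IsDD (formSign f) (weightSign hf 1) 0 d (lieDer hf Θ) := by
  have := derBracket_isDD (isSignPair hf) (d_isDer hf) (contraction_isDD hf Θ)
  rwa [zero_add] at this

theorem lieDer_apply {d : ℤ} (Θ : DoubleDer f 𝒜 d) (α : Forms f) :
    lieDer hf Θ α = derTensor (formSign f) (Forms.d f) (contraction hf Θ α) +
      contraction hf Θ (Forms.d f α) := by
  -- Both `d` and the contraction have odd form degree, so their graded commutator is the sum in
  -- Cartan's formula.
  have : sgn k (1 * -1 + 0 * d) = -1 := sgn_of_not_even (by simp)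
  rw [lieDer, derBracket, this,
    show passBy (formSign f) (weightSign hf 1) 1 0 = _ from pass_one_zero hf]
  simp

/-- The inclusion `A ⊗ A → Ω ⊗ Ω`. -/
abbrev ofTensor (f : R →ₐ[k] A) : A ⊗[k] A →ₗ[k] Forms f ⊗[k] Forms f :=
  TensorProduct.map (of f).toLinearMap (of f).toLinearMap

theorem lieDer_of {d : ℤ} (Θ : DoubleDer f 𝒜 d) (a : A) :
    lieDer hf Θ (of f a) = ofTensor f (Θ.toLin a) := by
  rw [lieDer_apply, contraction_of, map_zero, zero_add, d_of, contraction_δ]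

theorem lieDer_δ {d : ℤ} (Θ : DoubleDer f 𝒜 d) (a : A) :
    lieDer hf Θ (δ f a) = derTensor (formSign f) (Forms.d f) (ofTensor f (Θ.toLin a)) := by
  rw [lieDer_apply, contraction_δ, d_δ, map_zero, add_zero]

theorem circ_eq : circ hf = opMul (formSign f) (weightSign hf 1) := rfl

/-- The projection of forms onto functions. -/
def toFun (f : R →ₐ[k] A) : Forms f →ₐ[k] A :=
  lift f (AlgHom.id k A) 0 (by simp) (by simp)

theorem toFun_of (a : A) : toFun f (of f a) = a := lift_of _ _ _ _ _ _

theorem toFun_δ (a : A) : toFun f (δ f a) = 0 := lift_δ _ _ _ _ _ _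

/-- Killing all differentials retracts forms onto functions. -/
theorem ofTensor_injective : Function.Injective (ofTensor f) := by
  have h : TensorProduct.map (toFun f).toLinearMap (toFun f).toLinearMap ∘ₗ ofTensor f =
      LinearMap.id := by
    ext x y
    simp [toFun_of]
  exact Function.LeftInverse.injective (LinearMap.congr_fun h)

/-- A double derivation of forms vanishing on functions comes from a double derivation of `A`. -/
theorem exists_doubleDer {d : ℤ} (Ψ : A →ₗ[k] A ⊗[k] A) (Z : Forms f →ₗ[k] Forms f ⊗[k] Forms f)
    (hZ : ∀ α β, Z (α * β) = Z α * (1 ⊗ₜ β) + (pass hf (-1) d α ⊗ₜ 1) * Z β)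
    (ho : ∀ a, Z (of f a) = 0) (hδ : ∀ a, Z (δ f a) = ofTensor f (Ψ a))
    (hw : ∀ (n : ℕ), ∀ a ∈ 𝒜 n, Ψ a ∈ tensorPart 𝒜 (n + d)) :
    ∃ Θ : DoubleDer f 𝒜 d, Θ.toLin = Ψ ∧ contraction hf Θ = Z := by
  have hmul : ∀ s t : A ⊗[k] A, ofTensor f (s * t) = ofTensor f s * ofTensor f t :=
    fun s t => map_mul (Algebra.TensorProduct.map (of f) (of f)) s t
  obtain ⟨Θ, hΘ⟩ : ∃ Θ : DoubleDer f 𝒜 d, Θ.toLin = Ψ := by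
    refine ⟨⟨Ψ, hw, fun n a ha b => ?_, fun r => ?_⟩, rfl⟩
    · apply ofTensor_injective (f := f)
      -- The Leibniz rule for `Ψ` is read off from `Z(d(ab))`, with `d(ab) = (da)b + a(db)` and `Z`
      -- vanishing on functions.
      have h := hZ (δ f a) (of f b)
      have h' := hZ (of f a) (δ f b)
      rw [ho, mul_zero, add_zero] at h
      rw [ho, zero_mul, zero_add, pass_of, NCCourant.weightSign_of_mem 𝒜 d ha, map_smul,
        ← TensorProduct.smul_tmul', smul_mul_assoc] at h'
      rw [← hδ, δ_mul, map_add, h, h', map_add, map_smul, hmul, hmul, hδ, hδ]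
      simp
    · apply ofTensor_injective (f := f)
      rw [← hδ, δ_base]
      exact (map_zero Z).trans (map_zero (ofTensor f)).symm
  refine ⟨Θ, hΘ, LinearMap.ext fun x => ?_⟩
  induction x using Forms.induction with
  | ho a => rw [contraction_of, ho]
  | hδ a => rw [contraction_δ, hδ, hΘ]
  | hadd x y hx hy => rw [map_add, map_add, hx, hy]
  | hmul x y hx hy => rw [contraction_mul, hZ, passSign_eq, hx, hy]

end Forms

end FormsCalculus

/-! ### Skew-symmetry, and the action of Hamiltonian derivations on double brackets -/

section HamiltonianCalculus

variable {k : Type*} [Field k] [CharZero k]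
variable {R : Type*} [Ring R] [Algebra k R]
variable {A : Type*} [Ring A] [Algebra k A]
variable {f : R →ₐ[k] A} {𝒜 : ℕ → Submodule k A} [GradedAlgebra 𝒜] (hf : ∀ r, f r ∈ 𝒜 0)

variable (𝒜) in
/-- The graded flip `x ⊗ y ↦ (-1)^{|x||y|} y ⊗ x` of `A ⊗ A`. -/
def gradedFlip : A ⊗[k] A →ₗ[k] A ⊗[k] A :=
  (TensorProduct.comm k A A).toLinearMap ∘ₗ
    signTwist (weightSign 𝒜 1).toLinearMap (weightSign 𝒜 1).toLinearMap

theorem gradedFlip_tmul {m n : ℕ} {x y : A} (hx : x ∈ 𝒜 m) (hy : y ∈ 𝒜 n) :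
    gradedFlip 𝒜 (x ⊗ₜ y) = sgn k (m * n) • (y ⊗ₜ x) := by
  rw [gradedFlip, LinearMap.comp_apply, signTwist_tmul (m := m) (n := n)
    (by simpa using weightSign_of_mem 𝒜 1 hx) (by simpa using weightSign_of_mem 𝒜 1 hy), map_smul]
  rfl

theorem graded_tensor_induction {p : A ⊗[k] A → Prop} (h0 : p 0)
    (hadd : ∀ x y, p x → p y → p (x + y))
    (h : ∀ (m n : ℕ), ∀ x ∈ 𝒜 m, ∀ y ∈ 𝒜 n, p (x ⊗ₜ y)) (t : A ⊗[k] A) : p t := by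
  induction t with
  | zero => exact h0
  | add x y hx hy => exact hadd x y hx hy
  | tmul x y =>
    induction x using DirectSum.Decomposition.inductionOn 𝒜 with
    | zero => rwa [TensorProduct.zero_tmul]
    | add x x' h1 h2 => rw [TensorProduct.add_tmul]; exact hadd _ _ h1 h2
    | @homogeneous m x =>
      induction y using DirectSum.Decomposition.inductionOn 𝒜 with
      | zero => rwa [TensorProduct.tmul_zero]
      | add y y' h1 h2 => rw [TensorProduct.tmul_add]; exact hadd _ _ h1 h2
      | @homogeneous n y => exact h m n x x.2 y y.2

namespace Forms

theorem of_mem_homog {n : ℕ} {a : A} (ha : a ∈ 𝒜 n) : of f a ∈ homog f 𝒜 0 n :=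
  Submodule.subset_span (.of ha)

theorem flip₂_ofTensor (t : A ⊗[k] A) :
    flip₂ (formSign f) (weightSign hf 1) (ofTensor f t) = ofTensor f (gradedFlip 𝒜 t) := by
  induction t using graded_tensor_induction (𝒜 := 𝒜) with
  | h0 => simp
  | hadd x y hx hy => simp only [map_add, hx, hy]
  | h m n x hx y hy =>
    rw [gradedFlip_tmul hx hy, ofTensor, TensorProduct.map_tmul, AlgHom.toLinearMap_apply,
      AlgHom.toLinearMap_apply, signFlip_tmul (isPar_of_mem hf (of_mem_homog hx))
        (isPar_of_mem hf (of_mem_homog hy)), map_smul]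
    simp

theorem actFirst_contraction_ofTensor {d : ℤ} (Θ : DoubleDer f 𝒜 d) (t : A ⊗[k] A) :
    actFirst (contraction hf Θ) (ofTensor f t) = 0 := by
  induction t with
  | zero => simp
  | add x y hx hy => rw [map_add, map_add, hx, hy, add_zero]
  | tmul x y => simp [actFirst, contraction_of]

theorem actSecond_contraction_ofTensor {d : ℤ} (c : Forms f →ₐ[k] Forms f) (Θ : DoubleDer f 𝒜 d)
    (t : A ⊗[k] A) : actSecond c (contraction hf Θ) (ofTensor f t) = 0 := by
  induction t with
  | zero => simp
  | add x y hx hy => rw [map_add, map_add, hx, hy, add_zero]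
  | tmul x y => simp [actSecond, contraction_of]

/-- Contractions commute in the graded sense. -/
theorem tripleBracket_contraction {d e : ℤ} (Θ : DoubleDer f 𝒜 d) (Δ : DoubleDer f 𝒜 e)
    (α : Forms f) : tripleBracket (formSign f) (weightSign hf 1) (-1) d (-1) e
      (contraction hf Θ) (contraction hf Δ) α = 0 := by
  -- The bracket is a triple derivation, so generators suffice. On `da` a contraction gives a tensor
  -- of functions, which the other contraction kills.
  induction α using Forms.induction with
  | ho a => simp [tripleBracket, contraction_of]
  | hδ a =>
    simp [tripleBracket, contraction_δ, actFirst_contraction_ofTensor,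
      actSecond_contraction_ofTensor]
  | hadd x y hx hy => rw [map_add, hx, hy, add_zero]
  | hmul x y hx hy =>
    rw [tripleBracket_mul (isSignPair hf) (contraction_isDD hf Θ) (contraction_isDD hf Δ), hx, hy,
      zero_mul, mul_zero, add_zero]

variable {w : Forms f}

/-- Skew-symmetry of the double bracket of a 2-form. -/
theorem skew {d e : ℤ} {Θ : DoubleDer f 𝒜 d} {Δ : DoubleDer f 𝒜 e} {a b : A}
    (hΘ : reducedContraction hf Θ w = δ f a) (hΔ : reducedContraction hf Δ w = δ f b) :
    Θ.toLin b = sgn k (1 + d * e) • gradedFlip 𝒜 (Δ.toLin a) := by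
  -- With vanishing triple brackets, the identity says that `i_Θ(ι_Δ w) = i_Θ(db) = Θ(b)` is up to
  -- sign the flip of `i_Δ(ι_Θ w) = Δ(a)`.
  have h := opMul_bracket (isSignPair hf) (contraction_isDD hf Θ) (contraction_isDD hf Δ) w
  rw [tripleBracket_contraction, tripleBracket_contraction, map_zero, map_zero, smul_zero,
    sub_zero, sub_eq_zero] at h
  have h1 : opMul (formSign f) (weightSign hf 1) (contraction hf Δ w) = δ f b := hΔ
  have h2 : opMul (formSign f) (weightSign hf 1) (contraction hf Θ w) = δ f a := hΘ
  rw [h1, h2, contraction_δ, contraction_δ, flip₂_ofTensor, ← map_smul] at h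
  have := ofTensor_injective h
  rwa [show (-1 * -1 + d * e : ℤ) = 1 + d * e by ring] at this

/-- Cartan's formula: the reduced Lie derivative of `w` is `d(ι_Θ w) + ι_Θ(dw)`. The first term is
`d(da) = 0`, and in the second `dw` is a sum of commutators, which reduced contractions kill. This
says that Hamiltonian double derivations preserve the form. -/
theorem opMul_lieDer (hw : Forms.d f w ∈ commutators f 𝒜) {d : ℤ} {Θ : DoubleDer f 𝒜 d} {a : A}
    (hΘ : reducedContraction hf Θ w = δ f a) :
    opMul (formSign f) (weightSign hf 1) (lieDer hf Θ w) = 0 := by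
  have h1 : opMul (formSign f) (weightSign hf 1) (contraction hf Θ w) = δ f a := hΘ
  have h2 := LinearMap.congr_fun ((d_isDer hf).comp_opMul (isSignPair hf)) (contraction hf Θ w)
  rw [show passBy (formSign f) (weightSign hf 1) 1 0 = _ from pass_one_zero hf,
    LinearMap.comp_apply, LinearMap.comp_apply, h1, d_δ] at h2
  have h3 : opMul (formSign f) (weightSign hf 1) (contraction hf Θ (Forms.d f w)) = 0 :=
    reducedContraction_commutators hf Θ hw
  rw [lieDer_apply, map_add, ← h2, h3, add_zero]

/-- On homogeneous tensors the difference `x y ∓ y x` is a graded commutator. Reduced statements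
about `°` thus become statements about the multiplication modulo commutators. -/
theorem mul'_sub_opMul_mem (t : Forms f ⊗[k] Forms f) :
    LinearMap.mul' k _ t - opMul (formSign f) (weightSign hf 1) t ∈ commutators f 𝒜 := by
  induction t with
  | zero => simp
  | add x y hx hy => rw [map_add, map_add, add_sub_add_comm]; exact add_mem hx hy
  | tmul x y =>
    induction x using homog_induction (𝒜 := 𝒜) with
    | hadd x x' h1 h2 =>
      rw [TensorProduct.add_tmul, map_add, map_add, add_sub_add_comm]; exact add_mem h1 h2
    | h p v x hx =>
      induction y using homog_induction (𝒜 := 𝒜) with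
      | hadd x x' h1 h2 =>
        rw [TensorProduct.tmul_add, map_add, map_add, add_sub_add_comm]; exact add_mem h1 h2
      | h q u y hy =>
        rw [opMul_tmul (isPar_of_mem hf hx) (isPar_of_mem hf hy), LinearMap.mul'_apply, add_comm]
        exact Submodule.subset_span ⟨p, q, v, u, x, hx, y, hy, rfl⟩

end Forms

theorem tensorPart_induction {m : ℤ} {V : Type*} [AddCommGroup V] [Module k V]
    (F : A ⊗[k] A →ₗ[k] V) (W : Submodule k V)
    (h : ∀ (i j : ℕ), (i + j : ℤ) = m → ∀ x ∈ 𝒜 i, ∀ y ∈ 𝒜 j, F (x ⊗ₜ y) ∈ W)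
    {t : A ⊗[k] A} (ht : t ∈ tensorPart 𝒜 m) : F t ∈ W := by
  have hle : tensorPart 𝒜 m ≤ W.comap F := by
    refine Submodule.span_le.2 ?_
    rintro _ ⟨i, j, x, y, hx, hy, hij, rfl⟩
    exact h i j hij x hx y hy
  exact hle ht

theorem tmul_mem_tensorPart {i j : ℕ} {m : ℤ} {x y : A} (hx : x ∈ 𝒜 i) (hy : y ∈ 𝒜 j)
    (h : (i + j : ℤ) = m) : x ⊗ₜ y ∈ tensorPart 𝒜 m :=
  Submodule.subset_span ⟨i, j, x, y, hx, hy, h, rfl⟩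

/-- The weight `m` part of `A`, for an integer `m`. -/
def intPart (𝒜 : ℕ → Submodule k A) (m : ℤ) : Submodule k A := ⨆ i : {i : ℕ // (i : ℤ) = m}, 𝒜 i

theorem mem_intPart {i : ℕ} {m : ℤ} (h : (i : ℤ) = m) {x : A} (hx : x ∈ 𝒜 i) : x ∈ intPart 𝒜 m :=
  le_iSup (fun i : {i : ℕ // (i : ℤ) = m} => 𝒜 i) ⟨i, h⟩ hx

theorem intPart_natCast (n : ℕ) : intPart 𝒜 n = 𝒜 n := by
  refine le_antisymm (iSup_le ?_) fun x hx => mem_intPart rfl hx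
  rintro ⟨i, hi⟩
  have : i = n := by exact_mod_cast hi
  subst this
  exact le_rfl

theorem tmul_mem_tensorPart' {i j m : ℤ} {x y : A} (hx : x ∈ intPart 𝒜 i)
    (hy : y ∈ intPart 𝒜 j) (h : i + j = m) : x ⊗ₜ y ∈ tensorPart 𝒜 m := by
  have h1 : ∀ x ∈ intPart 𝒜 i, ∀ j' : ℕ, (j' : ℤ) = j → ∀ y ∈ 𝒜 j', x ⊗ₜ y ∈ tensorPart 𝒜 m := by
    intro x hx j' hj y hy
    refine (iSup_le ?_ : intPart 𝒜 i ≤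
      (tensorPart 𝒜 m).comap ((TensorProduct.mk k A A).flip y)) hx
    rintro ⟨i', hi⟩ x hx
    exact tmul_mem_tensorPart (i := i') (j := j') hx hy (by omega)
  refine (iSup_le ?_ : intPart 𝒜 j ≤ (tensorPart 𝒜 m).comap (TensorProduct.mk k A A x)) hy
  rintro ⟨j', hj⟩ y hy
  exact h1 x hx j' hj y hy

theorem mul'_mem_intPart {m : ℤ} {t : A ⊗[k] A} (ht : t ∈ tensorPart 𝒜 m) :
    LinearMap.mul' k A t ∈ intPart 𝒜 m :=
  tensorPart_induction _ _ (fun i j hij x hx y hy => by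
    rw [LinearMap.mul'_apply]
    exact mem_intPart (by push_cast; exact hij) (SetLike.mul_mem_graded hx hy)) ht

theorem DoubleDer.map_intPart {d : ℤ} (Θ : DoubleDer f 𝒜 d) {m : ℤ} {x : A}
    (hx : x ∈ intPart 𝒜 m) : Θ.toLin x ∈ tensorPart 𝒜 (m + d) := by
  refine (iSup_le ?_ : intPart 𝒜 m ≤ (tensorPart 𝒜 (m + d)).comap Θ.toLin) hx
  rintro ⟨i, rfl⟩ x hx
  exact Θ.map_weight i x hx

theorem weightSign_mem (d : ℤ) {n : ℕ} {x : A} (hx : x ∈ 𝒜 n) : weightSign 𝒜 d x ∈ 𝒜 n := by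
  rw [weightSign_of_mem 𝒜 d hx]
  exact Submodule.smul_mem _ _ hx

variable {w : Forms f}

/-- The derivation `{a, -} = m ∘ H_a`. -/
def DoubleDer.toDer {d : ℤ} (Θ : DoubleDer f 𝒜 d) : A →ₗ[k] A := LinearMap.mul' k A ∘ₗ Θ.toLin

/-- The Hamiltonian derivation `{s, -}` acts on Hamiltonian double derivations. -/
theorem exists_hamiltonian_bracket (hw : Forms.d f w ∈ Forms.commutators f 𝒜) {d e : ℤ}
    {D : DoubleDer f 𝒜 d} {H : DoubleDer f 𝒜 e} {s b : A}
    (hD : Forms.reducedContraction hf D w = Forms.δ f s)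
    (hH : Forms.reducedContraction hf H w = Forms.δ f b) :
    ∃ Ψ : DoubleDer f 𝒜 (d + e),
      (∀ a, Ψ.toLin a = derTensor (weightSign 𝒜 d) D.toDer (H.toLin a) -
        sgn k (d * e) • H.toLin (D.toDer a)) ∧
      Forms.reducedContraction hf Ψ w = Forms.δ f (D.toDer b) := by
  -- The composite `m ∘ L_D` is a derivation of forms which extends `{s, -}` on functions and is
  -- compatible with `d` on them. Its commutator with `i_H` is the contraction with the required
  -- `Ψ`.
  have hder : IsDer (Forms.formSign f) (Forms.weightSign hf 1) 0 d
    (LinearMap.mul' k _ ∘ₗ Forms.lieDer hf D) := (Forms.lieDer_isDD hf D).mul'_isDer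
  have hmul : ∀ t : A ⊗[k] A, LinearMap.mul' k _ (Forms.ofTensor f t) =
      Forms.of f (LinearMap.mul' k A t) := by
    intro t
    induction t with
    | zero => simp
    | add x y hx hy => simp only [map_add, hx, hy]
    | tmul x y => simp
  have hof : ∀ a, (LinearMap.mul' k _ ∘ₗ Forms.lieDer hf D) (Forms.of f a) =
      Forms.of f (D.toDer a) := by
    intro a
    rw [LinearMap.comp_apply, Forms.lieDer_of, hmul]; rfl
  have hδ : ∀ a, (LinearMap.mul' k _ ∘ₗ Forms.lieDer hf D) (Forms.δ f a) =
      Forms.δ f (D.toDer a) := by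
    intro a
    have : ∀ t : Forms f ⊗[k] Forms f,
        LinearMap.mul' k _ (derTensor (Forms.formSign f) (Forms.d f) t) =
        Forms.d f (LinearMap.mul' k _ t) := by
      intro t
      induction t with
      | zero => simp
      | add x y hx hy => simp only [map_add, hx, hy]
      | tmul x y => simp [derTensor_tmul, Forms.d_mul]
    rw [LinearMap.comp_apply, Forms.lieDer_δ, this, hmul, Forms.d_of]; rfl
  have he : (0 * -1 + d * e : ℤ) = d * e := by ring
  obtain ⟨Ψ, h1, h2⟩ := Forms.exists_doubleDer hf (d := d + e)
    (derTensor (weightSign 𝒜 d) D.toDer ∘ₗ H.toLin - sgn k (d * e) • (H.toLin ∘ₗ D.toDer))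
    (derBracket (Forms.formSign f) (Forms.weightSign hf 1) 0 d (-1) e
      (LinearMap.mul' k _ ∘ₗ Forms.lieDer hf D) (Forms.contraction hf H))
    (fun α β => by
      rw [derBracket_mul (Forms.isSignPair hf) hder (Forms.contraction_isDD hf H),
        passBy_passBy (Forms.isSignPair hf)]
      simp only [zero_add])
    (fun a => by
      rw [derBracket, LinearMap.sub_apply, LinearMap.comp_apply, LinearMap.smul_apply,
        LinearMap.comp_apply, hof, Forms.contraction_of, Forms.contraction_of]
      simp)
    (fun a => by
      have h3 : ∀ t : A ⊗[k] A,
          derTensor (passBy (Forms.formSign f) (Forms.weightSign hf 1) 0 d)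
            (LinearMap.mul' k _ ∘ₗ Forms.lieDer hf D) (Forms.ofTensor f t) =
          Forms.ofTensor f (derTensor (weightSign 𝒜 d) D.toDer t) := by
        intro t
        induction t with
        | zero => simp
        | add x y hx hy => simp only [map_add, hx, hy]
        | tmul x y =>
          simp only [Forms.ofTensor, TensorProduct.map_tmul, AlgHom.toLinearMap_apply,
            derTensor_tmul, hof, map_add]
          rw [Forms.pass_of hf]
      rw [derBracket, LinearMap.sub_apply, LinearMap.comp_apply, LinearMap.smul_apply,
        LinearMap.comp_apply, hδ, Forms.contraction_δ, Forms.contraction_δ, h3, he]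
      simp only [LinearMap.sub_apply, LinearMap.comp_apply, LinearMap.smul_apply, map_sub, map_smul])
    (fun n a ha => by
      rw [LinearMap.sub_apply, LinearMap.comp_apply, LinearMap.smul_apply, LinearMap.comp_apply]
      refine sub_mem ?_ (Submodule.smul_mem _ _ ?_)
      · refine tensorPart_induction _ _ (fun i j hij x hx y hy => ?_) (H.map_weight n a ha)
        rw [derTensor_tmul]
        refine add_mem ?_ ?_
        · exact tmul_mem_tensorPart' (mul'_mem_intPart (D.map_weight i x hx)) (mem_intPart rfl hy)
            (by linarith)
        · exact tmul_mem_tensorPart' (mem_intPart rfl (weightSign_mem d hx))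
            (mul'_mem_intPart (D.map_weight j y hy)) (by linarith)
      · have := H.map_intPart (mul'_mem_intPart (D.map_weight n a ha))
        rwa [add_assoc] at this)
  refine ⟨Ψ, fun a => by rw [h1]; rfl, ?_⟩
  -- Since `°(L_D w) = 0`, the derivation `m ∘ L_D` sends `w` into the commutators, which `ι_H`
  -- kills. Only one half of the commutator contributes to `ι_Ψ w`.
  have h4 := Forms.mul'_sub_opMul_mem hf (Forms.lieDer hf D w)
  rw [Forms.opMul_lieDer hf hw hD, sub_zero] at h4
  -- The surviving half is the derivation applied to `ι_H w = db`, which gives `d{s, b}`.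
  have h5 := LinearMap.congr_fun (hder.comp_opMul (Forms.isSignPair hf)) (Forms.contraction hf H w)
  have h6 : opMul (Forms.formSign f) (Forms.weightSign hf 1) (Forms.contraction hf H w) =
    Forms.δ f b := hH
  have h7 : opMul (Forms.formSign f) (Forms.weightSign hf 1) (Forms.contraction hf H
    ((LinearMap.mul' k _ ∘ₗ Forms.lieDer hf D) w)) = 0 :=
      Forms.reducedContraction_commutators hf H h4
  rw [LinearMap.comp_apply, h6, hδ, LinearMap.comp_apply] at h5
  rw [Forms.reducedContraction, LinearMap.comp_apply, h2, Forms.circ_eq, derBracket,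
    LinearMap.sub_apply, map_sub, LinearMap.comp_apply, ← h5, LinearMap.smul_apply, map_smul,
    LinearMap.comp_apply, h7, smul_zero, sub_zero]

end HamiltonianCalculus

/-! ### The double Jacobi identity, tested on the middle tensor factor -/

section HamiltonianCalculus

variable {k : Type*} [Field k] [CharZero k]
variable {R : Type*} [Ring R] [Algebra k R]
variable {A : Type*} [Ring A] [Algebra k A]
variable {f : R →ₐ[k] A} {𝒜 : ℕ → Submodule k A} [GradedAlgebra 𝒜] (hf : ∀ r, f r ∈ 𝒜 0)

namespace Forms

/-- The inclusion `A ⊗ A ⊗ A → Ω ⊗ Ω ⊗ Ω`. -/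
abbrev ofTriple (f : R →ₐ[k] A) :
    A ⊗[k] (A ⊗[k] A) →ₗ[k] Forms f ⊗[k] (Forms f ⊗[k] Forms f) :=
  TensorProduct.map (of f).toLinearMap (ofTensor f)

theorem actFirst_lieDer_ofTensor {d : ℤ} (D : DoubleDer f 𝒜 d) (t : A ⊗[k] A) :
    actFirst (lieDer hf D) (ofTensor f t) = ofTriple f (actFirst D.toLin t) := by
  induction t with
  | zero => simp
  | add x y hx hy => simp only [map_add, hx, hy]
  | tmul x y =>
    simp only [actFirst, LinearMap.comp_apply, ofTensor, TensorProduct.map_tmul,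
      AlgHom.toLinearMap_apply, LinearMap.id_apply, lieDer_of]
    generalize D.toLin x = s
    induction s with
    | zero => simp
    | add s s' h h' => simp only [map_add, TensorProduct.add_tmul, h, h']
    | tmul u v => simp

/-- Of `dx ⊗ y + x ⊗ dy` only the second summand survives, because contractions kill functions. With
`lieDer_δ` this computes `(1 ⊗ i_H) L_D` on exact 1-forms. -/
theorem actSecond_derTensor_ofTensor {e : ℤ} (H : DoubleDer f 𝒜 e) (t : A ⊗[k] A) :
    actSecond (passBy (formSign f) (weightSign hf 1) (-1) e) (contraction hf H)
      (derTensor (formSign f) (Forms.d f) (ofTensor f t)) =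
      ofTriple f (actSecond (NCCourant.weightSign 𝒜 e) H.toLin t) := by
  induction t with
  | zero => simp
  | add x y hx hy => simp only [map_add, hx, hy]
  | tmul x y =>
    simp only [actSecond, ofTensor, TensorProduct.map_tmul, AlgHom.toLinearMap_apply,
      derTensor_tmul, map_add, d_of, formSign_of, contraction_of, contraction_δ,
      TensorProduct.tmul_zero, zero_add, ofTriple]
    rw [pass_of hf]

section Projection

variable {C : Type*} [Ring C] [Algebra k C] (π : A →ₐ[k] C)

variable (f) in
/-- The extension of `π` to forms by zero in positive form degree. -/
abbrev extendZero : Forms f →ₐ[k] C := π.comp (toFun f)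

theorem extendZero_formSign (x : Forms f) : extendZero f π (formSign f x) = extendZero f π x := by
  have : (extendZero f π).comp (formSign f) = extendZero f π :=
    algHom_ext (fun a => by simp [formSign_of]) (fun a => by simp [formSign_δ, toFun_δ])
  exact DFunLike.congr_fun this x

variable {π}

/-- The map `π` sees only weight 0, where the weight sign is trivial. -/
theorem map_weightSign_of_vanishing (hπ : ∀ n : ℕ, 0 < n → ∀ a ∈ 𝒜 n, π a = 0)
    (d : ℤ) (a : A) : π (NCCourant.weightSign 𝒜 d a) = π a := by
  induction a using DirectSum.Decomposition.inductionOn 𝒜 with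
  | zero => simp
  | add x y hx hy => rw [map_add, map_add, map_add, hx, hy]
  | @homogeneous n a =>
    rw [NCCourant.weightSign_of_mem 𝒜 d a.2, map_smul]
    rcases Nat.eq_zero_or_pos n with rfl | hn
    · simp [sgn_zero]
    · rw [hπ n hn a a.2, smul_zero]

theorem extendZero_weightSign (hπ : ∀ n : ℕ, 0 < n → ∀ a ∈ 𝒜 n, π a = 0)
    (d : ℤ) (x : Forms f) :
    extendZero f π (weightSign hf d x) = extendZero f π x := by
  have : (extendZero f π).comp (weightSign hf d) = extendZero f π :=
    algHom_ext (fun a => by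
      simp [weightSign_of, toFun_of, map_weightSign_of_vanishing hπ])
      (fun a => by simp [weightSign_δ, toFun_δ])
  exact DFunLike.congr_fun this x

theorem extendZero_passBy (hπ : ∀ n : ℕ, 0 < n → ∀ a ∈ 𝒜 n, π a = 0)
    (p d : ℤ) (x : Forms f) :
    extendZero f π (passBy (formSign f) (weightSign hf 1) p d x) = extendZero f π x := by
  unfold passBy signPow
  rw [AlgHom.comp_apply]
  split_ifs
  · rfl
  · exact extendZero_weightSign hf hπ 1 x
  · exact extendZero_formSign π x
  · exact (extendZero_formSign π _).trans (extendZero_weightSign hf hπ 1 x)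

/-- The triple bracket vanishes on functions. In its Leibniz rule the factor not differentiated
stays in an outer tensor slot. For a product of two 1-forms some outer slot then contains a 1-form,
which the projection kills. Only a single 1-form could contribute. -/
theorem map_extendZero_tripleBracket (hπ : ∀ n : ℕ, 0 < n → ∀ a ∈ 𝒜 n, π a = 0)
    {d e : ℤ} (D : DoubleDer f 𝒜 d) (H : DoubleDer f 𝒜 e)
    {p : ℕ} {v : ℤ} {α : Forms f} (hα : α ∈ homog f 𝒜 p v) (hp : p ≠ 1) :
    TensorProduct.map (extendZero f π).toLinearMap
      (TensorProduct.map LinearMap.id (extendZero f π).toLinearMap)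
      (tripleBracket (formSign f) (weightSign hf 1) (-1) e 0 d (contraction hf H)
        (lieDer hf D) α) = 0 := by
  let K : Forms f ⊗[k] (Forms f ⊗[k] Forms f) →ₐ[k] C ⊗[k] (Forms f ⊗[k] C) :=
    Algebra.TensorProduct.map (extendZero f π)
      (Algebra.TensorProduct.map (AlgHom.id k _) (extendZero f π))
  let T := tripleBracket (formSign f) (weightSign hf 1) (-1) e 0 d (contraction hf H)
        (lieDer hf D)
  have hle : homog f 𝒜 p v ≤ LinearMap.ker (K.toLinearMap ∘ₗ T) := by
    refine Submodule.span_le.2 fun α hα => ?_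
    change K (T α) = 0
    -- The induction over products must also carry the vanishing of the projection in positive form
    -- degree, to treat a 1-form multiplied by a form of positive degree.
    have key : (p ≠ 1 → K (T α) = 0) ∧ (p ≠ 0 → extendZero f π α = 0) := by
      clear hp
      rename_i hα'
      clear hα'
      induction hα with
      | @of n a ha =>
        refine ⟨fun _ => ?_, fun h => (h rfl).elim⟩
        have : T (of f a) = 0 := by
          simp only [T, tripleBracket, LinearMap.sub_apply, LinearMap.comp_apply,
            LinearMap.smul_apply, lieDer_of, contraction_of, map_zero, smul_zero, sub_zero,
            actFirst_contraction_ofTensor]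
        rw [this, map_zero]
      | δ ha => exact ⟨fun h => (h rfl).elim, fun _ => by simp [toFun_δ]⟩
      | @mul p q v w α β hα hβ h1 h2 =>
        have hT : K (T (α * β)) = K (T α) * (1 ⊗ₜ (1 ⊗ₜ extendZero f π β)) +
            (extendZero f π α ⊗ₜ 1) * K (T β) := by
          simp only [T]
          rw [tripleBracket_mul (isSignPair hf) (contraction_isDD hf H) (lieDer_isDD hf D), map_add,
            map_mul, map_mul]
          simp only [K, Algebra.TensorProduct.map_tmul, map_one, AlgHom.id_apply,
            extendZero_passBy hf hπ]
        refine ⟨fun hpq => ?_, fun hpq => ?_⟩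
        · rw [hT]
          have e1 : K (T α) * (1 ⊗ₜ (1 ⊗ₜ extendZero f π β)) = 0 := by
            by_cases hp : p = 1
            · rw [h2.2 (by omega)]; simp
            · rw [h1.1 hp, zero_mul]
          have e2 : (extendZero f π α ⊗ₜ 1) * K (T β) = 0 := by
            by_cases hq : q = 1
            · rw [h1.2 (by omega)]; simp
            · rw [h2.1 hq, mul_zero]
          rw [e1, e2, add_zero]
        · rw [map_mul]
          by_cases hp : p = 0
          · rw [h2.2 (by omega), mul_zero]
          · rw [h1.2 hp, zero_mul]
    exact key.1 hp
  exact hle hα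

end Projection

end Forms

variable {w : Forms f} {C : Type*} [Ring C] [Algebra k C] {π : A →ₐ[k] C}

/-- The double Jacobi identity, in the form obtained by evaluating a functional on the middle
tensor factor. -/
theorem exists_hamiltonian_midEval (hπ : ∀ n : ℕ, 0 < n → ∀ a ∈ 𝒜 n, π a = 0)
    (hw : Forms.d f w ∈ Forms.commutators f 𝒜) {N : ℤ} (hwN : w ∈ Forms.homog f 𝒜 2 N) {d e : ℤ}
    {D : DoubleDer f 𝒜 d} {H : DoubleDer f 𝒜 e} {s b : A}
    (hD : Forms.reducedContraction hf D w = Forms.δ f s)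
    (hH : Forms.reducedContraction hf H w = Forms.δ f b) (l : C →ₗ[k] k) :
    ∃ Ψ : DoubleDer f 𝒜 (d + e),
      (∀ a, Ψ.toLin a = midEval (l ∘ₗ π.toLinearMap) (actFirst D.toLin (H.toLin a)) -
        sgn k (d * e) • midEval (l ∘ₗ π.toLinearMap)
          (actSecond (weightSign 𝒜 e) H.toLin (D.toLin a))) ∧
      Forms.reducedContraction hf Ψ w =
        Forms.δ f (lastEval (l ∘ₗ π.toLinearMap) (D.toLin b)) := by
  have he : (0 * -1 + d * e : ℤ) = d * e := by ring
  let L := l ∘ₗ (Forms.extendZero f π).toLinearMap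
  have hL : ∀ t : A ⊗[k] (A ⊗[k] A), midEval L (Forms.ofTriple f t) =
      Forms.ofTensor f (midEval (l ∘ₗ π.toLinearMap) t) := by
    intro t
    induction t with
    | zero => simp
    | add x y hx hy => simp only [map_add, hx, hy]
    | tmul x s =>
      induction s with
      | zero => simp
      | add x y hx hy => simp only [TensorProduct.tmul_add, map_add, hx, hy]
      | tmul y z => simp [midEval_tmul, L, Forms.toFun_of]
  have hl : l (π 0) = 0 := by rw [map_zero, map_zero]
  -- Evaluating the middle factor turns the triple derivation into a double derivation of forms. It
  -- kills functions, so it is a contraction.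
  obtain ⟨Ψ, h1, h2⟩ := Forms.exists_doubleDer hf (d := d + e)
    (midEval (l ∘ₗ π.toLinearMap) ∘ₗ actFirst D.toLin ∘ₗ H.toLin -
      sgn k (d * e) • (midEval (l ∘ₗ π.toLinearMap) ∘ₗ
        actSecond (weightSign 𝒜 e) H.toLin ∘ₗ D.toLin))
    (midEval L ∘ₗ tripleBracket (Forms.formSign f) (Forms.weightSign hf 1) 0 d (-1) e
      (Forms.lieDer hf D) (Forms.contraction hf H))
    (fun α β => by
      rw [LinearMap.comp_apply, LinearMap.comp_apply, LinearMap.comp_apply,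
        tripleBracket_mul (Forms.isSignPair hf) (Forms.lieDer_isDD hf D)
          (Forms.contraction_isDD hf H), map_add, midEval_tmul_right, midEval_tmul_left,
        passBy_passBy (Forms.isSignPair hf)]
      simp only [zero_add])
    (fun a => by
      simp only [tripleBracket, LinearMap.sub_apply, LinearMap.comp_apply,
        LinearMap.smul_apply, Forms.lieDer_of, Forms.contraction_of, map_zero, smul_zero, sub_zero,
        Forms.actSecond_contraction_ofTensor])
    (fun a => by
      simp only [tripleBracket, LinearMap.sub_apply, LinearMap.comp_apply,
        LinearMap.smul_apply, Forms.lieDer_δ, Forms.contraction_δ, map_sub, map_smul,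
        Forms.actFirst_lieDer_ofTensor, Forms.actSecond_derTensor_ofTensor, hL, he])
    (fun n a ha => by
      simp only [LinearMap.sub_apply, LinearMap.comp_apply, LinearMap.smul_apply]
      refine sub_mem ?_ (Submodule.smul_mem _ _ ?_)
      · refine tensorPart_induction (midEval (l ∘ₗ π.toLinearMap) ∘ₗ actFirst D.toLin) _
          (fun i j hij x hx y hy => ?_) (H.map_weight n a ha)
        refine tensorPart_induction (midEval (l ∘ₗ π.toLinearMap) ∘ₗ
          (TensorProduct.assoc k A A A).toLinearMap ∘ₗ (TensorProduct.mk k _ _).flip y) _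
          (fun i' j' hij' x' hx' y' hy' => ?_) (D.map_weight i x hx)
        simp only [LinearMap.comp_apply, LinearMap.flip_apply, TensorProduct.mk_apply,
          LinearEquiv.coe_coe, TensorProduct.assoc_tmul, midEval_tmul]
        -- The functional kills positive weights, so evaluating the middle factor loses no weight
        -- and `Ψ` is homogeneous of weight `d + e`.
        rcases Nat.eq_zero_or_pos j' with rfl | hj
        · exact Submodule.smul_mem _ _ (tmul_mem_tensorPart hx' hy (by push_cast at *; linarith))
        · rw [AlgHom.toLinearMap_apply, hπ j' hj y' hy', map_zero, zero_smul]; exact zero_mem _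
      · refine tensorPart_induction (midEval (l ∘ₗ π.toLinearMap) ∘ₗ
          actSecond (weightSign 𝒜 e) H.toLin) _
          (fun i j hij x hx y hy => ?_) (D.map_weight n a ha)
        refine tensorPart_induction (midEval (l ∘ₗ π.toLinearMap) ∘ₗ
          (TensorProduct.mk k _ _ (weightSign 𝒜 e x))) _
          (fun i' j' hij' x' hx' y' hy' => ?_) (H.map_weight j y hy)
        simp only [LinearMap.comp_apply, TensorProduct.mk_apply, midEval_tmul]
        rcases Nat.eq_zero_or_pos i' with rfl | hj
        · exact Submodule.smul_mem _ _ (tmul_mem_tensorPart (weightSign_mem e hx) hy'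
            (by push_cast at *; linarith))
        · rw [AlgHom.toLinearMap_apply, hπ i' hj x' hx', map_zero, zero_smul]; exact zero_mem _)
  refine ⟨Ψ, fun a => by rw [h1]; rfl, ?_⟩
  -- At `w` the left side reduces to `L_D(db)`, because `°(L_D w) = 0`. Evaluating the last factor
  -- turns it into the differential of a function. On the right the `moveFirst` term dies and the
  -- `moveLast` term becomes `ι_Ψ w`.
  have h3 := opMul_bracket (Forms.isSignPair hf) (Forms.lieDer_isDD hf D)
    (Forms.contraction_isDD hf H) w
  have h6 : opMul (Forms.formSign f) (Forms.weightSign hf 1) (Forms.contraction hf H w) =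
    Forms.δ f b := hH
  rw [Forms.opMul_lieDer hf hw hD, h6, map_zero, map_zero, smul_zero, sub_zero,
    Forms.lieDer_δ] at h3
  have h4 := congrArg (lastEval L) h3
  rw [map_sub, map_smul, lastEval_moveFirst (Forms.isSignPair hf) (Forms.extendZero f π)
    (Forms.extendZero_formSign π) (Forms.extendZero_weightSign hf hπ 1) l _
    (Forms.map_extendZero_tripleBracket hf hπ D H hwN (by decide)), smul_zero, sub_zero,
    lastEval_moveLast (Forms.isSignPair hf) L
      (fun x => congrArg l (Forms.extendZero_formSign π x))
      (fun x => congrArg l (Forms.extendZero_weightSign hf hπ 1 x))] at h4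
  have h5 : ∀ t : A ⊗[k] A, lastEval L (derTensor (Forms.formSign f) (Forms.d f)
      (Forms.ofTensor f t)) = Forms.δ f (lastEval (l ∘ₗ π.toLinearMap) t) := by
    intro t
    induction t with
    | zero => simp
    | add x y hx hy => simp only [map_add, hx, hy]
    | tmul x y =>
      simp [derTensor_tmul, lastEval_tmul, L, Forms.d_of, Forms.toFun_δ, Forms.toFun_of]
  rw [Forms.reducedContraction, LinearMap.comp_apply, h2, Forms.circ_eq, LinearMap.comp_apply,
    ← h4, h5]

end HamiltonianCalculus

/-! ### Bimodule actions, twisted derivations and projections of `T_B M` -/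

section Bimodules

variable {k : Type*} [Field k] {B : Type*} [Ring B] [Algebra k B]
variable {M : Type*} [AddCommGroup M] [Module k M] [Module (Env k B) M]
  [IsScalarTower k (Env k B) M]

theorem Env.mk_mul_mk (a b c d : B) : Env.mk k a b * Env.mk k c d = Env.mk k (a * c) (d * b) :=
  Algebra.TensorProduct.tmul_mul_tmul _ _ _ _

theorem lact_add (b c : B) (m : M) : lact k (b + c) m = lact k b m + lact k c m :=
  map_add (lactOn m) b c

theorem ract_add (b c : B) (m : M) : ract k (b + c) m = ract k b m + ract k c m :=
  map_add (ractOn m) b c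

theorem lact_zero (m : M) : lact k (0 : B) m = 0 := map_zero (lactOn m)

theorem lact_smul (r : k) (b : B) (m : M) : lact k (r • b) m = r • lact k b m :=
  map_smul (lactOn m) r b

theorem ract_smul (r : k) (b : B) (m : M) : ract k (r • b) m = r • ract k b m :=
  map_smul (ractOn m) r b

theorem lact_lact (b c : B) (m : M) : lact k b (lact k c m) = lact k (b * c) m := by
  change Env.mk k b 1 • Env.mk k c 1 • m = Env.mk k (b * c) 1 • m
  rw [smul_smul, Env.mk_mul_mk, one_mul]

theorem ract_ract (b c : B) (m : M) : ract k b (ract k c m) = ract k (c * b) m := by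
  change Env.mk k 1 b • Env.mk k 1 c • m = Env.mk k 1 (c * b) • m
  rw [smul_smul, Env.mk_mul_mk, one_mul]

theorem lact_ract (b c : B) (m : M) : lact k b (ract k c m) = ract k c (lact k b m) := by
  change Env.mk k b 1 • Env.mk k 1 c • m = Env.mk k 1 c • Env.mk k b 1 • m
  rw [smul_smul, smul_smul, Env.mk_mul_mk, Env.mk_mul_mk]
  simp

theorem lact_one (m : M) : lact k (1 : B) m = m := one_smul (Env k B) m

theorem ract_one (m : M) : ract k (1 : B) m = m := one_smul (Env k B) m

theorem lact_prod {M' : Type*} [AddCommGroup M'] [Module k M'] [Module (Env k B) M']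
    [IsScalarTower k (Env k B) M'] (b : B) (m : M × M') :
    lact k b m = (lact k b m.1, lact k b m.2) := rfl

theorem ract_prod {M' : Type*} [AddCommGroup M'] [Module k M'] [Module (Env k B) M']
    [IsScalarTower k (Env k B) M'] (b : B) (m : M × M') :
    ract k b m = (ract k b m.1, ract k b m.2) := rfl

namespace TensorAlg

/-- A twisted derivation of `T_B M` vanishing on `B` is determined by a bimodule map on `M`. -/
theorem exists_twistedDer {T : Type*} [Ring T] [Algebra k T] (γ j : TensorAlg k B M →ₐ[k] T)
    (D₁ : M →ₗ[k] T) (hl : ∀ b m, D₁ (lact k b m) = γ (base k B M b) * D₁ m)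
    (hr : ∀ b m, D₁ (ract k b m) = D₁ m * j (base k B M b)) :
    ∃ D : TensorAlg k B M →ₗ[k] T, (∀ b, D (base k B M b) = 0) ∧ (∀ m, D (gen k B M m) = D₁ m) ∧
      ∀ x y, D (x * y) = D x * j y + γ x * D y := by
  -- A twisted derivation is the off-diagonal entry of a triangular representation `(x, t) ↦ (α x,
  -- D(α) j(x) + γ(α) t)`. The representation is obtained from the universal property of `T_B M`.
  let φ : B →ₐ[k] Module.End k (TensorAlg k B M × T) :=
    AlgHom.ofLinearMap
      { toFun := fun b => LinearMap.prodMap (LinearMap.mulLeft k (base k B M b))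
          (LinearMap.mulLeft k (γ (base k B M b)))
        map_add' := fun b c => LinearMap.ext fun p => by simp [add_mul]
        map_smul' := fun r b => LinearMap.ext fun p => by simp }
      (LinearMap.ext fun p => by simp)
      (fun b c => LinearMap.ext fun p => by simp [mul_assoc])
  let ψ : M →ₗ[k] Module.End k (TensorAlg k B M × T) :=
    { toFun := fun m => LinearMap.prod
        (LinearMap.mulLeft k (gen k B M m) ∘ₗ LinearMap.fst k _ _)
        (LinearMap.mulLeft k (D₁ m) ∘ₗ j.toLinearMap ∘ₗ LinearMap.fst k _ _ +
          LinearMap.mulLeft k (γ (gen k B M m)) ∘ₗ LinearMap.snd k _ _)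
      map_add' := fun b c => LinearMap.ext fun p => by simp [add_mul]; abel
      map_smul' := fun r b => LinearMap.ext fun p => by simp }
  have hφ : ∀ b p, φ b p = (base k B M b * p.1, γ (base k B M b) * p.2) := fun _ _ => rfl
  have hψ : ∀ m p, ψ m p = (gen k B M m * p.1, D₁ m * j p.1 + γ (gen k B M m) * p.2) :=
    fun _ _ => rfl
  let Φ : TensorAlg k B M →ₐ[k] Module.End k (TensorAlg k B M × T) := lift φ ψ
    (fun b m => LinearMap.ext fun p => by
      rw [Module.End.mul_apply, hψ, hψ, hφ, hl, ← base_mul_gen, map_mul]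
      simp [mul_assoc, mul_add])
    (fun b m => LinearMap.ext fun p => by
      rw [Module.End.mul_apply, hψ, hψ, hφ, hr, ← gen_mul_base, map_mul]
      simp [mul_assoc])
  have hb : ∀ b p, Φ (base k B M b) p = (base k B M b * p.1, γ (base k B M b) * p.2) := by
    intro b p
    simp only [Φ, lift_base, hφ]
  have hg : ∀ m p, Φ (gen k B M m) p =
      (gen k B M m * p.1, D₁ m * j p.1 + γ (gen k B M m) * p.2) := by
    intro m p
    simp only [Φ, lift_gen, hψ]
  let D : TensorAlg k B M →ₗ[k] T := LinearMap.snd k _ _ ∘ₗ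
    LinearMap.applyₗ ((1, 0) : TensorAlg k B M × T) ∘ₗ Φ.toLinearMap
  have hD : ∀ α, D α = (Φ α (1, 0)).2 := fun _ => rfl
  have key : ∀ α, ∀ p, Φ α p = (α * p.1, D α * j p.1 + γ α * p.2) := by
    intro α
    induction α using TensorAlg.induction with
    | hb a => intro p; rw [hD, hb, hb]; simp
    | hm a => intro p; rw [hD, hg, hg]; simp
    | hadd x y hx hy =>
      intro p
      rw [map_add, LinearMap.add_apply, hx, hy, map_add, map_add]
      ext <;> simp [add_mul]
      abel
    | hmul x y hx hy =>
      intro p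
      have hxy : D (x * y) = D x * j y + γ x * D y := by
        rw [hD (x * y), map_mul, Module.End.mul_apply, hx, hy]; simp
      rw [map_mul, Module.End.mul_apply, hx, hy, hxy]
      ext <;> simp [add_mul, mul_add, mul_assoc, add_assoc]
  refine ⟨D, fun a => ?_, fun a => ?_, fun α β => ?_⟩
  · rw [hD, hb]; simp
  · rw [hD, hg]; simp
  · rw [hD (α * β), map_mul, Module.End.mul_apply, key, key]; simp

variable (k B M) in
/-- The projection `T_B M → B`. -/
def toBase : TensorAlg k B M →ₐ[k] B := lift (AlgHom.id k B) 0 (by simp) (by simp)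

theorem toBase_base (b : B) : toBase k B M (base k B M b) = b := lift_base _ _ _ _ _

theorem toBase_gen (m : M) : toBase k B M (gen k B M m) = 0 := lift_gen _ _ _ _ _

/-- The projection `T_B M → M` onto the component of length one. -/
theorem exists_toGen : ∃ D : TensorAlg k B M →ₗ[k] M, (∀ b, D (base k B M b) = 0) ∧
    (∀ m, D (gen k B M m) = m) ∧
    ∀ x y, D (x * y) = ract k (toBase k B M y) (D x) + lact k (toBase k B M x) (D y) := by
  -- `T_B M` acts on `B ⊕ M` with `b` acting diagonally and `m` sending `(c, n)` to `(0, m c)`. The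
  -- image of `(1, 0)` has the length-one component as its second entry.
  let φ : B →ₐ[k] Module.End k (B × M) :=
    AlgHom.ofLinearMap
      { toFun := fun b => LinearMap.prodMap (LinearMap.mulLeft k b) (lact k b)
        map_add' := fun b c => LinearMap.ext fun p => by simp [add_mul, lact_add]
        map_smul' := fun r b => LinearMap.ext fun p => by simp [lact_smul] }
      (LinearMap.ext fun p => by simp [lact_one])
      (fun b c => LinearMap.ext fun p => by simp [mul_assoc, lact_lact])
  let ψ : M →ₗ[k] Module.End k (B × M) :=
    { toFun := fun m => LinearMap.inr k B M ∘ₗ ractOn m ∘ₗ LinearMap.fst k B M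
      map_add' := fun b c => LinearMap.ext fun p => by simp [ractOn_apply]
      map_smul' := fun r b => LinearMap.ext fun p => by simp [ractOn_apply] }
  have hφ : ∀ b p, φ b p = (b * p.1, lact k b p.2) := fun _ _ => rfl
  have hψ : ∀ m p, ψ m p = (0, ract k p.1 m) := fun _ _ => rfl
  let Φ : TensorAlg k B M →ₐ[k] Module.End k (B × M) := lift φ ψ
    (fun b m => LinearMap.ext fun p => by
      rw [Module.End.mul_apply, hψ, hψ, hφ, lact_ract]
      simp)
    (fun b m => LinearMap.ext fun p => by
      rw [Module.End.mul_apply, hψ, hψ, hφ, ract_ract])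
  have hb : ∀ b p, Φ (base k B M b) p = (b * p.1, lact k b p.2) := by
    intro b p
    simp only [Φ, lift_base, hφ]
  have hg : ∀ m p, Φ (gen k B M m) p = (0, ract k p.1 m) := by
    intro m p
    simp only [Φ, lift_gen, hψ]
  let D : TensorAlg k B M →ₗ[k] M := LinearMap.snd k _ _ ∘ₗ
    LinearMap.applyₗ ((1, 0) : B × M) ∘ₗ Φ.toLinearMap
  have hD : ∀ α, D α = (Φ α (1, 0)).2 := fun _ => rfl
  have key : ∀ α, ∀ p, Φ α p =
      (toBase k B M α * p.1, ract k p.1 (D α) + lact k (toBase k B M α) p.2) := by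
    intro α
    induction α using TensorAlg.induction with
    | hb a => intro p; rw [hD, hb, hb]; simp [toBase_base]
    | hm a => intro p; rw [hD, hg, hg]; simp [toBase_gen, ract_one, lact_zero]
    | hadd x y hx hy =>
      intro p
      rw [map_add, LinearMap.add_apply, hx, hy, map_add, map_add]
      ext <;> simp [add_mul, lact_add]
      abel
    | hmul x y hx hy =>
      intro p
      have hxy : D (x * y) = ract k (toBase k B M y) (D x) + lact k (toBase k B M x) (D y) := by
        rw [hD (x * y), map_mul, Module.End.mul_apply, hx, hy]; simp [ract_one]
      rw [map_mul, Module.End.mul_apply, hx, hy, hxy]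
      ext <;> simp [mul_assoc, ract_ract, lact_lact, lact_ract, add_assoc]
  refine ⟨D, fun a => ?_, fun a => ?_, fun α β => ?_⟩
  · rw [hD, hb]; simp
  · rw [hD, hg]; simp [ract_one]
  · rw [hD (α * β), map_mul, Module.End.mul_apply, key, key]; simp [ract_one]

variable (k B M) in
/-- The projection `T_B M → M`. -/
def toGen : TensorAlg k B M →ₗ[k] M := exists_toGen.choose

theorem toGen_base (b : B) : toGen k B M (base k B M b) = 0 := exists_toGen.choose_spec.1 b

theorem toGen_gen (m : M) : toGen k B M (gen k B M m) = m := exists_toGen.choose_spec.2.1 m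

theorem toGen_mul (x y : TensorAlg k B M) : toGen k B M (x * y) =
    ract k (toBase k B M y) (toGen k B M x) + lact k (toBase k B M x) (toGen k B M y) :=
  exists_toGen.choose_spec.2.2 x y

variable (k B M) in
/-- The derivation of `T_B M` which counts the length of tensors. -/
theorem exists_euler : ∃ D : TensorAlg k B M →ₗ[k] TensorAlg k B M,
    (∀ b, D (base k B M b) = 0) ∧ (∀ m, D (gen k B M m) = gen k B M m) ∧
      ∀ x y, D (x * y) = D x * y + x * D y :=
  exists_twistedDer (AlgHom.id k _) (AlgHom.id k _) (gen k B M)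
    (fun b m => (base_mul_gen b m).symm) (fun b m => (gen_mul_base b m).symm)

end TensorAlg

end Bimodules

/-! ### Low weights of `A` and of `A ⊗ A` -/

section WeightTwo

variable {k : Type*} [Field k] [CharZero k]
variable {B : Type*} [Ring B] [Algebra k B]
variable {E₁ : Type*} [AddCommGroup E₁] [Module k E₁] [Module (Env k B) E₁]
  [IsScalarTower k (Env k B) E₁]
variable {E₂ : Type*} [AddCommGroup E₂] [Module k E₂] [Module (Env k B) E₂]
  [IsScalarTower k (Env k B) E₂]
variable {R : Type*} [Ring R] [Algebra k R] {f : R →ₐ[k] B}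

namespace TAlg

variable (k B E₁ E₂) in
/-- The projection `A → B`. -/
abbrev toB : TAlg k B E₁ E₂ →ₐ[k] B := TensorAlg.toBase k B (E₁ × E₂)

variable (k B E₁ E₂) in
/-- The projection `A → E₁`. -/
def toE₁ : TAlg k B E₁ E₂ →ₗ[k] E₁ := LinearMap.fst k E₁ E₂ ∘ₗ TensorAlg.toGen k B (E₁ × E₂)

theorem toB_ofB (b : B) : toB k B E₁ E₂ (ofB k B E₁ E₂ b) = b := TensorAlg.toBase_base b

theorem toB_ofE₁ (e : E₁) : toB k B E₁ E₂ (ofE₁ k B E₁ E₂ e) = 0 := TensorAlg.toBase_gen _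

theorem toE₁_ofB (b : B) : toE₁ k B E₁ E₂ (ofB k B E₁ E₂ b) = 0 :=
  congrArg Prod.fst (TensorAlg.toGen_base b)

theorem toE₁_ofE₁ (e : E₁) : toE₁ k B E₁ E₂ (ofE₁ k B E₁ E₂ e) = e :=
  congrArg Prod.fst (TensorAlg.toGen_gen ((e, 0) : E₁ × E₂))

theorem toE₁_mul (x y : TAlg k B E₁ E₂) : toE₁ k B E₁ E₂ (x * y) =
    ract k (toB k B E₁ E₂ y) (toE₁ k B E₁ E₂ x) + lact k (toB k B E₁ E₂ x) (toE₁ k B E₁ E₂ y) :=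
  congrArg Prod.fst (TensorAlg.toGen_mul x y)

theorem toB_of_pos : ∀ n : ℕ, 0 < n → ∀ a ∈ part k B E₁ E₂ n, toB k B E₁ E₂ a = 0 := by
  intro n hn a ha
  have hle : part k B E₁ E₂ n ≤ LinearMap.ker (toB k B E₁ E₂).toLinearMap := by
    refine Submodule.span_le.2 fun x hx => ?_
    change toB k B E₁ E₂ x = 0
    change IsMonomial k B E₁ E₂ n x at hx
    clear ha
    induction hx with
    | ofB b => omega
    | ofE₁ e => exact TensorAlg.toBase_gen _
    | ofE₂ e => exact TensorAlg.toBase_gen _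
    | @mul p q x y hx hy h1 h2 =>
      rw [map_mul]
      rcases Nat.eq_zero_or_pos p with rfl | hp
      · rw [h2 (by omega), mul_zero]
      · rw [h1 hp, zero_mul]
  exact hle ha

/-- Generators outside `B` have positive weight. A monomial of weight 0 thus has factors in `B`
only, and one of weight 1 has exactly one further factor, from `E₁`, which absorbs its neighbours.
-/
theorem isMonomial_low {n : ℕ} {x : TAlg k B E₁ E₂} (hx : IsMonomial k B E₁ E₂ n x) :
    (n = 0 → ∃ b, x = ofB k B E₁ E₂ b) ∧ (n = 1 → ∃ e, x = ofE₁ k B E₁ E₂ e) := by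
  induction hx with
  | ofB b => exact ⟨fun _ => ⟨b, rfl⟩, fun h => by omega⟩
  | ofE₁ e => exact ⟨fun h => by omega, fun _ => ⟨e, rfl⟩⟩
  | ofE₂ e => exact ⟨fun h => by omega, fun h => by omega⟩
  | @mul p q x y hx hy h1 h2 =>
    constructor
    · intro h
      obtain ⟨b, rfl⟩ := h1.1 (by omega)
      obtain ⟨c, rfl⟩ := h2.1 (by omega)
      exact ⟨b * c, (map_mul _ _ _).symm⟩
    · intro h
      by_cases hp : p = 0
      · obtain ⟨b, rfl⟩ := h1.1 hp
        obtain ⟨e, rfl⟩ := h2.2 (by omega)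
        exact ⟨_, base_mul_ofE₁ k B E₁ E₂ b e⟩
      · obtain ⟨e, rfl⟩ := h1.2 (by omega)
        obtain ⟨b, rfl⟩ := h2.1 (by omega)
        exact ⟨_, ofE₁_mul_base k B E₁ E₂ b e⟩

theorem ofB_mem (b : B) : ofB k B E₁ E₂ b ∈ part k B E₁ E₂ 0 := Submodule.subset_span (.ofB b)

theorem ofE₁_mem (e : E₁) : ofE₁ k B E₁ E₂ e ∈ part k B E₁ E₂ 1 := Submodule.subset_span (.ofE₁ e)

theorem ofB_toB {x : TAlg k B E₁ E₂} (hx : x ∈ part k B E₁ E₂ 0) :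
    ofB k B E₁ E₂ (toB k B E₁ E₂ x) = x := by
  have hle : part k B E₁ E₂ 0 ≤ LinearMap.eqLocus
      ((ofB k B E₁ E₂).toLinearMap ∘ₗ (toB k B E₁ E₂).toLinearMap) LinearMap.id := by
    refine Submodule.span_le.2 fun x hx => ?_
    obtain ⟨b, rfl⟩ := (isMonomial_low (k := k) (B := B) (E₁ := E₁) (E₂ := E₂) hx).1 rfl
    exact congrArg (ofB k B E₁ E₂) (toB_ofB (E₁ := E₁) (E₂ := E₂) b)
  exact hle hx

theorem ofE₁_toE₁ {x : TAlg k B E₁ E₂} (hx : x ∈ part k B E₁ E₂ 1) :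
    ofE₁ k B E₁ E₂ (toE₁ k B E₁ E₂ x) = x := by
  have hle : part k B E₁ E₂ 1 ≤ LinearMap.eqLocus
      (ofE₁ k B E₁ E₂ ∘ₗ toE₁ k B E₁ E₂) LinearMap.id := by
    refine Submodule.span_le.2 fun x hx => ?_
    obtain ⟨e, rfl⟩ := (isMonomial_low (k := k) (B := B) (E₁ := E₁) (E₂ := E₂) hx).2 rfl
    exact congrArg (ofE₁ k B E₁ E₂) (toE₁_ofE₁ (E₂ := E₂) e)
  exact hle hx

variable (k B E₁ E₂) in
/-- The projection `A ⊗ A → B ⊗ B`. -/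
def toBB : TAlg k B E₁ E₂ ⊗[k] TAlg k B E₁ E₂ →ₗ[k] B ⊗[k] B :=
  TensorProduct.map (toB k B E₁ E₂).toLinearMap (toB k B E₁ E₂).toLinearMap

variable (k B E₁ E₂) in
/-- The projection `A ⊗ A → E₁ ⊗ B ⊕ B ⊗ E₁`. -/
def toMixed : TAlg k B E₁ E₂ ⊗[k] TAlg k B E₁ E₂ →ₗ[k] Mixed k B E₁ :=
  LinearMap.prod (TensorProduct.map (toE₁ k B E₁ E₂) (toB k B E₁ E₂).toLinearMap)
    (TensorProduct.map (toB k B E₁ E₂).toLinearMap (toE₁ k B E₁ E₂))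

theorem toBB_inclBB (t : B ⊗[k] B) : toBB k B E₁ E₂ (inclBB k B E₁ E₂ t) = t := by
  induction t with
  | zero => simp
  | add x y hx hy => rw [map_add, map_add, hx, hy]
  | tmul x y =>
    simp only [inclBB, toBB, TensorProduct.map_tmul, AlgHom.toLinearMap_apply]
    rw [toB_ofB, toB_ofB]

theorem inclBB_injective : Function.Injective (inclBB k B E₁ E₂) :=
  Function.LeftInverse.injective toBB_inclBB

theorem toMixed_inclMixed (t : Mixed k B E₁) :
    toMixed k B E₁ E₂ (inclMixed k B E₁ E₂ t) = t := by
  obtain ⟨s, t⟩ := t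
  have h1 : ∀ s : E₁ ⊗[k] B, toMixed k B E₁ E₂ (inclMixed k B E₁ E₂ (s, 0)) = (s, 0) := by
    intro s
    rw [inclMixed, LinearMap.coprod_apply, map_zero, add_zero]
    dsimp only
    induction s with
    | zero => rw [map_zero, map_zero]; rfl
    | add x y hx hy => rw [map_add, map_add, hx, hy]; simp
    | tmul x y =>
      simp only [toMixed, TensorProduct.map_tmul, AlgHom.toLinearMap_apply, LinearMap.prod_apply,
        Function.prod_apply]
      rw [toB_ofB, toB_ofE₁, toE₁_ofE₁, TensorProduct.zero_tmul]
  have h2 : ∀ s : B ⊗[k] E₁, toMixed k B E₁ E₂ (inclMixed k B E₁ E₂ (0, s)) = (0, s) := by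
    intro s
    rw [inclMixed, LinearMap.coprod_apply, map_zero, zero_add]
    dsimp only
    induction s with
    | zero => rw [map_zero, map_zero]; rfl
    | add x y hx hy => rw [map_add, map_add, hx, hy]; simp
    | tmul x y =>
      simp only [toMixed, TensorProduct.map_tmul, AlgHom.toLinearMap_apply, LinearMap.prod_apply,
        Function.prod_apply]
      rw [toB_ofB, toB_ofE₁, toE₁_ofE₁, TensorProduct.tmul_zero]
  have h : ((s, t) : Mixed k B E₁) = (s, 0) + (0, t) := by simp
  rw [h, map_add, map_add, h1, h2]

theorem inclMixed_injective : Function.Injective (inclMixed k B E₁ E₂) :=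
  Function.LeftInverse.injective toMixed_inclMixed

theorem eq_zero_of_mem_tensorPart {m : ℤ} (hm : m < 0)
    {t : TAlg k B E₁ E₂ ⊗[k] TAlg k B E₁ E₂} (ht : t ∈ tensorPart (part k B E₁ E₂) m) : t = 0 := by
  have := tensorPart_induction (LinearMap.id) ⊥ (fun i j hij x hx y hy => by omega) ht
  simpa using this

/-- Weights in `A` are non-negative, so total weight 0 forces both factors into `A⁰ = B`. This lets
the inner product and the anchor take values in `B ⊗ B`. -/
theorem inclBB_toBB {t : TAlg k B E₁ E₂ ⊗[k] TAlg k B E₁ E₂}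
    (ht : t ∈ tensorPart (part k B E₁ E₂) 0) : inclBB k B E₁ E₂ (toBB k B E₁ E₂ t) = t := by
  have := tensorPart_induction (inclBB k B E₁ E₂ ∘ₗ toBB k B E₁ E₂ - LinearMap.id) ⊥
    (fun i j hij x hx y hy => by
      obtain rfl : i = 0 := by omega
      obtain rfl : j = 0 := by omega
      simp only [inclBB, toBB, LinearMap.sub_apply, LinearMap.comp_apply, TensorProduct.map_tmul,
        AlgHom.toLinearMap_apply, LinearMap.id_apply, Submodule.mem_bot]
      rw [ofB_toB hx, ofB_toB hy, sub_self]) ht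
  simpa [sub_eq_zero] using this

/-- Total weight 1 puts one factor in `A⁰ = B` and the other in `A¹ = E₁`. This is what places the
Dorfman bracket in `E ⊗ B ⊕ B ⊗ E`. -/
theorem inclMixed_toMixed {t : TAlg k B E₁ E₂ ⊗[k] TAlg k B E₁ E₂}
    (ht : t ∈ tensorPart (part k B E₁ E₂) 1) : inclMixed k B E₁ E₂ (toMixed k B E₁ E₂ t) = t := by
  have := tensorPart_induction (inclMixed k B E₁ E₂ ∘ₗ toMixed k B E₁ E₂ - LinearMap.id) ⊥
    (fun i j hij x hx y hy => by
      simp only [inclMixed, toMixed, LinearMap.sub_apply, LinearMap.comp_apply,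
        LinearMap.prod_apply, Function.prod_apply, LinearMap.coprod_apply, TensorProduct.map_tmul,
        AlgHom.toLinearMap_apply, LinearMap.id_apply, Submodule.mem_bot]
      by_cases hi : i = 0
      · subst hi
        obtain rfl : j = 1 := by omega
        rw [ofB_toB hx, ofE₁_toE₁ hy, toB_of_pos 1 one_pos y hy]
        simp
      · obtain rfl : i = 1 := by omega
        obtain rfl : j = 0 := by omega
        rw [ofB_toB hy, ofE₁_toE₁ hx, toB_of_pos 1 one_pos x hx]
        simp) ht
  simpa [sub_eq_zero] using this

theorem inclBB_mem (t : B ⊗[k] B) :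
    inclBB k B E₁ E₂ t ∈ tensorPart (part k B E₁ E₂) 0 := by
  induction t with
  | zero => simp
  | add x y hx hy => rw [map_add]; exact add_mem hx hy
  | tmul x y => exact tmul_mem_tensorPart (ofB_mem x) (ofB_mem y) (by simp)

theorem inclBB_mul (s t : B ⊗[k] B) : inclBB k B E₁ E₂ (s * t) =
    inclBB k B E₁ E₂ s * inclBB k B E₁ E₂ t :=
  map_mul (Algebra.TensorProduct.map (ofB k B E₁ E₂) (ofB k B E₁ E₂)) s t

theorem mul_mem_tensorPart {m n : ℤ} {s t : TAlg k B E₁ E₂ ⊗[k] TAlg k B E₁ E₂}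
    (hs : s ∈ tensorPart (part k B E₁ E₂) m) (ht : t ∈ tensorPart (part k B E₁ E₂) n) :
    s * t ∈ tensorPart (part k B E₁ E₂) (m + n) := by
  refine tensorPart_induction (LinearMap.mulRight k t) _ (fun i j hij x hx y hy => ?_) hs
  refine tensorPart_induction (LinearMap.mulLeft k (x ⊗ₜ y)) _ (fun i' j' hij' x' hx' y' hy' => ?_)
    ht
  rw [LinearMap.mulLeft_apply, Algebra.TensorProduct.tmul_mul_tmul]
  exact tmul_mem_tensorPart (SetLike.mul_mem_graded hx hx') (SetLike.mul_mem_graded hy hy')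
    (by push_cast; linarith)

/-- A bimodule map `E₁ → B ⊗ B` extends to a double derivation of weight `-1`. -/
theorem exists_doubleDer_extension (ψ : E₁ →ₗ[k] B ⊗[k] B)
    (hl : ∀ b e, ψ (lact k b e) = (b ⊗ₜ 1) * ψ e) (hr : ∀ b e, ψ (ract k b e) = ψ e * (1 ⊗ₜ b)) :
    ∃ Θ : DoubleDer (ofR E₁ E₂ f) (part k B E₁ E₂) (-1),
      ∀ e, Θ.toLin (ofE₁ k B E₁ E₂ e) = inclBB k B E₁ E₂ (ψ e) := by
  have hs : ∀ b : B, weightSign (part k B E₁ E₂) (-1) (TensorAlg.base k B (E₁ × E₂) b) =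
      TensorAlg.base k B (E₁ × E₂) b := fun b => by
    rw [weightSign_of_mem _ (-1) (ofB_mem b)]; simp [sgn_zero]
  -- The extension is by zero on `B` and on `E₂`.
  obtain ⟨D, h1, h2, h3⟩ := TensorAlg.exists_twistedDer
    (T := TAlg k B E₁ E₂ ⊗[k] TAlg k B E₁ E₂)
    (Algebra.TensorProduct.includeLeft.comp (weightSign (part k B E₁ E₂) (-1)))
    Algebra.TensorProduct.includeRight (inclBB k B E₁ E₂ ∘ₗ ψ ∘ₗ LinearMap.fst k E₁ E₂)
    (fun b m => by
      simp only [LinearMap.comp_apply, LinearMap.fst_apply, lact_prod, hl, inclBB_mul,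
        AlgHom.comp_apply, hs]
      simp [inclBB])
    (fun b m => by
      simp only [LinearMap.comp_apply, LinearMap.fst_apply, ract_prod, hr, inclBB_mul]
      simp [inclBB])
  have hE₁ : ∀ e, D (ofE₁ k B E₁ E₂ e) = inclBB k B E₁ E₂ (ψ e) := fun e => h2 (e, 0)
  refine ⟨⟨D, fun n a ha => ?_, fun n a ha b => ?_, fun r => h1 (f r)⟩, hE₁⟩
  · have hle : part k B E₁ E₂ n ≤ (tensorPart (part k B E₁ E₂) (n + -1)).comap D := by
      refine Submodule.span_le.2 fun x hx => ?_
      change D x ∈ tensorPart (part k B E₁ E₂) (n + -1)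
      change IsMonomial k B E₁ E₂ n x at hx
      clear ha
      induction hx with
      | ofB b => rw [show D (ofB k B E₁ E₂ b) = 0 from h1 b]; exact zero_mem _
      | ofE₁ e => rw [hE₁]; exact inclBB_mem _
      | ofE₂ e =>
        rw [show D (ofE₂ k B E₁ E₂ e) = _ from h2 (0, e)]
        simp
      | @mul p q x y hx hy ih1 ih2 =>
        have hx' : x ∈ part k B E₁ E₂ p := Submodule.subset_span hx
        have hy' : y ∈ part k B E₁ E₂ q := Submodule.subset_span hy
        rw [h3]
        refine add_mem ?_ ?_
        · have h := mul_mem_tensorPart ih1 (tmul_mem_tensorPart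
            (SetLike.GradedOne.one_mem (A := part k B E₁ E₂)) hy' (m := q) (by simp))
          rwa [show (p + -1 + q : ℤ) = ((p + q : ℕ) : ℤ) + -1 by push_cast; ring] at h
        · have h := mul_mem_tensorPart (tmul_mem_tensorPart (weightSign_mem (-1) hx')
            (SetLike.GradedOne.one_mem (A := part k B E₁ E₂)) (m := p) (by simp)) ih2
          rwa [show (p + (q + -1) : ℤ) = ((p + q : ℕ) : ℤ) + -1 by push_cast; ring] at h
    exact hle ha
  · rw [h3, AlgHom.comp_apply, weightSign_of_mem _ _ ha, map_smul, smul_mul_assoc]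
    rfl

end TAlg

end WeightTwo

/-! ### The inner action on double derivations, and dual bases -/

section InnerAction

variable {k : Type*} [Field k]

section Basic

variable {A : Type*} [Ring A] [Algebra k A]

/-- The inner action of `A ⊗ A` on itself, `(s ⊗ t, x ⊗ y) ↦ x s ⊗ t y`. -/
def innerAct (k A : Type*) [Field k] [Ring A] [Algebra k A] :
    A ⊗[k] A →ₗ[k] A ⊗[k] A →ₗ[k] A ⊗[k] A :=
  TensorProduct.lift (LinearMap.mk₂ k
    (fun s t => TensorProduct.map (LinearMap.mulRight k s) (LinearMap.mulLeft k t))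
    (fun s s' t => TensorProduct.ext' fun x y => by simp [mul_add, TensorProduct.add_tmul])
    (fun c s t => TensorProduct.ext' fun x y => by simp [TensorProduct.smul_tmul'])
    (fun s t t' => TensorProduct.ext' fun x y => by simp [add_mul, TensorProduct.tmul_add])
    (fun c s t => TensorProduct.ext' fun x y => by simp))

theorem innerAct_tmul (s t x y : A) :
    innerAct k A (s ⊗ₜ t) (x ⊗ₜ y) = (x * s) ⊗ₜ (t * y) := by
  simp [innerAct]

theorem innerAct_mul_right (s t : A ⊗[k] A) (b : A) :
    innerAct k A s (t * (1 ⊗ₜ b)) = innerAct k A s t * (1 ⊗ₜ b) := by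
  induction s with
  | zero => simp
  | add s s' h h' => simp only [map_add, LinearMap.add_apply, add_mul, h, h']
  | tmul u v =>
    induction t with
    | zero => simp
    | add s s' h h' => simp only [map_add, add_mul, h, h']
    | tmul x y => simp [innerAct_tmul, mul_assoc]

theorem innerAct_mul_left (s t : A ⊗[k] A) (b : A) :
    innerAct k A s ((b ⊗ₜ 1) * t) = (b ⊗ₜ 1) * innerAct k A s t := by
  induction s with
  | zero => simp
  | add s s' h h' => simp only [map_add, LinearMap.add_apply, mul_add, h, h']
  | tmul u v =>
    induction t with
    | zero => simp
    | add s s' h h' => simp only [map_add, mul_add, h, h']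
    | tmul x y => simp [innerAct_tmul, mul_assoc]

theorem innerAct_map {C : Type*} [Ring C] [Algebra k C] (g : A →ₐ[k] C) (s t : A ⊗[k] A) :
    innerAct k C (TensorProduct.map g.toLinearMap g.toLinearMap s)
      (TensorProduct.map g.toLinearMap g.toLinearMap t) =
      TensorProduct.map g.toLinearMap g.toLinearMap (innerAct k A s t) := by
  induction s with
  | zero => simp
  | add s s' h h' => simp only [map_add, LinearMap.add_apply, h, h']
  | tmul u v =>
    induction t with
    | zero => simp
    | add s s' h h' => simp only [map_add, h, h']
    | tmul x y => simp [innerAct_tmul]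

end Basic

section Hamiltonian

variable [CharZero k] {R : Type*} [Ring R] [Algebra k R] {A : Type*} [Ring A] [Algebra k A]
variable {f : R →ₐ[k] A} {𝒜 : ℕ → Submodule k A} [GradedAlgebra 𝒜] (hf : ∀ r, f r ∈ 𝒜 0)

/-- Together with the two statements that follow, this supplies linear combinations of double
derivations with their reduced contractions, since `DoubleDer` carries no module structure here. -/
theorem exists_doubleDer_zero (d : ℤ) : ∃ Θ : DoubleDer f 𝒜 d, Θ.toLin = 0 ∧
    ∀ w, Forms.reducedContraction hf Θ w = 0 := by
  obtain ⟨Θ, h1, h2⟩ := Forms.exists_doubleDer hf (d := d) (0 : A →ₗ[k] A ⊗[k] A) 0 (by simp)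
    (by simp) (by simp) (by simp)
  exact ⟨Θ, h1, fun w => by simp [Forms.reducedContraction, h2]⟩

theorem exists_doubleDer_add {d : ℤ} (Θ Δ : DoubleDer f 𝒜 d) : ∃ Ψ : DoubleDer f 𝒜 d,
    Ψ.toLin = Θ.toLin + Δ.toLin ∧ ∀ w, Forms.reducedContraction hf Ψ w =
      Forms.reducedContraction hf Θ w + Forms.reducedContraction hf Δ w := by
  obtain ⟨Ψ, h1, h2⟩ := Forms.exists_doubleDer hf (d := d) (Θ.toLin + Δ.toLin)
    (Forms.contraction hf Θ + Forms.contraction hf Δ)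
    (fun α β => by
      simp only [LinearMap.add_apply, Forms.contraction_mul, Forms.passSign_eq, add_mul, mul_add]
      abel)
    (fun a => by simp [Forms.contraction_of])
    (fun a => by simp [Forms.contraction_δ])
    (fun n a ha => add_mem (Θ.map_weight n a ha) (Δ.map_weight n a ha))
  exact ⟨Ψ, h1, fun w => by simp [Forms.reducedContraction, h2]⟩

/-- The inner action commutes with the outer one, so the Leibniz rule persists. Under `°` it becomes
two-sided multiplication, since `x s ⊗ t y` goes to `± t (y x) s`; no sign arises because `s` and
`t` have weight and form degree 0. -/
theorem exists_doubleDer_innerAct {d : ℤ} (Θ : DoubleDer f 𝒜 d) {s t : A} (hs : s ∈ 𝒜 0)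
    (ht : t ∈ 𝒜 0) : ∃ Ψ : DoubleDer f 𝒜 d,
      (∀ a, Ψ.toLin a = innerAct k A (s ⊗ₜ t) (Θ.toLin a)) ∧
      ∀ w, Forms.reducedContraction hf Ψ w =
        Forms.of f t * Forms.reducedContraction hf Θ w * Forms.of f s := by
  obtain ⟨Ψ, h1, h2⟩ := Forms.exists_doubleDer hf (d := d) (innerAct k A (s ⊗ₜ t) ∘ₗ Θ.toLin)
    (innerAct k (Forms f) (Forms.of f s ⊗ₜ Forms.of f t) ∘ₗ Forms.contraction hf Θ)
    (fun α β => by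
      rw [LinearMap.comp_apply, LinearMap.comp_apply, LinearMap.comp_apply, Forms.contraction_mul,
        map_add, innerAct_mul_right, innerAct_mul_left, Forms.passSign_eq])
    (fun a => by rw [LinearMap.comp_apply, Forms.contraction_of, map_zero])
    (fun a => by
      rw [LinearMap.comp_apply, LinearMap.comp_apply, Forms.contraction_δ, ← innerAct_map]
      rfl)
    (fun n a ha => by
      refine tensorPart_induction (innerAct k A (s ⊗ₜ t)) _ (fun i j hij x hx y hy => ?_)
        (Θ.map_weight n a ha)
      rw [innerAct_tmul]
      exact tmul_mem_tensorPart (SetLike.mul_mem_graded hx hs) (SetLike.mul_mem_graded ht hy)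
        (by push_cast; linarith))
  refine ⟨Ψ, fun a => by rw [h1]; rfl, fun w => ?_⟩
  have key : ∀ u : Forms f ⊗[k] Forms f, opMul (Forms.formSign f) (Forms.weightSign hf 1)
      (innerAct k (Forms f) (Forms.of f s ⊗ₜ Forms.of f t) u) =
      Forms.of f t * opMul (Forms.formSign f) (Forms.weightSign hf 1) u * Forms.of f s := by
    have hs' := Forms.isPar_of_mem hf (Forms.of_mem_homog (f := f) hs)
    have ht' := Forms.isPar_of_mem hf (Forms.of_mem_homog (f := f) ht)
    intro u
    induction u with
    | zero => simp
    | add u u' h h' => simp only [map_add, h, h', mul_add, add_mul]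
    | tmul x y =>
      induction x using (Forms.isSignPair hf).induction with
      | hadd x x' h1 h2 => simp only [TensorProduct.add_tmul, map_add, h1, h2, mul_add, add_mul]
      | h p w x hx =>
      induction y using (Forms.isSignPair hf).induction with
      | hadd y y' h1 h2 => simp only [TensorProduct.tmul_add, map_add, h1, h2, mul_add, add_mul]
      | h q v y hy =>
      rw [innerAct_tmul, opMul_tmul (hx.mul hs') (ht'.mul hy), opMul_tmul hx hy]
      simp [mul_assoc]
  rw [Forms.reducedContraction, LinearMap.comp_apply, h2, LinearMap.comp_apply, Forms.circ_eq, key]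
  rfl

end Hamiltonian

section Bimodule

variable {B : Type*} [Ring B] [Algebra k B]
variable {M : Type*} [AddCommGroup M] [Module k M] [Module (Env k B) M]
  [IsScalarTower k (Env k B) M]

variable (k B) in
/-- The identification `Bᵉ = B ⊗ B`. -/
def envEquiv : Env k B ≃ₗ[k] B ⊗[k] B :=
  TensorProduct.congr (LinearEquiv.refl k B) (opLinearEquiv k).symm

theorem envEquiv_mk (b c : B) : envEquiv k B (Env.mk k b c) = b ⊗ₜ c :=
  TensorProduct.congr_tmul _ _ _ _

theorem envEquiv_mul_left (b : B) (z : Env k B) :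
    envEquiv k B (Env.mk k b 1 * z) = (b ⊗ₜ 1) * envEquiv k B z := by
  induction z using Env.induction with
  | h0 => simp
  | hmk c d => rw [Env.mk_mul_mk, envEquiv_mk, envEquiv_mk]; simp
  | hadd x y hx hy => rw [mul_add, map_add, hx, hy, map_add, mul_add]

theorem envEquiv_mul_right (b : B) (z : Env k B) :
    envEquiv k B (Env.mk k 1 b * z) = envEquiv k B z * (1 ⊗ₜ b) := by
  induction z using Env.induction with
  | h0 => simp
  | hmk c d => rw [Env.mk_mul_mk, envEquiv_mk, envEquiv_mk]; simp
  | hadd x y hx hy => rw [mul_add, map_add, hx, hy, map_add, add_mul]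

/-- A bimodule map into the outer bimodule `B ⊗ B` is linear over `Bᵉ`. -/
theorem outer_map_smul {ψ : M →ₗ[k] B ⊗[k] B} (hl : ∀ b e, ψ (lact k b e) = (b ⊗ₜ 1) * ψ e)
    (hr : ∀ b e, ψ (ract k b e) = ψ e * (1 ⊗ₜ b)) (z : Env k B) (e : M) :
    ψ (z • e) = innerAct k B (ψ e) (envEquiv k B z) := by
  induction z using Env.induction with
  | h0 => simp
  | hmk c d =>
    rw [← Env.mk_mul, mul_smul]
    change ψ (lact k c (ract k d e)) = _
    rw [hl, hr, Env.mk_mul, envEquiv_mk]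
    generalize ψ e = t
    induction t with
    | zero => simp
    | add x y hx hy => simp only [map_add, LinearMap.add_apply, add_mul, mul_add, hx, hy]
    | tmul x y => simp [innerAct_tmul]
  | hadd x y hx hy => rw [add_smul, map_add, hx, hy, map_add, map_add]

/-- The action `(s ⊗ t, m) ↦ t m s`. -/
def oppAct (k : Type*) [Field k] {B : Type*} [Ring B] [Algebra k B]
    (M : Type*) [AddCommGroup M] [Module k M] [Module (Env k B) M] [IsScalarTower k (Env k B) M] :
    B ⊗[k] B →ₗ[k] M →ₗ[k] M :=
  TensorProduct.lift (LinearMap.mk₂ k (fun s t => lact k t ∘ₗ ract k s)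
    (fun s s' t => LinearMap.ext fun m => by simp [ract_add])
    (fun c s t => LinearMap.ext fun m => by simp [ract_smul])
    (fun s t t' => LinearMap.ext fun m => by simp [lact_add])
    (fun c s t => LinearMap.ext fun m => by simp [lact_smul]))

theorem oppAct_tmul (s t : B) (m : M) : oppAct k M (s ⊗ₜ t) m = lact k t (ract k s m) := by
  simp [oppAct]

/-- Compare `outer_map_smul`: there the value of the map acts on the scalar, here the scalar acts on
the value. The two together move an inner-linear map across the dual basis expansion. -/
theorem inner_map_oppAct {φ : M →ₗ[k] B ⊗[k] B} (hl : ∀ b p, φ (lact k b p) = (1 ⊗ₜ b) * φ p)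
    (hr : ∀ b p, φ (ract k b p) = φ p * (b ⊗ₜ 1)) (t : B ⊗[k] B) (m : M) :
    φ (oppAct k M t m) = innerAct k B t (φ m) := by
  induction t with
  | zero => simp
  | add x y hx hy => simp only [map_add, LinearMap.add_apply, hx, hy]
  | tmul s t =>
    rw [oppAct_tmul, hl, hr]
    generalize φ m = u
    induction u with
    | zero => simp
    | add x y hx hy => simp only [map_add, add_mul, mul_add, hx, hy]
    | tmul x y => simp [innerAct_tmul]

/-- Dual bases of finitely generated projective modules. -/
theorem exists_dual_basis {S M : Type*} [Ring S] [AddCommGroup M] [Module S M]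
    [Module.Finite S M] [Module.Projective S M] :
    ∃ (n : ℕ) (e : Fin n → M) (ε : Fin n → M →ₗ[S] S), ∀ x, ∑ i, ε i x • e i = x := by
  obtain ⟨n, g, hg⟩ := Module.Finite.exists_fin' S M
  obtain ⟨h, hh⟩ := Module.projective_lifting_property g LinearMap.id hg
  refine ⟨n, fun i => g (Pi.single i 1), fun i => LinearMap.proj i ∘ₗ h, fun x => ?_⟩
  have hx : g (h x) = x := LinearMap.congr_fun hh x
  conv_rhs => rw [← hx, ← Finset.univ_sum_single (h x), map_sum]
  refine Finset.sum_congr rfl fun i _ => ?_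
  rw [← map_smul]
  congr 1
  ext j
  simp [Pi.single_apply]

end Bimodule

end InnerAction

/-! ### Non-degeneracy of the pairing on `E₁` -/

section Nondegeneracy

section General

variable {k : Type*} [Field k] [CharZero k] {R : Type*} [Ring R] [Algebra k R]
variable {A : Type*} [Ring A] [Algebra k A]
variable {f : R →ₐ[k] A} {𝒜 : ℕ → Submodule k A} [GradedAlgebra 𝒜] (hf : ∀ r, f r ∈ 𝒜 0)
variable {C : Type*} [Ring C] [Algebra k C]

namespace Forms

variable (𝒜) in
/-- The span of the `x ⊗ y` with `x` or `y` in the kernel of `P`. -/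
def kerTensor (P : Forms f →ₐ[k] C) : Submodule k (Forms f ⊗[k] Forms f) :=
  Submodule.span k {t | ∃ (p q : ℕ) (v u : ℤ), ∃ x ∈ homog f 𝒜 p v, ∃ y ∈ homog f 𝒜 q u,
    (P x = 0 ∨ P y = 0) ∧ t = x ⊗ₜ y}

variable {P : Forms f →ₐ[k] C}

theorem circ_kerTensor {t : Forms f ⊗[k] Forms f} (ht : t ∈ kerTensor 𝒜 P) :
    P (circ hf t) = 0 := by
  have hle : kerTensor 𝒜 P ≤ LinearMap.ker (P.toLinearMap ∘ₗ circ hf) := by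
    refine Submodule.span_le.2 ?_
    rintro _ ⟨p, q, v, u, x, hx, y, hy, h, rfl⟩
    change P (circ hf (x ⊗ₜ y)) = 0
    rw [circ_tmul hf hx hy, map_smul, map_mul]
    rcases h with h | h <;> simp [h]
  exact hle ht

theorem kerTensor_mul {t : Forms f ⊗[k] Forms f} (ht : t ∈ kerTensor 𝒜 P) {q : ℕ} {u : ℤ}
    {β : Forms f} (hβ : β ∈ homog f 𝒜 q u) : t * (1 ⊗ₜ β) ∈ kerTensor 𝒜 P := by
  have hle : kerTensor 𝒜 P ≤ (kerTensor 𝒜 P).comap (LinearMap.mulRight k (1 ⊗ₜ β)) := by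
    refine Submodule.span_le.2 ?_
    rintro _ ⟨p, q, v, u, x, hx, y, hy, h, rfl⟩
    change (x ⊗ₜ y) * (1 ⊗ₜ β) ∈ kerTensor 𝒜 P
    rw [Algebra.TensorProduct.tmul_mul_tmul, mul_one]
    refine Submodule.subset_span ⟨_, _, _, _, x, hx, _, mul_mem_homog f 𝒜 hy hβ, ?_, rfl⟩
    rcases h with h | h
    · exact Or.inl h
    · exact Or.inr (by rw [map_mul, h, zero_mul])
  exact hle ht

theorem mul_kerTensor {t : Forms f ⊗[k] Forms f} (ht : t ∈ kerTensor 𝒜 P) {q : ℕ} {u : ℤ}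
    {α : Forms f} (hα : α ∈ homog f 𝒜 q u) : (α ⊗ₜ 1) * t ∈ kerTensor 𝒜 P := by
  have hle : kerTensor 𝒜 P ≤ (kerTensor 𝒜 P).comap (LinearMap.mulLeft k (α ⊗ₜ 1)) := by
    refine Submodule.span_le.2 ?_
    rintro _ ⟨p, q, v, u, x, hx, y, hy, h, rfl⟩
    change (α ⊗ₜ 1) * (x ⊗ₜ y) ∈ kerTensor 𝒜 P
    rw [Algebra.TensorProduct.tmul_mul_tmul, one_mul]
    refine Submodule.subset_span ⟨_, _, _, _, _, mul_mem_homog f 𝒜 hα hx, y, hy, ?_, rfl⟩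
    rcases h with h | h
    · exact Or.inl (by rw [map_mul, h, mul_zero])
    · exact Or.inr h
  exact hle ht

theorem tensorHomog_mul_mem_kerTensor {p : ℕ} {v : ℤ} {t : Forms f ⊗[k] Forms f}
    (ht : t ∈ tensorHomog (f := f) (𝒜 := 𝒜) p v) {q : ℕ} {u : ℤ} {β : Forms f}
    (hβ : β ∈ homog f 𝒜 q u) (h : P β = 0) : t * (1 ⊗ₜ β) ∈ kerTensor 𝒜 P := by
  have hle : tensorHomog (f := f) (𝒜 := 𝒜) p v ≤
      (kerTensor 𝒜 P).comap (LinearMap.mulRight k (1 ⊗ₜ β)) := by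
    refine Submodule.span_le.2 ?_
    rintro _ ⟨p₁, p₂, w₁, w₂, x, hx, y, hy, -, -, rfl⟩
    change (x ⊗ₜ y) * (1 ⊗ₜ β) ∈ kerTensor 𝒜 P
    rw [Algebra.TensorProduct.tmul_mul_tmul, mul_one]
    exact Submodule.subset_span ⟨_, _, _, _, x, hx, _, mul_mem_homog f 𝒜 hy hβ,
      Or.inr (by rw [map_mul, h, mul_zero]), rfl⟩
  exact hle ht

theorem mul_tensorHomog_mem_kerTensor {p : ℕ} {v : ℤ} {t : Forms f ⊗[k] Forms f}
    (ht : t ∈ tensorHomog (f := f) (𝒜 := 𝒜) p v) {q : ℕ} {u : ℤ} {α : Forms f}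
    (hα : α ∈ homog f 𝒜 q u) (h : P α = 0) : (α ⊗ₜ 1) * t ∈ kerTensor 𝒜 P := by
  have hle : tensorHomog (f := f) (𝒜 := 𝒜) p v ≤
      (kerTensor 𝒜 P).comap (LinearMap.mulLeft k (α ⊗ₜ 1)) := by
    refine Submodule.span_le.2 ?_
    rintro _ ⟨p₁, p₂, w₁, w₂, x, hx, y, hy, -, -, rfl⟩
    change (α ⊗ₜ 1) * (x ⊗ₜ y) ∈ kerTensor 𝒜 P
    rw [Algebra.TensorProduct.tmul_mul_tmul, one_mul]
    exact Submodule.subset_span ⟨_, _, _, _, _, mul_mem_homog f 𝒜 hα hx, y, hy,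
      Or.inl (by rw [map_mul, h, zero_mul]), rfl⟩
  exact hle ht

/-- If `P` kills the differentials of functions of weight zero, then `P (ι_Θ w)`, for `w` of form
degree and weight two, depends only on the values of `Θ` in weights zero and one. -/
theorem reducedContraction_congr (hP : ∀ a ∈ 𝒜 0, P (δ f a) = 0) {d : ℤ}
    {Θ Δ : DoubleDer f 𝒜 d} (h : ∀ n ≤ 1, ∀ a ∈ 𝒜 n, Θ.toLin a = Δ.toLin a) {w : Forms f}
    (hw : w ∈ homog f 𝒜 2 2) :
    P (reducedContraction hf Θ w) = P (reducedContraction hf Δ w) := by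
  let Z : Forms f →ₗ[k] Forms f ⊗[k] Forms f := contraction hf Θ - contraction hf Δ
  have hZm : ∀ {p : ℕ} {v : ℤ} {α : Forms f}, α ∈ homog f 𝒜 p v →
      Z α ∈ tensorHomog (f := f) (𝒜 := 𝒜) p (v + d) := fun hα =>
    sub_mem (contraction_mem hf Θ hα) (contraction_mem hf Δ hα)
  have hZ : ∀ α β, Z (α * β) = Z α * (1 ⊗ₜ β) + (passSign hf d α ⊗ₜ 1) * Z β := fun α β => by
    simp only [Z, LinearMap.sub_apply, contraction_mul, sub_mul, mul_sub]
    abel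
  have hpass : ∀ {p : ℕ} {v : ℤ} {α : Forms f}, α ∈ homog f 𝒜 p v →
      passSign hf d α = (sgn k (d * v) * sgn k p) • α := fun hα => by
    rw [passSign, AlgHom.comp_apply, weightSign_of_mem hf d hα, map_smul, formSign_of_mem f 𝒜 hα,
      smul_smul]
  -- `Z` can be non-zero only through a factor `da` with `a` of weight at least 2. In total weight 2
  -- every other factor then has weight 0, and a second 1-form among them is killed by `P`. The
  -- other clauses are what the product step needs.
  have key : ∀ (p : ℕ) (v : ℤ) (α : Forms f), IsMonomial f 𝒜 p v α →
      0 ≤ v ∧ (p = 0 → Z α = 0) ∧ (v ≤ 1 → Z α = 0) ∧ (1 ≤ p → v = 0 → P α = 0) ∧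
        (v = 2 → 2 ≤ p → Z α ∈ kerTensor 𝒜 P) := by
    intro p v α hα
    induction hα with
    | @of n a ha =>
      have h0 : Z (of f a) = 0 := by simp [Z, contraction_of]
      exact ⟨by positivity, fun _ => h0, fun _ => h0, fun h => by omega, fun _ h => by omega⟩
    | @δ n a ha =>
      refine ⟨by positivity, fun h => by omega, fun hn => ?_, fun _ hn => ?_, fun _ h => by omega⟩
      · simp [Z, contraction_δ, h n (by omega) a ha]
      · obtain rfl : n = 0 := by omega
        exact hP a ha
    | @mul p q v u α β hα hβ h1 h2 =>
      obtain ⟨a1, a2, a3, a4, a5⟩ := h1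
      obtain ⟨b1, b2, b3, b4, b5⟩ := h2
      have hα' : α ∈ homog f 𝒜 p v := Submodule.subset_span hα
      have hβ' : β ∈ homog f 𝒜 q u := Submodule.subset_span hβ
      refine ⟨by omega, fun h => ?_, fun h => ?_, fun h h' => ?_, fun h h' => ?_⟩
      · rw [hZ, a2 (by omega), b2 (by omega)]; simp
      · rw [hZ, a3 (by omega), b3 (by omega)]; simp
      · rw [map_mul]
        by_cases hp : 1 ≤ p
        · rw [a4 hp (by omega), zero_mul]
        · rw [b4 (by omega) (by omega), mul_zero]
      · rw [hZ, hpass hα', ← TensorProduct.smul_tmul', smul_mul_assoc]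
        refine add_mem ?_ (Submodule.smul_mem _ _ ?_)
        · by_cases hv : v ≤ 1
          · rw [a3 hv, zero_mul]; exact zero_mem _
          by_cases hp : p = 0
          · rw [a2 hp, zero_mul]; exact zero_mem _
          by_cases hp' : 2 ≤ p
          · exact kerTensor_mul (a5 (by omega) hp') hβ'
          · exact tensorHomog_mul_mem_kerTensor (hZm hα') hβ' (b4 (by omega) (by omega))
        · by_cases hv : u ≤ 1
          · rw [b3 hv, mul_zero]; exact zero_mem _
          by_cases hp : q = 0
          · rw [b2 hp, mul_zero]; exact zero_mem _
          by_cases hp' : 2 ≤ q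
          · exact mul_kerTensor (b5 (by omega) hp') hα'
          · exact mul_tensorHomog_mem_kerTensor (hZm hβ') hα' (a4 (by omega) (by omega))
  have hle : homog f 𝒜 2 2 ≤ (kerTensor 𝒜 P).comap Z :=
    Submodule.span_le.2 fun α hα => (key 2 2 α hα).2.2.2.2 rfl le_rfl
  have := circ_kerTensor hf (hle hw)
  rwa [LinearMap.sub_apply, map_sub, map_sub, sub_eq_zero] at this

end Forms

theorem exists_doubleDer_sum {d : ℤ} {ι : Type*} (s : Finset ι) (Θ : ι → DoubleDer f 𝒜 d) :
    ∃ Ψ : DoubleDer f 𝒜 d, Ψ.toLin = ∑ i ∈ s, (Θ i).toLin ∧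
      ∀ w, Forms.reducedContraction hf Ψ w = ∑ i ∈ s, Forms.reducedContraction hf (Θ i) w := by
  classical
  induction s using Finset.induction_on with
  | empty => simpa using exists_doubleDer_zero hf d
  | insert i s hi ih =>
    obtain ⟨Ψ, h1, h2⟩ := ih
    obtain ⟨Ψ', h1', h2'⟩ := exists_doubleDer_add hf (Θ i) Ψ
    refine ⟨Ψ', ?_, fun w => ?_⟩
    · rw [h1', h1, Finset.sum_insert hi]
    · rw [h2', h2, Finset.sum_insert hi]

end General

section WeightTwo

variable {k : Type*} [Field k] [CharZero k]
variable {B : Type*} [Ring B] [Algebra k B]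
variable {E₁ : Type*} [AddCommGroup E₁] [Module k E₁] [Module (Env k B) E₁]
  [IsScalarTower k (Env k B) E₁]
variable {E₂ : Type*} [AddCommGroup E₂] [Module k E₂] [Module (Env k B) E₂]
  [IsScalarTower k (Env k B) E₂]
variable {R : Type*} [Ring R] [Algebra k R] {f : R →ₐ[k] B}

namespace TAlg

theorem toE₁_base_mul_base (b c : B) (x : TAlg k B E₁ E₂) :
    toE₁ k B E₁ E₂ (ofB k B E₁ E₂ b * x * ofB k B E₁ E₂ c) =
      lact k b (ract k c (toE₁ k B E₁ E₂ x)) := by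
  rw [toE₁_mul, toE₁_mul, toE₁_ofB, toE₁_ofB, toB_ofB, toB_ofB, lact_ract]
  simp

variable (E₁ E₂) in
/-- A left inverse of the differential on `E₁`. -/
theorem exists_eulerForms (f : R →ₐ[k] B) :
    ∃ P : Forms (ofR E₁ E₂ f) →ₐ[k] TAlg k B E₁ E₂,
    (∀ a, P (Forms.of _ a) = a) ∧ (∀ a ∈ part k B E₁ E₂ 0, P (Forms.δ _ a) = 0) ∧
      ∀ e, P (Forms.δ _ (ofE₁ k B E₁ E₂ e)) = ofE₁ k B E₁ E₂ e := by
  -- The identity on functions together with the Euler derivation on differentials defines an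
  -- algebra map on forms. It sends `db` to 0 and `de` to `e`.
  obtain ⟨D, h1, h2, h3⟩ := TensorAlg.exists_euler k B (E₁ × E₂)
  refine ⟨Forms.lift (ofR E₁ E₂ f) (AlgHom.id k _) D h3 (fun r => h1 (f r)),
    fun a => Forms.lift_of _ _ _ _ _ _, fun a ha => ?_, fun e => ?_⟩
  · refine (Forms.lift_δ _ _ _ _ _ _).trans ?_
    rw [← ofB_toB ha]
    exact h1 _
  · exact (Forms.lift_δ _ _ _ _ _ _).trans (h2 _)

/-- The action of `B ⊗ B` on double derivations of weight `-1`. -/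
theorem exists_doubleDer_inclBB {w : Forms (ofR E₁ E₂ f)}
    {P : Forms (ofR E₁ E₂ f) →ₐ[k] TAlg k B E₁ E₂} (hP : ∀ a, P (Forms.of _ a) = a) {d : ℤ}
    (Θ : DoubleDer (ofR E₁ E₂ f) (part k B E₁ E₂) d) (t : B ⊗[k] B) :
    ∃ Ψ : DoubleDer (ofR E₁ E₂ f) (part k B E₁ E₂) d,
      (∀ a, Ψ.toLin a = innerAct k _ (inclBB k B E₁ E₂ t) (Θ.toLin a)) ∧
      toE₁ k B E₁ E₂ (P (Forms.reducedContraction (ofR_mem E₁ E₂ f) Ψ w)) =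
        oppAct k E₁ t (toE₁ k B E₁ E₂ (P (Forms.reducedContraction (ofR_mem E₁ E₂ f) Θ w))) := by
  induction t with
  | zero =>
    obtain ⟨Ψ, h1, h2⟩ := exists_doubleDer_zero (ofR_mem E₁ E₂ f) d
    exact ⟨Ψ, fun a => by simp [h1], by simp [h2]⟩
  | add s t hs ht =>
    obtain ⟨Ψ, h1, h2⟩ := hs
    obtain ⟨Ψ', h1', h2'⟩ := ht
    obtain ⟨Ψ'', h, h'⟩ := exists_doubleDer_add (ofR_mem E₁ E₂ f) Ψ Ψ'
    exact ⟨Ψ'', fun a => by simp [h, h1, h1'], by rw [h', map_add, map_add, h2, h2']; simp⟩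
  | tmul s t =>
    obtain ⟨Ψ, h1, h2⟩ := exists_doubleDer_innerAct (ofR_mem E₁ E₂ f) Θ
      (ofB_mem (E₁ := E₁) (E₂ := E₂) s) (ofB_mem (E₁ := E₁) (E₂ := E₂) t)
    exact ⟨Ψ, h1, by rw [h2, map_mul P, map_mul P, hP, hP, toE₁_base_mul_base, oppAct_tmul]⟩

theorem ofE₁_lact (b : B) (e : E₁) :
    ofE₁ k B E₁ E₂ (lact k b e) = ofB k B E₁ E₂ b * ofE₁ k B E₁ E₂ e :=
  (base_mul_ofE₁ k B E₁ E₂ b e).symm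

theorem ofE₁_ract (b : B) (e : E₁) :
    ofE₁ k B E₁ E₂ (ract k b e) = ofE₁ k B E₁ E₂ e * ofB k B E₁ E₂ b :=
  (ofE₁_mul_base k B E₁ E₂ b e).symm

/-- `A ⊗ A` has no negative weights. Double derivations of negative weight are therefore linear over
`B` for the outer actions. -/
theorem doubleDer_ofB {d : ℤ} (hd : d < 0) (Θ : DoubleDer (ofR E₁ E₂ f) (part k B E₁ E₂) d)
    (b : B) : Θ.toLin (ofB k B E₁ E₂ b) = 0 :=
  eq_zero_of_mem_tensorPart (by push_cast; omega) (Θ.map_weight 0 _ (ofB_mem b))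

/-- A double derivation of weight `-1`, restricted to `E₁`. -/
def pairing (Θ : DoubleDer (ofR E₁ E₂ f) (part k B E₁ E₂) (-1)) : E₁ →ₗ[k] B ⊗[k] B :=
  toBB k B E₁ E₂ ∘ₗ Θ.toLin ∘ₗ ofE₁ k B E₁ E₂

variable (Θ : DoubleDer (ofR E₁ E₂ f) (part k B E₁ E₂) (-1))

theorem inclBB_pairing (e : E₁) :
    inclBB k B E₁ E₂ (pairing Θ e) = Θ.toLin (ofE₁ k B E₁ E₂ e) :=
  inclBB_toBB (by simpa using Θ.map_weight 1 _ (ofE₁_mem e))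

theorem pairing_lact (b : B) (e : E₁) : pairing Θ (lact k b e) = (b ⊗ₜ 1) * pairing Θ e := by
  apply inclBB_injective (E₁ := E₁) (E₂ := E₂)
  rw [inclBB_mul, inclBB_pairing, inclBB_pairing, ofE₁_lact, Θ.leibniz 0 _ (ofB_mem b),
    doubleDer_ofB (by norm_num)]
  simp [sgn_zero, inclBB]

theorem pairing_ract (b : B) (e : E₁) : pairing Θ (ract k b e) = pairing Θ e * (1 ⊗ₜ b) := by
  apply inclBB_injective (E₁ := E₁) (E₂ := E₂)
  rw [inclBB_mul, inclBB_pairing, inclBB_pairing, ofE₁_ract, Θ.leibniz 1 _ (ofE₁_mem e),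
    doubleDer_ofB (by norm_num)]
  simp [inclBB]

/-- The pairing on `E₁` given by the Hamiltonian double derivations of a form of weight two is
non-degenerate. -/
theorem pairing_nondegenerate [Module.Finite (Env k B) E₁] [Module.Projective (Env k B) E₁]
    {w : Forms (ofR E₁ E₂ f)} (hw : w ∈ Forms.homog _ (part k B E₁ E₂) 2 2)
    {H : E₁ → DoubleDer (ofR E₁ E₂ f) (part k B E₁ E₂) (-1)}
    (hH : ∀ e, Forms.reducedContraction (ofR_mem E₁ E₂ f) (H e) w =
      Forms.δ _ (ofE₁ k B E₁ E₂ e))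
    (hsymm : ∀ p q, pairing (H p) q = TensorProduct.comm k B B (pairing (H q) p))
    (φ : E₁ →ₗ[k] B ⊗[k] B) (hl : ∀ b p, φ (lact k b p) = (1 ⊗ₜ b) * φ p)
    (hr : ∀ b p, φ (ract k b p) = φ p * (b ⊗ₜ 1)) : ∃! q, ∀ p, pairing (H p) q = φ p := by
  obtain ⟨P, hP, hP₀, hP₁⟩ := exists_eulerForms E₁ E₂ f
  -- `Φ` is a left inverse of `e ↦ H e` that is defined on all double derivations of weight -1 and,
  -- by `hcongr`, depends only on their restriction to `E₁`.
  let Φ : DoubleDer (ofR E₁ E₂ f) (part k B E₁ E₂) (-1) → E₁ := fun Θ =>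
    toE₁ k B E₁ E₂ (P (Forms.reducedContraction (ofR_mem E₁ E₂ f) Θ w))
  have hΦH : ∀ q, Φ (H q) = q := fun q => by
    change toE₁ k B E₁ E₂ (P (Forms.reducedContraction _ (H q) w)) = q
    rw [hH, hP₁, toE₁_ofE₁]
  have hcongr : ∀ Θ Δ : DoubleDer (ofR E₁ E₂ f) (part k B E₁ E₂) (-1),
      (∀ e, Θ.toLin (ofE₁ k B E₁ E₂ e) = Δ.toLin (ofE₁ k B E₁ E₂ e)) → Φ Θ = Φ Δ := by
    intro Θ Δ h
    refine congrArg (toE₁ k B E₁ E₂) (Forms.reducedContraction_congr _ hP₀ (fun n hn a ha => ?_) hw)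
    obtain rfl | rfl : n = 0 ∨ n = 1 := by omega
    · rw [← ofB_toB ha, doubleDer_ofB (by norm_num), doubleDer_ofB (by norm_num)]
    · rw [← ofE₁_toE₁ ha, h]
  -- By symmetry the hypothesis says that `H q` and `H q'` agree on `E₁`, so `Φ` identifies `q` with
  -- `q'`.
  have hinj : ∀ q q', (∀ p, pairing (H p) q = pairing (H p) q') → q = q' := by
    intro q q' h
    rw [← hΦH q, ← hΦH q']
    refine hcongr _ _ fun e => ?_
    rw [← inclBB_pairing, ← inclBB_pairing, hsymm, h, ← hsymm]
  obtain ⟨n, e, ε, hε⟩ := exists_dual_basis (S := Env k B) (M := E₁)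
  -- The dual basis functionals, read as outer bimodule maps into `B ⊗ B`, extend to double
  -- derivations `Ψ i` of weight -1.
  let ψ : Fin n → E₁ →ₗ[k] B ⊗[k] B := fun i =>
    (envEquiv k B).toLinearMap ∘ₗ (ε i).restrictScalars k
  have hψ : ∀ i, ∃ Θ : DoubleDer (ofR E₁ E₂ f) (part k B E₁ E₂) (-1),
      ∀ x, Θ.toLin (ofE₁ k B E₁ E₂ x) = inclBB k B E₁ E₂ (ψ i x) := fun i =>
    exists_doubleDer_extension (ψ i)
      (fun b x => by
        change envEquiv k B (ε i (Env.mk k b 1 • x)) = _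
        rw [map_smul, smul_eq_mul, envEquiv_mul_left]; rfl)
      (fun b x => by
        change envEquiv k B (ε i (Env.mk k 1 b • x)) = _
        rw [map_smul, smul_eq_mul, envEquiv_mul_right]; rfl)
  choose Ψ hΨ using hψ
  -- On `E₁`, `H p` agrees with the sum of the `Ψ i` under the inner action of `⟨p, eᵢ⟩`. Applying
  -- `Φ` to both gives the expansion of `p`.
  have hexp : ∀ p, p = ∑ i, oppAct k E₁ (pairing (H p) (e i)) (Φ (Ψ i)) := by
    intro p
    choose Δ hΔ hΔ' using fun i =>
      exists_doubleDer_inclBB (w := w) hP (Ψ i) (pairing (H p) (e i))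
    obtain ⟨Λ, hΛ, hΛ'⟩ := exists_doubleDer_sum (ofR_mem E₁ E₂ f) Finset.univ Δ
    have h1 : Φ (H p) = Φ Λ := hcongr _ _ fun x => by
      rw [hΛ, LinearMap.sum_apply, ← inclBB_pairing]
      conv_lhs => rw [← hε x, map_sum, map_sum]
      refine Finset.sum_congr rfl fun i _ => ?_
      rw [hΔ, hΨ, outer_map_smul (pairing_lact (H p)) (pairing_ract (H p))]
      exact (innerAct_map (ofB k B E₁ E₂) _ _).symm
    rw [hΦH] at h1
    conv_lhs => rw [h1]
    change toE₁ k B E₁ E₂ (P (Forms.reducedContraction _ Λ w)) = _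
    rw [hΛ', map_sum, map_sum]
    exact Finset.sum_congr rfl fun i _ => hΔ' i
  -- Applying the inner-linear `φ` to the expansion of `p` gives a sum of terms linear in `⟨p, eᵢ⟩`.
  -- Outer linearity of `⟨p, -⟩` collects them into one pairing with the displayed element.
  have hq : ∀ p, pairing (H p) (∑ i, (envEquiv k B).symm (φ (Φ (Ψ i))) • e i) = φ p := fun p => by
    conv_rhs => rw [hexp p, map_sum]
    rw [map_sum]
    refine Finset.sum_congr rfl fun i _ => ?_
    rw [outer_map_smul (pairing_lact (H p)) (pairing_ract (H p)), LinearEquiv.apply_symm_apply,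
      inner_map_oppAct hl hr]
  exact ⟨_, hq, fun q h => hinj _ _ fun p => (h p).trans (hq p).symm⟩

end TAlg

end WeightTwo

end Nondegeneracy

/-! ### Projections to `B` and `E₁`, and compatibility with flips and actions -/

section Components

variable {k : Type*} [Field k] [CharZero k]
variable {B : Type*} [Ring B] [Algebra k B]

/-- After the middle factor is moved to the front, evaluating coordinate functionals of a basis of
`B` gives the coordinates of the tensor. -/
theorem eq_zero_of_midEval {t : B ⊗[k] (B ⊗[k] B)} (h : ∀ l : B →ₗ[k] k, midEval l t = 0) :
    t = 0 := by
  classical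
  have key : ∀ (l : B →ₗ[k] k) (t : B ⊗[k] (B ⊗[k] B)),
      TensorProduct.lid k _ (l.rTensor _ (TensorProduct.leftComm k B B B t)) = midEval l t := by
    intro l t
    induction t with
    | zero => simp
    | add x y hx hy => simp only [map_add, hx, hy]
    | tmul x s =>
      induction s with
      | zero => simp
      | add y z hy hz => simp only [TensorProduct.tmul_add, map_add, hy, hz]
      | tmul m z => simp [midEval_tmul]
  apply (TensorProduct.leftComm k B B B).injective
  rw [map_zero]
  apply (TensorProduct.equivFinsuppOfBasisLeft (Module.Basis.ofVectorSpace k B)).injective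
  ext i
  rw [TensorProduct.equivFinsuppOfBasisLeft_apply, key, h]
  simp

theorem comm_left_mul (b : B) (t : B ⊗[k] B) : TensorProduct.comm k B B ((b ⊗ₜ 1) * t) =
    (1 ⊗ₜ b) * TensorProduct.comm k B B t := by
  induction t with
  | zero => simp
  | add x y hx hy => simp only [mul_add, map_add, hx, hy]
  | tmul x y => simp

theorem comm_mul_right (b : B) (t : B ⊗[k] B) : TensorProduct.comm k B B (t * (1 ⊗ₜ b)) =
    TensorProduct.comm k B B t * (b ⊗ₜ 1) := by
  induction t with
  | zero => simp
  | add x y hx hy => simp only [add_mul, map_add, hx, hy]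
  | tmul x y => simp

section Mixed

variable {E : Type*} [AddCommGroup E] [Module k E] [Module (Env k B) E]
  [IsScalarTower k (Env k B) E]

namespace Mixed

theorem flip_flip (t : Mixed k B E) : Mixed.flip (Mixed.flip t) = t := by
  obtain ⟨s, t⟩ := t
  simp [Mixed.flip]

theorem linearMap_ext {V : Type*} [AddCommGroup V] [Module k V] {g h : Mixed k B E →ₗ[k] V}
    (h₁ : ∀ e b, g (e ⊗ₜ b, 0) = h (e ⊗ₜ b, 0)) (h₂ : ∀ b e, g (0, b ⊗ₜ e) = h (0, b ⊗ₜ e)) :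
    g = h := by
  apply LinearMap.prod_ext
  · exact TensorProduct.ext' h₁
  · exact TensorProduct.ext' h₂

theorem flip_outerLeft (b : B) (t : Mixed k B E) :
    Mixed.flip (Mixed.outerLeft b t) = Mixed.innerLeft b (Mixed.flip t) := by
  have : (Mixed.flip : Mixed k B E →ₗ[k] Mixed k B E) ∘ₗ Mixed.outerLeft b =
      Mixed.innerLeft b ∘ₗ Mixed.flip :=
    linearMap_ext (fun _ _ => by simp [Mixed.flip, Mixed.outerLeft, Mixed.innerLeft])
      (fun _ _ => by simp [Mixed.flip, Mixed.outerLeft, Mixed.innerLeft])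
  exact LinearMap.congr_fun this t

theorem flip_outerRight (b : B) (t : Mixed k B E) :
    Mixed.flip (Mixed.outerRight b t) = Mixed.innerRight b (Mixed.flip t) := by
  have : (Mixed.flip : Mixed k B E →ₗ[k] Mixed k B E) ∘ₗ Mixed.outerRight b =
      Mixed.innerRight b ∘ₗ Mixed.flip :=
    linearMap_ext (fun _ _ => by simp [Mixed.flip, Mixed.outerRight, Mixed.innerRight])
      (fun _ _ => by simp [Mixed.flip, Mixed.outerRight, Mixed.innerRight])
  exact LinearMap.congr_fun this t

end Mixed

end Mixed

variable {E₁ : Type*} [AddCommGroup E₁] [Module k E₁] [Module (Env k B) E₁]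
  [IsScalarTower k (Env k B) E₁]
variable {E₂ : Type*} [AddCommGroup E₂] [Module k E₂] [Module (Env k B) E₂]
  [IsScalarTower k (Env k B) E₂]

namespace TAlg

theorem toBB_tmul (x y : TAlg k B E₁ E₂) :
    toBB k B E₁ E₂ (x ⊗ₜ y) = toB k B E₁ E₂ x ⊗ₜ toB k B E₁ E₂ y := rfl

theorem toMixed_tmul (x y : TAlg k B E₁ E₂) : toMixed k B E₁ E₂ (x ⊗ₜ y) =
    (toE₁ k B E₁ E₂ x ⊗ₜ toB k B E₁ E₂ y, toB k B E₁ E₂ x ⊗ₜ toE₁ k B E₁ E₂ y) := rfl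

theorem toBB_mul (s t : TAlg k B E₁ E₂ ⊗[k] TAlg k B E₁ E₂) :
    toBB k B E₁ E₂ (s * t) = toBB k B E₁ E₂ s * toBB k B E₁ E₂ t :=
  map_mul (Algebra.TensorProduct.map (toB k B E₁ E₂) (toB k B E₁ E₂)) s t

theorem sgn_smul_toB_tmul {V : Type*} [AddCommGroup V] [Module k V] {m n : ℕ}
    {x : TAlg k B E₁ E₂} (hx : x ∈ part k B E₁ E₂ m) (v : V) :
    sgn k (m * n) • (toB k B E₁ E₂ x ⊗ₜ[k] v) = toB k B E₁ E₂ x ⊗ₜ v := by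
  rcases Nat.eq_zero_or_pos m with rfl | hm
  · simp [sgn_zero]
  · rw [toB_of_pos m hm x hx]; simp

theorem toBB_gradedFlip (t : TAlg k B E₁ E₂ ⊗[k] TAlg k B E₁ E₂) :
    toBB k B E₁ E₂ (gradedFlip (part k B E₁ E₂) t) =
      TensorProduct.comm k B B (toBB k B E₁ E₂ t) := by
  induction t using graded_tensor_induction (𝒜 := part k B E₁ E₂) with
  | h0 => simp
  | hadd x y hx hy => simp only [map_add, hx, hy]
  | h m n x hx y hy =>
    rw [gradedFlip_tmul hx hy, map_smul, toBB_tmul, toBB_tmul, mul_comm, sgn_smul_toB_tmul hy,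
      TensorProduct.comm_tmul]

/-- In each component one factor is projected to `B`, which kills it unless its weight is 0. The
Koszul sign is then trivial, so the graded flip becomes the plain one. -/
theorem toMixed_gradedFlip (t : TAlg k B E₁ E₂ ⊗[k] TAlg k B E₁ E₂) :
    toMixed k B E₁ E₂ (gradedFlip (part k B E₁ E₂) t) =
      Mixed.flip (toMixed k B E₁ E₂ t) := by
  induction t using graded_tensor_induction (𝒜 := part k B E₁ E₂) with
  | h0 => simp
  | hadd x y hx hy => simp only [map_add, hx, hy]
  | h m n x hx y hy =>
    rw [gradedFlip_tmul hx hy, map_smul, toMixed_tmul, toMixed_tmul, Prod.smul_mk]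
    refine Prod.ext ?_ ?_
    · change sgn k (m * n) • (toE₁ k B E₁ E₂ y ⊗ₜ[k] toB k B E₁ E₂ x) = _
      rw [← TensorProduct.tmul_smul]
      rcases Nat.eq_zero_or_pos m with rfl | hm
      · simp [sgn_zero, Mixed.flip]
      · rw [toB_of_pos m hm x hx]; simp [Mixed.flip]
    · change sgn k (m * n) • (toB k B E₁ E₂ y ⊗ₜ[k] toE₁ k B E₁ E₂ x) = _
      rw [mul_comm, sgn_smul_toB_tmul hy]
      rfl

theorem toE₁_base_mul (b : B) (x : TAlg k B E₁ E₂) :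
    toE₁ k B E₁ E₂ (ofB k B E₁ E₂ b * x) = lact k b (toE₁ k B E₁ E₂ x) := by
  rw [toE₁_mul, toE₁_ofB, toB_ofB]; simp

theorem toE₁_mul_base (b : B) (x : TAlg k B E₁ E₂) :
    toE₁ k B E₁ E₂ (x * ofB k B E₁ E₂ b) = ract k b (toE₁ k B E₁ E₂ x) := by
  rw [toE₁_mul, toE₁_ofB, toB_ofB]; simp

theorem toE₁_ofE₁_mul (e : E₁) (x : TAlg k B E₁ E₂) :
    toE₁ k B E₁ E₂ (ofE₁ k B E₁ E₂ e * x) = ract k (toB k B E₁ E₂ x) e := by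
  rw [toE₁_mul, toE₁_ofE₁, toB_ofE₁, lact_zero, add_zero]

theorem toE₁_mul_ofE₁ (e : E₁) (x : TAlg k B E₁ E₂) :
    toE₁ k B E₁ E₂ (x * ofE₁ k B E₁ E₂ e) = lact k (toB k B E₁ E₂ x) e := by
  rw [toE₁_mul, toE₁_ofE₁, toB_ofE₁, show ract k (0 : B) (toE₁ k B E₁ E₂ x) = 0 from
    map_zero (ractOn _), zero_add]

theorem toMixed_base_mul (b : B) (t : TAlg k B E₁ E₂ ⊗[k] TAlg k B E₁ E₂) :
    toMixed k B E₁ E₂ ((ofB k B E₁ E₂ b ⊗ₜ 1) * t) =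
      Mixed.outerLeft b (toMixed k B E₁ E₂ t) := by
  induction t with
  | zero => simp
  | add x y hx hy => simp only [mul_add, map_add, hx, hy]
  | tmul x y =>
    rw [Algebra.TensorProduct.tmul_mul_tmul, one_mul, toMixed_tmul, toMixed_tmul, toE₁_base_mul,
      map_mul, toB_ofB]
    rfl

theorem toMixed_mul_base (b : B) (t : TAlg k B E₁ E₂ ⊗[k] TAlg k B E₁ E₂) :
    toMixed k B E₁ E₂ (t * (1 ⊗ₜ ofB k B E₁ E₂ b)) =
      Mixed.outerRight b (toMixed k B E₁ E₂ t) := by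
  induction t with
  | zero => simp
  | add x y hx hy => simp only [add_mul, map_add, hx, hy]
  | tmul x y =>
    rw [Algebra.TensorProduct.tmul_mul_tmul, mul_one, toMixed_tmul, toMixed_tmul, toE₁_mul_base,
      map_mul, toB_ofB]
    rfl

/-- The second factor ends in `e`, so its projection to `B` vanishes and only the component in `B ⊗
E₁` remains. -/
theorem toMixed_mul_ofE₁ (e : E₁) (t : TAlg k B E₁ E₂ ⊗[k] TAlg k B E₁ E₂) :
    toMixed k B E₁ E₂ (t * (1 ⊗ₜ ofE₁ k B E₁ E₂ e)) = Mixed.mulVec e (toBB k B E₁ E₂ t) := by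
  induction t with
  | zero => simp
  | add x y hx hy => simp only [add_mul, map_add, hx, hy]
  | tmul x y =>
    rw [Algebra.TensorProduct.tmul_mul_tmul, mul_one, toMixed_tmul, toE₁_mul_ofE₁, toBB_tmul,
      map_mul, toB_ofE₁, mul_zero, TensorProduct.tmul_zero]
    rfl

theorem toMixed_ofE₁_mul (e : E₁) (t : TAlg k B E₁ E₂ ⊗[k] TAlg k B E₁ E₂) :
    toMixed k B E₁ E₂ ((ofE₁ k B E₁ E₂ e ⊗ₜ 1) * t) = Mixed.vecMul e (toBB k B E₁ E₂ t) := by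
  induction t with
  | zero => simp
  | add x y hx hy => simp only [mul_add, map_add, hx, hy]
  | tmul x y =>
    rw [Algebra.TensorProduct.tmul_mul_tmul, one_mul, toMixed_tmul, toE₁_ofE₁_mul, toBB_tmul,
      map_mul, toB_ofE₁, zero_mul, TensorProduct.zero_tmul]
    rfl

variable (k B E₁ E₂) in
/-- The projection `A ⊗ A ⊗ A → B ⊗ B ⊗ B`. -/
def toBBB : TAlg k B E₁ E₂ ⊗[k] (TAlg k B E₁ E₂ ⊗[k] TAlg k B E₁ E₂) →ₗ[k]
    B ⊗[k] (B ⊗[k] B) :=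
  TensorProduct.map (toB k B E₁ E₂).toLinearMap (toBB k B E₁ E₂)

theorem toBB_midEval (l : B →ₗ[k] k)
    (t : TAlg k B E₁ E₂ ⊗[k] (TAlg k B E₁ E₂ ⊗[k] TAlg k B E₁ E₂)) :
    toBB k B E₁ E₂ (midEval (l ∘ₗ (toB k B E₁ E₂).toLinearMap) t) =
      midEval l (toBBB k B E₁ E₂ t) := by
  induction t with
  | zero => simp
  | add x y hx hy => simp only [map_add, hx, hy]
  | tmul x s =>
    induction s with
    | zero => simp
    | add y z hy hz => simp only [TensorProduct.tmul_add, map_add, hy, hz]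
    | tmul m z =>
      rw [midEval_tmul, map_smul, toBB_tmul, toBBB, TensorProduct.map_tmul, toBB_tmul, midEval_tmul]
      rfl

/-- With `X` the Hamiltonian double derivation of `{S, e}`, this identifies one term of the Jacobi
identity with the left side of axiom (d). -/
theorem toBBB_actFirst {X : TAlg k B E₁ E₂ →ₗ[k] TAlg k B E₁ E₂ ⊗[k] TAlg k B E₁ E₂}
    {θ : B →ₗ[k] B ⊗[k] B} (hX : ∀ b, toBB k B E₁ E₂ (X (ofB k B E₁ E₂ b)) = θ b)
    (t : B ⊗[k] B) :
    toBBB k B E₁ E₂ (actFirst X (inclBB k B E₁ E₂ t)) = extendFirst θ t := by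
  induction t with
  | zero => simp
  | add x y hx hy => simp only [map_add, hx, hy]
  | tmul x y =>
    have key : ∀ s : TAlg k B E₁ E₂ ⊗[k] TAlg k B E₁ E₂,
        toBBB k B E₁ E₂ (TensorProduct.assoc k _ _ _ (s ⊗ₜ ofB k B E₁ E₂ y)) =
          TensorProduct.assoc k B B B (toBB k B E₁ E₂ s ⊗ₜ y) := by
      intro s
      induction s with
      | zero => simp
      | add u v hu hv => simp only [TensorProduct.add_tmul, map_add, hu, hv]
      | tmul u v =>
        rw [TensorProduct.assoc_tmul, toBBB, TensorProduct.map_tmul, toBB_tmul, toBB_tmul, toB_ofB]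
        rfl
    refine (key _).trans ?_
    exact congrArg (fun s => TensorProduct.assoc k B B B (s ⊗ₜ[k] y)) (hX x)

/-- Pairing the first component of `m` with a functional. -/
theorem ofE₁_fst_lastEval (l : B →ₗ[k] k) (m : Mixed k B E₁) :
    lastEval (l ∘ₗ (toB k B E₁ E₂).toLinearMap) (inclMixed k B E₁ E₂ m) =
      ofE₁ k B E₁ E₂ (TensorProduct.rid k E₁ (l.lTensor E₁ m.1)) := by
  have : lastEval (l ∘ₗ (toB k B E₁ E₂).toLinearMap) ∘ₗ inclMixed k B E₁ E₂ =
      ofE₁ k B E₁ E₂ ∘ₗ (TensorProduct.rid k E₁).toLinearMap ∘ₗ l.lTensor E₁ ∘ₗ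
        LinearMap.fst k _ _ := by
    refine Mixed.linearMap_ext (fun e b => ?_) (fun b e => ?_)
    · change lastEval _ (inclMixed k B E₁ E₂ (e ⊗ₜ b, 0)) =
        ofE₁ k B E₁ E₂ (TensorProduct.rid k E₁ (l.lTensor E₁ (e ⊗ₜ b)))
      rw [inclMixed, LinearMap.coprod_apply, map_zero, add_zero, TensorProduct.map_tmul,
        lastEval_tmul]
      change l (toB k B E₁ E₂ (ofB k B E₁ E₂ b)) • _ = _
      rw [toB_ofB]
      simp
    · change lastEval _ (inclMixed k B E₁ E₂ (0, b ⊗ₜ e)) =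
        ofE₁ k B E₁ E₂ (TensorProduct.rid k E₁ (l.lTensor E₁ 0))
      rw [inclMixed, LinearMap.coprod_apply, map_zero, zero_add, TensorProduct.map_tmul,
        lastEval_tmul]
      change l (toB k B E₁ E₂ (ofE₁ k B E₁ E₂ e)) • _ = _
      rw [toB_ofE₁]
      simp
  exact LinearMap.congr_fun this m

end TAlg

/-- `⟨-, e⟩_L` followed by a functional on the middle factor. -/
theorem InnerProduct.midEval_pairL (P : InnerProduct k B E₁) (l : B →ₗ[k] k) (e : E₁)
    (m : Mixed k B E₁) : midEval l (P.pairL e m) =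
      P.toLin (TensorProduct.rid k E₁ (l.lTensor E₁ m.1)) e := by
  have : midEval l ∘ₗ P.pairL e = P.toLin.flip e ∘ₗ (TensorProduct.rid k E₁).toLinearMap ∘ₗ
      l.lTensor E₁ ∘ₗ LinearMap.fst k _ _ := by
    refine Mixed.linearMap_ext (fun u b => ?_) (fun b u => by simp [InnerProduct.pairL])
    change midEval l (P.pairL e (u ⊗ₜ b, 0)) =
      P.toLin (TensorProduct.rid k E₁ (l.lTensor E₁ (u ⊗ₜ b))) e
    simp only [InnerProduct.pairL, LinearMap.comp_apply, LinearMap.fst_apply,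
      TensorProduct.map_tmul, LinearMap.flip_apply, LinearMap.id_apply, LinearMap.lTensor_tmul,
      TensorProduct.rid_tmul, map_smul, LinearMap.smul_apply]
    generalize P.toLin u e = t
    induction t with
    | zero => simp
    | add x y hx hy => simp only [TensorProduct.add_tmul, map_add, hx, hy, smul_add]
    | tmul x y => simp [midEval_tmul]
  exact LinearMap.congr_fun this m

end Components

/-! ### Construction of the double pre-Courant algebroid -/

section Construction

variable {k : Type*} [Field k] [CharZero k]
variable {B : Type*} [Ring B] [Algebra k B]
variable {E₁ : Type*} [AddCommGroup E₁] [Module k E₁] [Module (Env k B) E₁]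
  [IsScalarTower k (Env k B) E₁]
variable {E₂ : Type*} [AddCommGroup E₂] [Module k E₂] [Module (Env k B) E₂]
  [IsScalarTower k (Env k B) E₂]
variable {R : Type*} [Ring R] [Algebra k R] {f : R →ₐ[k] B}

open TAlg

theorem DoubleDer.toDer_leibniz {A : Type*} [Ring A] [Algebra k A] {g : R →ₐ[k] A}
    {𝒜 : ℕ → Submodule k A} [GradedAlgebra 𝒜] {d : ℤ} (Θ : DoubleDer g 𝒜 d) {n : ℕ} {a : A}
    (ha : a ∈ 𝒜 n) (b : A) :
    Θ.toDer (a * b) = Θ.toDer a * b + sgn k (d * n) • (a * Θ.toDer b) := by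
  have h1 : ∀ (t : A ⊗[k] A) (c : A), LinearMap.mul' k A (t * (1 ⊗ₜ c)) =
      LinearMap.mul' k A t * c := by
    intro t c
    induction t with
    | zero => simp
    | add x y hx hy => simp only [add_mul, map_add, hx, hy]
    | tmul x y => simp [mul_assoc]
  have h2 : ∀ (t : A ⊗[k] A) (c : A), LinearMap.mul' k A ((c ⊗ₜ 1) * t) =
      c * LinearMap.mul' k A t := by
    intro t c
    induction t with
    | zero => simp
    | add x y hx hy => simp only [mul_add, map_add, hx, hy]
    | tmul x y => simp [mul_assoc]
  simp only [DoubleDer.toDer, LinearMap.comp_apply, Θ.leibniz n a ha b, map_add, map_smul, h1, h2]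

/-- Hamiltonian double derivations, with respect to `w`, of the elements of `B` and `E₁`, of `S`
and of the elements `{S, e}` for `e ∈ E₁`. -/
structure Hamiltonians (w : Forms (ofR E₁ E₂ f)) (S : TAlg k B E₁ E₂) where
  mem : w ∈ Forms.homog _ (part k B E₁ E₂) 2 2
  closed : Forms.d _ w ∈ Forms.commutators _ (part k B E₁ E₂)
  inj : ∀ (d : ℤ) (Θ Δ : DoubleDer (ofR E₁ E₂ f) (part k B E₁ E₂) d),
    Forms.reducedContraction (ofR_mem E₁ E₂ f) Θ w =
      Forms.reducedContraction (ofR_mem E₁ E₂ f) Δ w → Θ = Δ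
  /-- The Hamiltonian double derivations of the elements of `B`. -/
  HB : B → DoubleDer (ofR E₁ E₂ f) (part k B E₁ E₂) (-2)
  hHB : ∀ b, Forms.reducedContraction (ofR_mem E₁ E₂ f) (HB b) w = Forms.δ _ (ofB k B E₁ E₂ b)
  /-- The Hamiltonian double derivations of the elements of `E₁`. -/
  HE : E₁ → DoubleDer (ofR E₁ E₂ f) (part k B E₁ E₂) (-1)
  hHE : ∀ e, Forms.reducedContraction (ofR_mem E₁ E₂ f) (HE e) w = Forms.δ _ (ofE₁ k B E₁ E₂ e)
  /-- The Hamiltonian double derivation of `S`. -/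
  HS : DoubleDer (ofR E₁ E₂ f) (part k B E₁ E₂) 1
  hHS : Forms.reducedContraction (ofR_mem E₁ E₂ f) HS w = Forms.δ _ S
  /-- The Hamiltonian double derivations of the elements `{S, e}`. -/
  HT : E₁ → DoubleDer (ofR E₁ E₂ f) (part k B E₁ E₂) 0
  hHT : ∀ e, Forms.reducedContraction (ofR_mem E₁ E₂ f) (HT e) w =
    Forms.δ _ (HS.toDer (ofE₁ k B E₁ E₂ e))

namespace Hamiltonians

variable {w : Forms (ofR E₁ E₂ f)} {S : TAlg k B E₁ E₂} (h : Hamiltonians w S)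

/-- Injectivity of `Θ ↦ ι_Θ w` for weights such as `1 + -1` and `0`, which are equal without being
the same index. -/
theorem toLin_eq (h : Hamiltonians w S) {d d' : ℤ} (hd : d = d')
    {Θ : DoubleDer (ofR E₁ E₂ f) (part k B E₁ E₂) d}
    {Δ : DoubleDer (ofR E₁ E₂ f) (part k B E₁ E₂) d'}
    (he : Forms.reducedContraction (ofR_mem E₁ E₂ f) Θ w =
      Forms.reducedContraction (ofR_mem E₁ E₂ f) Δ w) : Θ.toLin = Δ.toLin := by
  subst hd
  rw [h.inj _ _ _ he]

theorem toDer_mem {n : ℕ} {x : TAlg k B E₁ E₂} (hx : x ∈ part k B E₁ E₂ n) :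
    h.HS.toDer x ∈ part k B E₁ E₂ (n + 1) := by
  have := mul'_mem_intPart (h.HS.map_weight n x hx)
  rwa [show (n + 1 : ℤ) = ((n + 1 : ℕ) : ℤ) by push_cast; rfl, intPart_natCast] at this

theorem HE_symm (p q : E₁) : (h.HE p).toLin (ofE₁ k B E₁ E₂ q) =
    gradedFlip (part k B E₁ E₂) ((h.HE q).toLin (ofE₁ k B E₁ E₂ p)) := by
  -- The sign exponent is `1 + (-1)(-1) = 2`: the double bracket, skew in general, is symmetric on
  -- `E₁`.
  rw [Forms.skew _ (h.hHE p) (h.hHE q), sgn_of_even (by decide), one_smul]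

theorem HT_ofB (e : E₁) (b : B) : (h.HT e).toLin (ofB k B E₁ E₂ b) =
    -gradedFlip (part k B E₁ E₂) ((h.HB b).toLin (h.HS.toDer (ofE₁ k B E₁ E₂ e))) := by
  rw [Forms.skew _ (h.hHT e) (h.hHB b), sgn_of_not_even (by decide), neg_smul, one_smul]

theorem HT_ofE₁ (e q : E₁) : (h.HT e).toLin (ofE₁ k B E₁ E₂ q) =
    -gradedFlip (part k B E₁ E₂) ((h.HE q).toLin (h.HS.toDer (ofE₁ k B E₁ E₂ e))) := by
  rw [Forms.skew _ (h.hHT e) (h.hHE q), sgn_of_not_even (by decide), neg_smul, one_smul]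

theorem toDer_lact (b : B) (e : E₁) : h.HS.toDer (ofE₁ k B E₁ E₂ (lact k b e)) =
    h.HS.toDer (ofB k B E₁ E₂ b) * ofE₁ k B E₁ E₂ e +
      ofB k B E₁ E₂ b * h.HS.toDer (ofE₁ k B E₁ E₂ e) := by
  rw [ofE₁_lact, h.HS.toDer_leibniz (ofB_mem b)]
  simp [sgn_zero]

/-- The minus sign comes from the odd derivation `{S, -}` passing `e`, which has weight 1. -/
theorem toDer_ract (b : B) (e : E₁) : h.HS.toDer (ofE₁ k B E₁ E₂ (ract k b e)) =
    h.HS.toDer (ofE₁ k B E₁ E₂ e) * ofB k B E₁ E₂ b -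
      ofE₁ k B E₁ E₂ e * h.HS.toDer (ofB k B E₁ E₂ b) := by
  rw [ofE₁_ract, h.HS.toDer_leibniz (ofE₁_mem e), Nat.cast_one, one_mul, sgn_one, neg_smul,
    one_smul, sub_eq_add_neg]

theorem toDer_base (r : R) : h.HS.toDer (ofB k B E₁ E₂ (f r)) = 0 := by
  rw [DoubleDer.toDer, LinearMap.comp_apply]
  exact (congrArg _ (h.HS.map_base r)).trans (map_zero _)

theorem HB_of_mem_one (b : B) {x : TAlg k B E₁ E₂} (hx : x ∈ part k B E₁ E₂ 1) :
    (h.HB b).toLin x = 0 :=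
  eq_zero_of_mem_tensorPart (by norm_num) ((h.HB b).map_weight 1 x hx)

/-- The symmetric pairing `⟨p, q⟩ = ⦃p, q⦄`. -/
def innerProduct [Module.Finite (Env k B) E₁] [Module.Projective (Env k B) E₁] :
    InnerProduct k B E₁ :=
  -- The `HE p` are chosen one by one, so nothing is known directly about dependence on `p`.
  -- Symmetry transfers linearity from the second argument to the first.
  have hsymm : ∀ p q, pairing (h.HE p) q = TensorProduct.comm k B B (pairing (h.HE q) p) :=
    fun p q => by
      rw [pairing, LinearMap.comp_apply, LinearMap.comp_apply, h.HE_symm, toBB_gradedFlip]; rfl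
  { toLin := LinearMap.mk₂ k (fun p q => pairing (h.HE p) q)
      (fun p p' q => by rw [hsymm, hsymm p, hsymm p', map_add, map_add])
      (fun c p q => by rw [hsymm, hsymm p, map_smul, map_smul])
      (fun p q q' => map_add _ _ _)
      (fun c p q => map_smul _ _ _)
    outer_left := fun p b q => pairing_lact (h.HE p) b q
    outer_right := fun p b q => pairing_ract (h.HE p) b q
    inner_left := fun p b q => by
      rw [LinearMap.mk₂_apply, LinearMap.mk₂_apply, hsymm, hsymm p, pairing_lact, comm_left_mul]
    inner_right := fun p b q => by
      rw [LinearMap.mk₂_apply, LinearMap.mk₂_apply, hsymm, hsymm p, pairing_ract, comm_mul_right]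
    symm := hsymm
    nondegenerate := fun φ hl hr => pairing_nondegenerate h.mem h.hHE hsymm φ hl hr }

theorem innerProduct_apply [Module.Finite (Env k B) E₁] [Module.Projective (Env k B) E₁]
    (p q : E₁) : h.innerProduct.toLin p q = pairing (h.HE p) q := rfl

/-- The anchor on elements. -/
def anchorMap (e : E₁) : B →ₗ[k] B ⊗[k] B :=
  toBB k B E₁ E₂ ∘ₗ (h.HT e).toLin ∘ₗ (ofB k B E₁ E₂).toLinearMap

theorem anchorMap_apply (e : E₁) (b : B) :
    h.anchorMap e b = toBB k B E₁ E₂ ((h.HT e).toLin (ofB k B E₁ E₂ b)) := rfl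

/-- Skew-symmetry moves `{S, e}` into the argument of a fixed double derivation, where linearity in
`e` and the inner actions become visible. The same device serves `bracketMap`. -/
theorem anchorMap_eq (e : E₁) (b : B) : h.anchorMap e b = -TensorProduct.comm k B B
    (toBB k B E₁ E₂ ((h.HB b).toLin (h.HS.toDer (ofE₁ k B E₁ E₂ e)))) := by
  rw [anchorMap_apply, HT_ofB, map_neg, toBB_gradedFlip]

/-- The anchor `ρ(e)(b) = ⦃{S, e}, b⦄`. -/
def anchor : Anchor f E₁ where
  toLin := LinearMap.mk₂ k (fun e b => h.anchorMap e b)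
    (fun e e' b => by simp only [anchorMap_eq, map_add, neg_add])
    (fun c e b => by simp only [anchorMap_eq, map_smul, smul_neg])
    (fun e b b' => map_add _ _ _)
    (fun c e b => map_smul _ _ _)
  leibniz e b c := by
    simp only [LinearMap.mk₂_apply, anchorMap_apply]
    rw [map_mul (ofB k B E₁ E₂), (h.HT e).leibniz 0 _ (ofB_mem b), map_add, map_smul, toBB_mul,
      toBB_mul, toBB_tmul, toBB_tmul, toB_ofB, toB_ofB, map_one]
    simp [sgn_zero]
  map_base e r := by
    simp only [LinearMap.mk₂_apply, anchorMap_apply]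
    exact (congrArg _ ((h.HT e).map_base r)).trans (map_zero _)
  inner_left b e c := by
    simp only [LinearMap.mk₂_apply, anchorMap_eq]
    -- `{S, be} = {S, b}e + b{S, e}`, and the double derivation of `c`, of weight -2, kills `{S, b}`
    -- and `e`, both of weight 1. Only `b` times the value at `{S, e}` remains.
    rw [toDer_lact, map_add, (h.HB c).leibniz 1 _ (h.toDer_mem (ofB_mem b)),
      (h.HB c).leibniz 0 _ (ofB_mem b), h.HB_of_mem_one c (h.toDer_mem (ofB_mem b)),
      h.HB_of_mem_one c (ofE₁_mem e), doubleDer_ofB (by norm_num)]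
    simp only [zero_mul, mul_zero, smul_zero, zero_add, map_smul, toBB_mul, toBB_tmul, toB_ofB,
      map_one, comm_left_mul]
    simp [sgn_zero]
  inner_right b e c := by
    simp only [LinearMap.mk₂_apply, anchorMap_eq]
    rw [toDer_ract, map_sub, (h.HB c).leibniz 1 _ (ofE₁_mem e),
      (h.HB c).leibniz 2 _ (h.toDer_mem (ofE₁_mem e)),
      h.HB_of_mem_one c (h.toDer_mem (ofB_mem b)),
      h.HB_of_mem_one c (ofE₁_mem e), doubleDer_ofB (by norm_num)]
    simp only [zero_mul, mul_zero, smul_zero, zero_add, add_zero, sub_zero, toBB_mul, toBB_tmul,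
      toB_ofB, map_one, comm_mul_right, neg_mul]

theorem anchor_apply (e : E₁) (b : B) :
    h.anchor.toLin e b = toBB k B E₁ E₂ ((h.HT e).toLin (ofB k B E₁ E₂ b)) := rfl

theorem inclBB_anchor (e : E₁) (b : B) : inclBB k B E₁ E₂ (h.anchor.toLin e b) =
    (h.HT e).toLin (ofB k B E₁ E₂ b) :=
  inclBB_toBB (by simpa using (h.HT e).map_weight 0 _ (ofB_mem b))

/-- The bracket on elements. -/
def bracketMap (e : E₁) : E₁ →ₗ[k] Mixed k B E₁ :=
  toMixed k B E₁ E₂ ∘ₗ (h.HT e).toLin ∘ₗ ofE₁ k B E₁ E₂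

theorem bracketMap_apply (e q : E₁) :
    h.bracketMap e q = toMixed k B E₁ E₂ ((h.HT e).toLin (ofE₁ k B E₁ E₂ q)) := rfl

theorem bracketMap_eq (e q : E₁) : h.bracketMap e q = -Mixed.flip
    (toMixed k B E₁ E₂ ((h.HE q).toLin (h.HS.toDer (ofE₁ k B E₁ E₂ e)))) := by
  rw [bracketMap_apply, HT_ofE₁, map_neg, toMixed_gradedFlip]

/-- The bracket `⟦e, q⟧ = ⦃{S, e}, q⦄`. -/
def bracket : E₁ →ₗ[k] E₁ →ₗ[k] Mixed k B E₁ :=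
  LinearMap.mk₂ k (fun e q => h.bracketMap e q)
    (fun e e' b => by simp only [bracketMap_eq, map_add, neg_add])
    (fun c e b => by simp only [bracketMap_eq, map_smul, smul_neg])
    (fun e b b' => map_add _ _ _)
    (fun c e b => map_smul _ _ _)

theorem bracket_apply (e q : E₁) :
    h.bracket e q = toMixed k B E₁ E₂ ((h.HT e).toLin (ofE₁ k B E₁ E₂ q)) := rfl

theorem bracket_eq (e q : E₁) : h.bracket e q = -Mixed.flip
    (toMixed k B E₁ E₂ ((h.HE q).toLin (h.HS.toDer (ofE₁ k B E₁ E₂ e)))) := h.bracketMap_eq e q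

theorem inclMixed_bracket (e q : E₁) : inclMixed k B E₁ E₂ (h.bracket e q) =
    (h.HT e).toLin (ofE₁ k B E₁ E₂ q) :=
  inclMixed_toMixed (by simpa using (h.HT e).map_weight 1 _ (ofE₁_mem q))

theorem bracket_lact (b : B) (e q : E₁) : h.bracket e (lact k b q) =
    Mixed.mulVec q (h.anchor.toLin e b) + Mixed.outerLeft b (h.bracket e q) := by
  rw [bracket_apply, ofE₁_lact, (h.HT e).leibniz 0 _ (ofB_mem b), map_add, toMixed_mul_ofE₁,
    map_smul, toMixed_base_mul, Nat.cast_zero, mul_zero, sgn_zero, one_smul]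
  rfl

theorem bracket_ract (b : B) (e q : E₁) : h.bracket e (ract k b q) =
    Mixed.vecMul q (h.anchor.toLin e b) + Mixed.outerRight b (h.bracket e q) := by
  rw [bracket_apply, ofE₁_ract, (h.HT e).leibniz 1 _ (ofE₁_mem q), map_add, toMixed_mul_base,
    map_smul, toMixed_ofE₁_mul, zero_mul, sgn_zero, one_smul, add_comm]
  rfl

/-- Scalars from `R` satisfy `{S, f r} = 0`, so the extra term of `toDer_lact` disappears. For
general `b` it need not, since the double derivation of `q` has weight -1 and may be non-zero on
`E₁`. -/
theorem lact_bracket (r : R) (e q : E₁) : h.bracket (lact k (f r) e) q =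
    Mixed.innerLeft (f r) (h.bracket e q) := by
  rw [bracket_eq, bracket_eq, toDer_lact, toDer_base, zero_mul, zero_add,
    (h.HE q).leibniz 0 _ (ofB_mem (f r)), doubleDer_ofB (by norm_num), zero_mul, zero_add,
    Nat.cast_zero, mul_zero, sgn_zero, one_smul, toMixed_base_mul, Mixed.flip_outerLeft, map_neg]

theorem ract_bracket (r : R) (e q : E₁) : h.bracket (ract k (f r) e) q =
    Mixed.innerRight (f r) (h.bracket e q) := by
  rw [bracket_eq, bracket_eq, toDer_ract, toDer_base, mul_zero, sub_zero,
    (h.HE q).leibniz 2 _ (h.toDer_mem (ofE₁_mem e)), doubleDer_ofB (by norm_num), mul_zero,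
    smul_zero, add_zero, toMixed_mul_base, Mixed.flip_outerRight, map_neg]

/-- The Hamiltonian double derivation of `{S, e}` is the bracket of those of `S` and `e`. -/
theorem HT_eq (e : E₁) (a : TAlg k B E₁ E₂) : (h.HT e).toLin a =
    derTensor (weightSign (part k B E₁ E₂) 1) h.HS.toDer ((h.HE e).toLin a) +
      (h.HE e).toLin (h.HS.toDer a) := by
  obtain ⟨Ψ, h1, h2⟩ := exists_hamiltonian_bracket (ofR_mem E₁ E₂ f) h.closed h.hHS (h.hHE e)
  have : (h.HT e).toLin = Ψ.toLin := h.toLin_eq (by norm_num) ((h.hHT e).trans h2.symm)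
  rw [this, h1, sgn_of_not_even (by decide), neg_smul, one_smul, sub_neg_eq_add]

variable [Module.Finite (Env k B) E₁] [Module.Projective (Env k B) E₁]

/-- Apply `{S, -}` to `⦃p, b⦄`, which is 0 for weight reasons. What remains is `⦃{S, p}, b⦄ = ⦃p,
{S, b}⦄`, so `{S, b}` has the defining property of `ρ^∨ d b`. -/
theorem coAnchorD_eq (b : B) : coAnchorD h.innerProduct h.anchor b =
    toE₁ k B E₁ E₂ (h.HS.toDer (ofB k B E₁ E₂ b)) := by
  refine (h.anchor.exists_dual h.innerProduct b).unique
    (fun p => inner_coAnchorD h.innerProduct h.anchor p b) fun p => ?_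
  rw [innerProduct_apply, anchor_apply, HT_eq, doubleDer_ofB (by norm_num), map_zero, zero_add,
    pairing, LinearMap.comp_apply, LinearMap.comp_apply, ofE₁_toE₁ (h.toDer_mem (ofB_mem b))]

theorem toMixed_derTensor (t : B ⊗[k] B) :
    toMixed k B E₁ E₂ (derTensor (weightSign (part k B E₁ E₂) 1) h.HS.toDer
      (inclBB k B E₁ E₂ t)) = coAnchorDTensor h.innerProduct h.anchor t := by
  induction t with
  | zero => simp
  | add x y hx hy => simp only [map_add, hx, hy]
  | tmul x y =>
    have hz : ∀ b, toB k B E₁ E₂ (h.HS.toDer (ofB k B E₁ E₂ b)) = 0 := fun b =>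
      toB_of_pos 1 one_pos _ (h.toDer_mem (ofB_mem b))
    rw [inclBB, TensorProduct.map_tmul, derTensor_tmul, map_add, toMixed_tmul, toMixed_tmul]
    simp only [AlgHom.toLinearMap_apply, weightSign_of_mem _ _ (ofB_mem x), hz, toB_ofB,
      Nat.cast_zero, mul_zero, sgn_zero, one_smul, TensorProduct.zero_tmul,
      TensorProduct.tmul_zero, Prod.mk_add_mk, zero_add, add_zero, ← coAnchorD_eq]
    rfl

/-- From `⦃{S, e}, e⦄ = {S, ⦃e, e⦄} + ⦃e, {S, e}⦄`: by skew-symmetry the last term is minus the flip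
of the left side, and `{S, -}` acts on `⟨e, e⟩` as `ρ^∨ d`. -/
theorem coAnchor_inner (e : E₁) :
    coAnchorDTensor h.innerProduct h.anchor (h.innerProduct.toLin e e) =
      h.bracket e e + Mixed.flip (h.bracket e e) := by
  have h1 := h.bracket_apply e e
  rw [HT_eq, map_add, ← inclBB_pairing, toMixed_derTensor] at h1
  have h2 := congrArg Mixed.flip (h.bracket_eq e e)
  rw [map_neg, Mixed.flip_flip] at h2
  rw [h2, h1, innerProduct_apply]
  abel

/-- `HE e` kills `B`, so the component in `E ⊗ B` contributes nothing, in accordance with the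
definition of `⟨e, -⟩_R`. -/
theorem toBBB_actSecond (e : E₁) (m : Mixed k B E₁) :
    toBBB k B E₁ E₂ (actSecond (weightSign (part k B E₁ E₂) (-1)) (h.HE e).toLin
      (inclMixed k B E₁ E₂ m)) = h.innerProduct.pairR e m := by
  have : toBBB k B E₁ E₂ ∘ₗ actSecond (weightSign (part k B E₁ E₂) (-1)) (h.HE e).toLin ∘ₗ
      inclMixed k B E₁ E₂ = h.innerProduct.pairR e := by
    refine Mixed.linearMap_ext (fun u b => ?_) (fun b u => ?_)
    · simp only [LinearMap.comp_apply, inclMixed, LinearMap.coprod_apply, map_zero, add_zero,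
        TensorProduct.map_tmul, actSecond, AlgHom.toLinearMap_apply]
      rw [doubleDer_ofB (by norm_num)]
      simp [InnerProduct.pairR]
    · simp only [LinearMap.comp_apply, inclMixed, LinearMap.coprod_apply, map_zero, zero_add,
        TensorProduct.map_tmul, actSecond, AlgHom.toLinearMap_apply, toBBB,
        weightSign_of_mem _ _ (ofB_mem b)]
      rw [Nat.cast_zero, mul_zero, sgn_zero, one_smul, toB_ofB]
      rfl
  exact LinearMap.congr_fun this m

theorem anchor_inner (e q : E₁) :
    extendFirst (h.anchor.toLin e) (h.innerProduct.toLin q q) =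
      h.innerProduct.pairL q (h.bracket e q) + h.innerProduct.pairR q (h.bracket e q) := by
  rw [← sub_eq_zero]
  refine eq_zero_of_midEval fun l => ?_
  -- The double Jacobi identity for `{S, e}` and `q`. The function generating `Ψ` is an element `u`
  -- of `E₁`, namely the `E ⊗ B` part of `⟦e, q⟧` with `l` evaluated on `B`. By injectivity `Ψ` is
  -- `HE u`, and its value at `q` is the pairing of `u` with `q`, the `L` term.
  obtain ⟨Ψ, h1, h2⟩ := exists_hamiltonian_midEval (ofR_mem E₁ E₂ f) (π := toB k B E₁ E₂)
    toB_of_pos h.closed h.mem (h.hHT e) (h.hHE q) l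
  rw [← inclMixed_bracket, ofE₁_fst_lastEval] at h2
  have hΨ : (h.HE _).toLin = Ψ.toLin := h.toLin_eq (by norm_num) ((h.hHE _).trans h2.symm)
  have h3 := congrArg (toBB k B E₁ E₂) (h1 (ofE₁ k B E₁ E₂ q))
  rw [← hΨ, map_sub, map_smul, toBB_midEval, toBB_midEval, ← inclBB_pairing, toBB_inclBB,
    ← inclBB_pairing, toBBB_actFirst (θ := h.anchor.toLin e) (fun b => rfl),
    ← inclMixed_bracket, toBBB_actSecond, zero_mul, sgn_zero, one_smul,
    ← innerProduct_apply, ← innerProduct_apply, ← InnerProduct.midEval_pairL] at h3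
  rw [map_sub, map_add, h3]
  abel

/-- The double pre-Courant algebroid attached to `w` and `S`. -/
def doublePreCourant : DoublePreCourant f E₁ where
  finite := inferInstance
  projective := inferInstance
  inner := h.innerProduct
  anchor := h.anchor
  bracket := h.bracket
  bracket_base_left r e₁ e₂ := by rw [bracket_lact, h.anchor.map_base, map_zero, zero_add]
  bracket_base_right r e₁ e₂ := by rw [bracket_ract, h.anchor.map_base, map_zero, zero_add]
  base_left_bracket := h.lact_bracket
  base_right_bracket := h.ract_bracket
  leibniz_left := h.bracket_lact
  leibniz_right := h.bracket_ract
  coAnchor_inner := h.coAnchor_inner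
  anchor_inner := h.anchor_inner

end Hamiltonians

end Construction

/-! ### Comparison with the bracket defined by `ω` -/

section Bracket

variable {k : Type*} [Field k] [CharZero k] {R : Type*} [Ring R] [Algebra k R]
variable {A : Type*} [Ring A] [Algebra k A]
variable {f : R →ₐ[k] A} {𝒜 : ℕ → Submodule k A} [GradedAlgebra 𝒜] {hf : ∀ r, f r ∈ 𝒜 0}
variable {N : ℕ} {ω : DR f 𝒜} (hω : IsBisymplectic hf N ω)

theorem IsBisymplectic.inj (hω : IsBisymplectic hf N ω) {d : ℤ} {Θ Δ : DoubleDer f 𝒜 d}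
    (h : DR.reducedContraction hf Θ ω = DR.reducedContraction hf Δ ω) : Θ = Δ :=
  (hω.bijOn d).injOn (Set.mem_univ _) (Set.mem_univ _) h

theorem IsBisymplectic.exists_hamiltonian_of_mem (hω : IsBisymplectic hf N ω) {n : ℕ} {d : ℤ}
    (hd : (n : ℤ) - N = d) {a : A} (ha : a ∈ 𝒜 n) :
    ∃ H : DoubleDer f 𝒜 d, DR.reducedContraction hf H ω = Forms.δ f a := by
  subst hd
  exact hω.exists_hamiltonian n ⟨a, ha⟩

/-- Injectivity of `Θ ↦ ι_Θ ω` makes the chosen Hamiltonian irrelevant, so any solution of the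
Hamiltonian equation in the right weight computes the bracket. -/
theorem IsBisymplectic.doubleBracket_eq {n : ℕ} {d : ℤ} (hd : (n : ℤ) - N = d) {a : A}
    (ha : a ∈ 𝒜 n) {H : DoubleDer f 𝒜 d} (hH : DR.reducedContraction hf H ω = Forms.δ f a)
    (b : A) : hω.doubleBracket a b = H.toLin b := by
  classical
  subst hd
  have hcoe : (DirectSum.decompose 𝒜 a n : A) = a := DirectSum.decompose_of_mem_same 𝒜 ha
  have hmain : hω.hamiltonian n (DirectSum.decompose 𝒜 a n) = H := by
    refine hω.inj ((hω.exists_hamiltonian n _).choose_spec.trans ?_)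
    rw [hcoe, hH]
  rw [IsBisymplectic.doubleBracket, Finset.sum_eq_single n, hmain]
  · intro m hm hne
    have h0 : DirectSum.decompose 𝒜 a m = 0 :=
      Subtype.ext (DirectSum.decompose_of_mem_ne 𝒜 ha hne.symm)
    simp [h0] at hm
  -- If `n` is not in the support then `a = 0` and the defining sum is empty, so the double
  -- derivation must be shown to be zero, again by injectivity.
  · intro hn
    have hn : DirectSum.decompose 𝒜 a n = 0 := by simpa using hn
    have ha0 : a = 0 := by rw [← hcoe, hn]; rfl
    obtain ⟨Θ, h1, h2⟩ := exists_doubleDer_zero hf ((n : ℤ) - N)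
    obtain ⟨w, rfl⟩ := Submodule.Quotient.mk_surjective _ ω
    have : H = Θ := hω.inj (by
      rw [hH, ha0, map_zero]
      exact (h2 w).symm)
    rw [hmain, this, h1]
    rfl

end Bracket

theorem TAlg.exists_hamiltonians {k : Type*} [Field k] [CharZero k]
    {B : Type*} [Ring B] [Algebra k B] {E₁ : Type*} [AddCommGroup E₁] [Module k E₁]
    [Module (Env k B) E₁] [IsScalarTower k (Env k B) E₁] {E₂ : Type*} [AddCommGroup E₂]
    [Module k E₂] [Module (Env k B) E₂] [IsScalarTower k (Env k B) E₂] {R : Type*} [Ring R]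
    [Algebra k R] {f : R →ₐ[k] B} {ω : DR (ofR E₁ E₂ f) (part k B E₁ E₂)}
    (hω : IsBisymplectic (ofR_mem E₁ E₂ f) 2 ω) {S : TAlg k B E₁ E₂}
    (hS : S ∈ part k B E₁ E₂ 3) :
    ∃ (w : Forms (ofR E₁ E₂ f)) (h : Hamiltonians w S),
      (∀ e b, hω.doubleBracket (ofE₁ k B E₁ E₂ e) b = (h.HE e).toLin b) ∧
      ∀ e b, hω.doubleBracket (hω.bracket S (ofE₁ k B E₁ E₂ e)) b = (h.HT e).toLin b := by
  -- The calculus takes place on forms, so `ω` is represented by a homogeneous `w`. It is closed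
  -- only modulo commutators, which is all that is needed.
  obtain ⟨w, hw, rfl⟩ := hω.mem_homog
  choose HB hHB using fun b : B =>
    hω.exists_hamiltonian_of_mem (d := -2) (by norm_num) (ofB_mem (E₁ := E₁) (E₂ := E₂) b)
  choose HE hHE using fun e : E₁ =>
    hω.exists_hamiltonian_of_mem (d := -1) (by norm_num) (ofE₁_mem (B := B) (E₂ := E₂) e)
  obtain ⟨HS, hHS⟩ := hω.exists_hamiltonian_of_mem (d := 1) (by norm_num) hS
  have hmem : ∀ e : E₁, HS.toDer (ofE₁ k B E₁ E₂ e) ∈ part k B E₁ E₂ 2 := fun e => by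
    have := mul'_mem_intPart (HS.map_weight 1 _ (ofE₁_mem e))
    rwa [show ((1 : ℕ) + 1 : ℤ) = ((2 : ℕ) : ℤ) by norm_num, intPart_natCast] at this
  choose HT hHT using fun e : E₁ => hω.exists_hamiltonian_of_mem (d := 0) (by norm_num) (hmem e)
  refine ⟨w, ⟨hw, ?_, fun d Θ Δ h => hω.inj h, HB, hHB, HE, hHE, HS, hHS, HT, hHT⟩,
    fun e b => hω.doubleBracket_eq (by norm_num) (ofE₁_mem e) (hHE e) b, fun e b => ?_⟩
  · exact (Submodule.Quotient.mk_eq_zero _).1 hω.closed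
  · have hb : hω.bracket S (ofE₁ k B E₁ E₂ e) = HS.toDer (ofE₁ k B E₁ E₂ e) := by
      rw [IsBisymplectic.bracket, hω.doubleBracket_eq (d := 1) (by norm_num) hS hHS]
      rfl
    rw [hb]
    exact hω.doubleBracket_eq (by norm_num) (hmem e) (hHT e) b

end NCCourant

end

/-! ### The main theorem -/

open scoped TensorProduct in
theorem mainTheorem5
    {k : Type*} [Field k] [CharZero k]
    {R : Type*} [Ring R] [Algebra k R] [FiniteDimensional k R] [IsSemisimpleRing R]
    {B : Type*} [Ring B] [Algebra k B] (f : R →ₐ[k] B) (hB : NCCourant.IsSmooth f)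
    {E₁ : Type*} [AddCommGroup E₁] [Module k E₁] [Module (NCCourant.Env k B) E₁]
    [IsScalarTower k (NCCourant.Env k B) E₁]
    [Module.Finite (NCCourant.Env k B) E₁] [Module.Projective (NCCourant.Env k B) E₁]
    {E₂ : Type*} [AddCommGroup E₂] [Module k E₂] [Module (NCCourant.Env k B) E₂]
    [IsScalarTower k (NCCourant.Env k B) E₂]
    [Module.Finite (NCCourant.Env k B) E₂] [Module.Projective (NCCourant.Env k B) E₂]
    (ω : NCCourant.DR (NCCourant.TAlg.ofR E₁ E₂ f) (NCCourant.TAlg.part k B E₁ E₂))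
    (hω : NCCourant.IsBisymplectic (NCCourant.TAlg.ofR_mem E₁ E₂ f) 2 ω)
    (S : NCCourant.TAlg k B E₁ E₂) (hS : S ∈ NCCourant.TAlg.part k B E₁ E₂ 3) :
    ∃! X : NCCourant.DoublePreCourant f E₁,
      (∀ e₁ e₂ : E₁,
        NCCourant.TAlg.inclBB k B E₁ E₂ (X.inner.toLin e₁ e₂) =
          hω.doubleBracket (NCCourant.TAlg.ofE₁ k B E₁ E₂ e₁)
            (NCCourant.TAlg.ofE₁ k B E₁ E₂ e₂)) ∧
      (∀ (e₁ : E₁) (b : B),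
        NCCourant.TAlg.inclBB k B E₁ E₂ (X.anchor.toLin e₁ b) =
          hω.doubleBracket (hω.bracket S (NCCourant.TAlg.ofE₁ k B E₁ E₂ e₁))
            (NCCourant.TAlg.ofB k B E₁ E₂ b)) ∧
      (∀ e₁ e₂ : E₁,
        NCCourant.TAlg.inclMixed k B E₁ E₂ (X.bracket e₁ e₂) =
          hω.doubleBracket (hω.bracket S (NCCourant.TAlg.ofE₁ k B E₁ E₂ e₁))
            (NCCourant.TAlg.ofE₁ k B E₁ E₂ e₂)) := by
  obtain ⟨w, h, hE, hT⟩ := NCCourant.TAlg.exists_hamiltonians hω hS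
  refine ⟨h.doublePreCourant, ⟨fun e₁ e₂ => ?_, fun e₁ b => ?_, fun e₁ e₂ => ?_⟩, ?_⟩
  · rw [hE]
    exact NCCourant.TAlg.inclBB_pairing (h.HE e₁) e₂
  · rw [hT]
    exact h.inclBB_anchor e₁ b
  · rw [hT]
    exact h.inclMixed_bracket e₁ e₂
  -- The inner product, anchor and bracket are the only data, and each is determined by its image in
  -- `A ⊗ A` because the inclusions are injective.
  · rintro Y ⟨h₁, h₂, h₃⟩
    refine NCCourant.DoublePreCourant.ext ?_ ?_ ?_
    · refine NCCourant.InnerProduct.ext (LinearMap.ext₂ fun e₁ e₂ => ?_)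
      apply NCCourant.TAlg.inclBB_injective (E₁ := E₁) (E₂ := E₂)
      rw [h₁, hE]
      exact (NCCourant.TAlg.inclBB_pairing (h.HE e₁) e₂).symm
    · refine NCCourant.Anchor.ext (LinearMap.ext₂ fun e₁ b => ?_)
      apply NCCourant.TAlg.inclBB_injective (E₁ := E₁) (E₂ := E₂)
      rw [h₂, hT]
      exact (h.inclBB_anchor e₁ b).symm
    · refine LinearMap.ext₂ fun e₁ e₂ => ?_
      apply NCCourant.TAlg.inclMixed_injective (E₁ := E₁) (E₂ := E₂)
      rw [h₃, hT]
      exact (h.inclMixed_bracket e₁ e₂).symm
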